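/- **Setting.** Let $X$ be a finite set of variables with a fixed monomial ordering $\preceq$ on its monomials. A *cone* is a subset of $\mathbb{Q}[X]$ that contains $0$ and is closed under addition and under multiplication by nonnegative rationals; $\mathrm{cone}(G)$ is the least cone containing $G$, and $\mathrm{units}(C)=\{p : p\in C,\ -p\in C\}$. A cone $C$ is *regular* if $1\in C$ and $\mathrm{units}(C)$ is an ideal. For finite $Z,P\subseteq\mathbb{Q}[X]$ put $\mathrm{alg.cone}(Z,P)=\langle Z\rangle+\mathrm{cone}(P)$. For a Gröbner basis $G$, $\mathrm{red}_G(p)$ is the unique $q$ such that $p-q\in\langle G\rangle$ and no monomial of $q$ is divisible by the leading monomial of a nonzero element of $G$. The pair $\langle Z,P\rangle$ is *reduced* if $Z$ is a Gröbner basis with respect to $\preceq$ and $\mathrm{red}_Z(p)=p$ for all $p\in P$. Write $\mathbb{Z}B$ for the set of integer combinations of elements of $B$; a *basis* of $\mathbb{Z}B$ is a finite linearly independent set $B'$ with $\mathbb{Z}B'=\mathbb{Z}B$. A set $C$ is *closed under cutting planes with respect to* $L$ if for all $a,b\in\mathbb{Z}$ with $a>0$ and all $p\in L$, $ap+b\in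 C$ implies $p+\lfloor b/a\rfloor\in C$; $\mathrm{cp}_L(C)$ is the least cone that contains the cone $C$ and is closed under cutting planes with respect to $L$. **Subprocedures.** All choices below (Gröbner bases, lattice bases, auxiliary monomial orderings, order of elimination, generators, units $t$) are arbitrary. - $\mathrm{reduce}(Z,P)$ returns $\langle G,\{\mathrm{red}_G(p): p\in P,\ \mathrm{red}_G(p)\neq 0\}\rangle$ for a finite Gröbner basis $G$ of $\langle Z\rangle$ with respect to $\preceq$. - $\mathrm{saturate}(Q)$ starts with $\langle Z,P\rangle=\langle\emptyset,Q\cup\{1\}\rangle$; as long as there is a nonzero $t\in\mathrm{units}(\mathrm{cone}(P))$ it picks one and replaces $\langle Z,P\rangle$ by $\mathrm{reduce}(Z\cup\{t\},P)$; it then returns $\langle Z,P\rangle$. - $\mathrm{project}_V(Z,P)$, for disjoint finite sets of variables $V,W$ and finite $Z,P\subseteq\mathbb{Q}[V\cup W]$: compute a finite Gröbner basis $G$ of $\langle Z\rangle$ with respect to an ordering eliminating $W$ (compare the $W$-parts of monomials first, then the $V$-parts), and return $G\cap\mathbb{Q}[V]$ together with the result of eliminating from $\{\mathrm{red}_G(p):p\in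 P\}$, one by one by Fourier–Motzkin elimination, all monomials that are not monomials over $V$. - $\mathrm{intersect}(Z_1,P_1,Z_2,P_2)=\mathrm{project}_V(tZ_1\cup(1-t)Z_2,\ tP_1\cup(1-t)P_2)$ for finite $Z_i,P_i\subseteq\mathbb{Q}[V]$ and a new variable $t$. - $\mathrm{cut}(Z,P,B)$: take new variables $Y=\{y_b: b\in B\}$ and the ring homomorphism $\hat f:\mathbb{Q}[Y]\to\mathbb{Q}[X]$, $y_b\mapsto b$. Compute $\langle Z_1,P_1\rangle=\mathrm{project}_Y(\{y-\hat f(y): y\in Y\}\cup Z,\,P)$ (inverse image); let $P_2$ be the second component of $\mathrm{intersect}(Z_1,P_1,\emptyset,Y\cup -Y\cup\{1,-1\})$ (intersection with the polynomials of degree at most one); compute a finite $P_3$ with $\mathrm{cone}(P_3)=\mathrm{cp}_{\mathbb{Z}Y}(\mathrm{cone}(P_2))$ (cutting plane closure of a polyhedral cone); return $\hat f(P_3)$ (image). **Algorithm** $\mathrm{rcp}(Z,P,B)$. Set $\langle Z',P'\rangle\leftarrow\langle Z,P\rangle$ and $B'\leftarrow$ a basis of $\mathbb{Z}B$. Repeat: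 $\langle Z_0,P_0\rangle\leftarrow\langle Z',P'\rangle$; $P_1\leftarrow\mathrm{cut}(Z_0,P_0,B')$; $\langle Z',P'\rangle\leftarrow\mathrm{saturate}(Z_0\cup -Z_0\cup P_0\cup P_1)$; $B'\leftarrow$ a basis of $\mathbb{Z}\{\mathrm{red}_{Z'}(b): b\in B'\}$; until $\mathrm{alg.cone}(Z',P')=\mathrm{alg.cone}(Z_0,P_0)$. Return $\langle Z',P'\rangle$. **Theorem (Regular cutting plane closure).** Let $Z,P,B\subseteq\mathbb{Q}[X]$ be finite with $\langle Z,P\rangle$ reduced. Then $\mathrm{rcp}(Z,P,B)$ terminates: every run is finite, and a run can always be continued until it returns (in particular all objects that the algorithm has to compute, such as the finite set $P_3$, exist). Every pair $\langle Z',P'\rangle$ that a run returns is reduced, and $\mathrm{alg.cone}(Z',P')$ is the least regular cone $C$ that contains $\mathrm{alg.cone}(Z,P)$ and is closed under cutting planes with respect to $\mathrm{units}(C)+\mathbb{Z}B$. -/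

import Mathlib

open scoped Pointwise

universe u v w

noncomputable section

namespace RCP

/-! ### Cones, regular cones, algebraic cones

Cones in `ℚ[X]` are Mathlib's pointed cones (sets that contain zero and are closed under addition
and under multiplication by nonnegative rationals); `PointedCone.hull ℚ G` is the conical hull
of `G`, and `C.lineal` is the set of additive units of `C`. -/

/-- A cone `C ⊆ ℚ[X]` is regular if `1 ∈ C` and its additive units form an ideal of `ℚ[X]`. -/
def IsRegularCone {σ : Type u} (C : PointedCone ℚ (MvPolynomial σ ℚ)) : Prop :=
  1 ∈ C ∧ ∃ I : Ideal (MvPolynomial σ ℚ), (I : Set (MvPolynomial σ ℚ)) = C.lineal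

/-- `alg.cone(Z, P) = ⟨Z⟩ + cone(P)`. -/
def algCone {σ : Type u} (Z P : Finset (MvPolynomial σ ℚ)) :
    PointedCone ℚ (MvPolynomial σ ℚ) :=
  PointedCone.ofSubmodule ((Ideal.span (Z : Set (MvPolynomial σ ℚ))).restrictScalars ℚ) ⊔
    PointedCone.hull ℚ (P : Set (MvPolynomial σ ℚ))

/-! ### Cutting planes -/

/-- The point lattice `ℤB`. -/
def intSpan {σ : Type u} (B : Set (MvPolynomial σ ℚ)) : AddSubgroup (MvPolynomial σ ℚ) :=
  AddSubgroup.closure B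

/-- `C` is closed under cutting planes with respect to `L`. -/
def ClosedUnderCuts {σ : Type u} (L C : Set (MvPolynomial σ ℚ)) : Prop :=
  ∀ a b : ℤ, 0 < a → ∀ p ∈ L,
    (a : MvPolynomial σ ℚ) * p + (b : MvPolynomial σ ℚ) ∈ C →
      p + ((⌊(b : ℚ) / (a : ℚ)⌋ : ℤ) : MvPolynomial σ ℚ) ∈ C

/-- `cp_L(C)`: the least cone that contains `C` and is closed under cutting planes with respect
to `L`. -/
def cpClosure {σ : Type u} (L : Set (MvPolynomial σ ℚ))
    (C : PointedCone ℚ (MvPolynomial σ ℚ)) : PointedCone ℚ (MvPolynomial σ ℚ) :=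
  sInf {D | C ≤ D ∧ ClosedUnderCuts L (D : Set (MvPolynomial σ ℚ))}

/-- The cutting plane closure is indeed the least such cone. -/
theorem isLeast_cpClosure {σ : Type u} (L : Set (MvPolynomial σ ℚ))
    (C : PointedCone ℚ (MvPolynomial σ ℚ)) :
    IsLeast {D : PointedCone ℚ (MvPolynomial σ ℚ) |
      C ≤ D ∧ ClosedUnderCuts L (D : Set (MvPolynomial σ ℚ))} (cpClosure L C) := by
  refine ⟨⟨le_sInf fun D hD => hD.1, ?_⟩, fun D hD => sInf_le hD⟩
  intro a b ha p hp h
  simp only [cpClosure, SetLike.mem_coe, Submodule.mem_sInf] at h ⊢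
  exact fun D hD => hD.2 a b ha p hp (h D hD)

/-! ### Gröbner bases and reduction -/

/-- `G` is a Gröbner basis (of the ideal it generates) with respect to `m`: the leading monomial of
every nonzero element of the ideal is divisible by the leading monomial of some nonzero element
of `G`. -/
def IsGroebner {σ : Type u} (m : MonomialOrder.{u, w} σ) (G : Set (MvPolynomial σ ℚ)) : Prop :=
  ∀ f ∈ Ideal.span G, f ≠ 0 → ∃ g ∈ G, g ≠ 0 ∧ m.degree g ≤ m.degree f

theorem exists_remainder {σ : Type u} (m : MonomialOrder.{u, w} σ) (G : Set (MvPolynomial σ ℚ))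
    (p : MvPolynomial σ ℚ) :
    ∃ r : MvPolynomial σ ℚ, p - r ∈ Ideal.span G ∧
      ∀ d ∈ r.support, ∀ g ∈ G, g ≠ 0 → ¬ m.degree g ≤ d := by
  obtain ⟨c, r, h1, -, h3⟩ := m.div_set (B := {g ∈ G | g ≠ 0})
    (fun b hb => (isUnit_iff_ne_zero.2 (by simpa using hb.2))) p
  refine ⟨r, ?_, fun d hd g hg hg0 => h3 d hd g ⟨hg, hg0⟩⟩
  rw [h1, add_sub_cancel_right, Finsupp.linearCombination_apply]
  refine Ideal.sum_mem _ fun b _ => ?_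
  exact Ideal.mul_mem_left _ _ (Ideal.subset_span b.2.1)

/-- `red_G(p)`: a polynomial that is congruent to `p` modulo `⟨G⟩` and has no monomial divisible by
the leading monomial of an element of `G`. It is unique when `G` is a Gröbner basis. -/
def red {σ : Type u} (m : MonomialOrder.{u, w} σ) (G : Set (MvPolynomial σ ℚ))
    (p : MvPolynomial σ ℚ) : MvPolynomial σ ℚ :=
  Classical.choose (exists_remainder m G p)

/-- `⟨Z, P⟩` is reduced with respect to `m`. -/
def IsReduced {σ : Type u} (m : MonomialOrder.{u, w} σ) (Z P : Finset (MvPolynomial σ ℚ)) : Prop :=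
  IsGroebner m (Z : Set (MvPolynomial σ ℚ)) ∧ ∀ p ∈ P, red m Z p = p

/-- `G` is a (finite) Gröbner basis for the ideal generated by `Z`. -/
def IsGroebnerFor {σ : Type u} (m : MonomialOrder.{u, w} σ)
    (Z G : Finset (MvPolynomial σ ℚ)) : Prop :=
  Ideal.span (G : Set (MvPolynomial σ ℚ)) = Ideal.span (Z : Set (MvPolynomial σ ℚ)) ∧
    IsGroebner m (G : Set (MvPolynomial σ ℚ))

open scoped Classical in
/-- `⟨Z', P'⟩` is a possible result of the procedure `reduce(Z, P)`. -/
def ReduceCone {σ : Type u} (m : MonomialOrder.{u, w} σ)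
    (Z P Z' P' : Finset (MvPolynomial σ ℚ)) : Prop :=
  IsGroebnerFor m Z Z' ∧ P' = (P.image (red m Z')).filter (· ≠ 0)

/-! ### Saturation -/

open scoped Classical in
/-- One iteration of the loop of `saturate`: choose a nonzero additive unit `t` of `cone(P)`,
and replace `⟨Z, P⟩` by `reduce(Z ∪ {t}, P)`. -/
def SaturateStep {σ : Type u} (m : MonomialOrder.{u, w} σ)
    (Z P Z' P' : Finset (MvPolynomial σ ℚ)) : Prop :=
  ∃ t ∈ (PointedCone.hull ℚ (P : Set (MvPolynomial σ ℚ))).lineal,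
    t ≠ 0 ∧ ReduceCone m (Z ∪ {t}) P Z' P'

/-- The exit condition of the loop of `saturate`: zero is the only additive unit of `cone(P)`. -/
def SaturateExit {σ : Type u} (P : Finset (MvPolynomial σ ℚ)) : Prop :=
  ∀ t ∈ (PointedCone.hull ℚ (P : Set (MvPolynomial σ ℚ))).lineal, t = 0

/-! ### Projection -/

/-- The elimination order on the monomials over `α ⊕ β` that eliminates the variables in `β`:
compare the `β`-parts first, and break ties by comparing the `α`-parts. -/
def elimOrder {α : Type u} {β : Type v} (mα : MonomialOrder.{u, u} α)
    (mβ : MonomialOrder.{v, v} β) : MonomialOrder.{max u v, max u v} (α ⊕ β) where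
  syn := mβ.syn ×ₗ mα.syn
  toSyn :=
    { toFun := fun d => toLex (mβ.toSyn (Finsupp.sumFinsuppAddEquivProdFinsupp d).2,
        mα.toSyn (Finsupp.sumFinsuppAddEquivProdFinsupp d).1)
      invFun := fun s => Finsupp.sumFinsuppAddEquivProdFinsupp.symm
        (mα.toSyn.symm (ofLex s).2, mβ.toSyn.symm (ofLex s).1)
      left_inv := fun d => by simp
      right_inv := fun s => by simp
      map_add' := fun d e => by
        simp only [map_add, Prod.fst_add, Prod.snd_add]
        rfl }
  toSyn_monotone := by
    intro d e h
    refine Prod.Lex.toLex_mono ⟨mβ.toSyn_monotone ?_, mα.toSyn_monotone ?_⟩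
    · intro b
      simpa using h (Sum.inr b)
    · intro a
      simpa using h (Sum.inl a)

open scoped Classical in
/-- One step of Fourier–Motzkin elimination, which eliminates the monomial `d`: keep the polynomials
in which `d` does not occur, and add up the pairs of polynomials in which `d`, after scaling,
has the coefficients `1` and `-1`. -/
def fmStep {τ : Type u} (d : τ →₀ ℕ) (P : Finset (MvPolynomial τ ℚ)) :
    Finset (MvPolynomial τ ℚ) :=
  P.filter (fun p => p.coeff d = 0) ∪
    (P.filter (fun p => 0 < p.coeff d) ×ˢ P.filter (fun q => q.coeff d < 0)).image
      (fun pq => (pq.1.coeff d)⁻¹ • pq.1 + (-(pq.2.coeff d))⁻¹ • pq.2)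

open scoped Classical in
/-- `Q` is the result of the polyhedral projection of `P` to the monomials in `N`: the monomials
that occur in `P` and are not in `N` are eliminated one at a time, in some order. -/
def PolyhedralProject {τ : Type u} (P : Finset (MvPolynomial τ ℚ)) (N : Set (τ →₀ ℕ))
    (Q : Finset (MvPolynomial τ ℚ)) : Prop :=
  ∃ l : List (τ →₀ ℕ), l.Nodup ∧
    (∀ d, d ∈ l ↔ (∃ p ∈ P, d ∈ p.support) ∧ d ∉ N) ∧
    Q = l.foldl (fun R d => fmStep d R) P

/-- `Q ∩ ℚ[α]` for a finite set `Q` of polynomials over the variables `α ⊕ β`. -/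
def restrictVars {α : Type u} {β : Type v} (Q : Finset (MvPolynomial (α ⊕ β) ℚ)) :
    Finset (MvPolynomial α ℚ) :=
  Q.preimage (MvPolynomial.rename Sum.inl)
    (MvPolynomial.rename_injective _ Sum.inl_injective).injOn

open scoped Classical in
/-- `⟨Z', P'⟩` is a possible result of `project_α(Z, P)`, where `Z, P ⊆ ℚ[α ⊕ β]`: compute a Gröbner
basis `G` for `⟨Z⟩` with respect to an elimination order, take `G ∩ ℚ[α]`, and project the
reductions of the elements of `P` to the monomials over `α`. -/
def Project {α : Type u} {β : Type v} (Z P : Finset (MvPolynomial (α ⊕ β) ℚ))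
    (Z' P' : Finset (MvPolynomial α ℚ)) : Prop :=
  ∃ (mα : MonomialOrder.{u, u} α) (mβ : MonomialOrder.{v, v} β)
    (G Q : Finset (MvPolynomial (α ⊕ β) ℚ)),
    IsGroebnerFor (elimOrder mα mβ) Z G ∧
    PolyhedralProject (P.image (red (elimOrder mα mβ) G)) {d | ∀ b : β, d (Sum.inr b) = 0} Q ∧
    Z' = restrictVars G ∧ P' = restrictVars Q

/-! ### Intersection, inverse image and cut -/

open scoped Classical in
/-- `t Q₁ ∪ (1 - t) Q₂` for a new variable `t`. -/
def tagged {α : Type u} (Q₁ Q₂ : Finset (MvPolynomial α ℚ)) :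
    Finset (MvPolynomial (α ⊕ Unit) ℚ) :=
  Q₁.image (fun q => MvPolynomial.X (Sum.inr ()) * MvPolynomial.rename Sum.inl q) ∪
    Q₂.image (fun q => (1 - MvPolynomial.X (Sum.inr ())) * MvPolynomial.rename Sum.inl q)

/-- `⟨Z, P⟩` is a possible result of `intersect(Z₁, P₁, Z₂, P₂)`. -/
def Intersect {α : Type u} (Z₁ P₁ Z₂ P₂ Z P : Finset (MvPolynomial α ℚ)) : Prop :=
  Project (tagged Z₁ Z₂) (tagged P₁ P₂) Z P

open scoped Classical in
/-- `Y ∪ -Y ∪ {1, -1}`, which generates the cone of the polynomials of degree at most one. -/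
def linGens (Y : Type u) [Fintype Y] : Finset (MvPolynomial Y ℚ) :=
  Finset.univ.image (fun y : Y => MvPolynomial.X y) ∪
    Finset.univ.image (fun y : Y => -MvPolynomial.X y) ∪ {1, -1}

/-- `P'` is a possible result of `intersect-subspace(Z, P, Y)`: the second component of
`intersect(Z, P, ∅, Y ∪ -Y ∪ {1, -1})`. -/
def IntersectSubspace {Y : Type u} [Fintype Y] (Z P P' : Finset (MvPolynomial Y ℚ)) : Prop :=
  ∃ Z' : Finset (MvPolynomial Y ℚ), Intersect Z P ∅ (linGens Y) Z' P'

open scoped Classical in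
/-- `⟨Z', P'⟩` is a possible result of `inverse-hom(Z, P, f, Y)`, that is, of
`project_Y({y - f(y) : y ∈ Y} ∪ Z, P)`. -/
def InverseHom {σ Y : Type u} [Fintype Y] (Z P : Finset (MvPolynomial σ ℚ))
    (f : MvPolynomial Y ℚ →ₐ[ℚ] MvPolynomial σ ℚ) (Z' P' : Finset (MvPolynomial Y ℚ)) : Prop :=
  Project (α := Y) (β := σ)
    (Finset.univ.image (fun y : Y => MvPolynomial.X (Sum.inl y) -
        MvPolynomial.rename Sum.inr (f (MvPolynomial.X y))) ∪
      Z.image (MvPolynomial.rename Sum.inr))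
    (P.image (MvPolynomial.rename Sum.inr)) Z' P'

/-- `P'` is a possible result of the procedure that computes the cutting plane closure of the
polyhedral cone generated by a finite set `P` of polynomials of degree at most one, with respect
to the lattice `ℤY` of integer combinations of the variables. -/
def CutPolyhedral {Y : Type u} (P P' : Finset (MvPolynomial Y ℚ)) : Prop :=
  PointedCone.hull ℚ (P' : Set (MvPolynomial Y ℚ)) =
    cpClosure (intSpan (Set.range (MvPolynomial.X : Y → MvPolynomial Y ℚ)))
      (PointedCone.hull ℚ (P : Set (MvPolynomial Y ℚ)))

/-- The ring homomorphism `ℚ[Y] → ℚ[X]` that sends the variable `y_b` to `b`, where the set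
`Y = {y_b : b ∈ B}` of fresh variables is indexed by `B`. -/
def evalB {σ : Type u} (B : Finset (MvPolynomial σ ℚ)) :
    MvPolynomial B ℚ →ₐ[ℚ] MvPolynomial σ ℚ :=
  MvPolynomial.aeval (fun b : B => (b : MvPolynomial σ ℚ))

open scoped Classical in
/-- `P'` is a possible result of `cut(Z, P, B)`: inverse image, intersection with the linear
polynomials, cutting plane closure of the resulting polyhedral cone, and image. -/
def Cut {σ : Type u} (Z P B P' : Finset (MvPolynomial σ ℚ)) : Prop :=
  ∃ Z₁ P₁ P₂ P₃ : Finset (MvPolynomial B ℚ),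
    InverseHom Z P (evalB B) Z₁ P₁ ∧
    IntersectSubspace Z₁ P₁ P₂ ∧
    CutPolyhedral P₂ P₃ ∧
    P' = P₃.image (evalB B)

/-! ### The algorithm `rcp` -/

/-- `B'` is a (finite) basis for the point lattice `ℤB`. -/
def IsLatticeBasis {σ : Type u} (B B' : Finset (MvPolynomial σ ℚ)) : Prop :=
  LinearIndependent ℚ (fun b : B' => (b : MvPolynomial σ ℚ)) ∧
    intSpan (B' : Set (MvPolynomial σ ℚ)) = intSpan (B : Set (MvPolynomial σ ℚ))

/-- Configurations of a run of `rcp`. -/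
inductive Config (σ : Type u) : Type u
  /-- The call `rcp(Z, P, B)`. -/
  | start (Z P B : Finset (MvPolynomial σ ℚ))
  /-- The beginning of the body of the outer loop, with current values `⟨Z', P'⟩` and `B'`. -/
  | loop (Z' P' B' : Finset (MvPolynomial σ ℚ))
  /-- The loop of `saturate`, with current values `⟨Z, P⟩`, called from an iteration of the outer
  loop with the values `⟨Z₀, P₀⟩` and `B'`. -/
  | saturating (Z₀ P₀ B' Z P : Finset (MvPolynomial σ ℚ))
  /-- The algorithm has returned `⟨Z', P'⟩`. -/
  | returned (Z' P' : Finset (MvPolynomial σ ℚ))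

open scoped Classical in
/-- The steps of `rcp`. -/
inductive Step {σ : Type u} (m : MonomialOrder.{u, w} σ) : Config σ → Config σ → Prop
  /-- Initialization: `⟨Z', P'⟩ ← ⟨Z, P⟩` and `B' ←` a basis for `ℤB`. -/
  | init {Z P B B' : Finset (MvPolynomial σ ℚ)} (hB : IsLatticeBasis B B') :
      Step m (.start Z P B) (.loop Z P B')
  /-- `⟨Z₀, P₀⟩ ← ⟨Z', P'⟩` and `P₁ ← cut(Z₀, P₀, B')`; then
  `saturate(Q)` is called with `Q = Z₀ ∪ -Z₀ ∪ P₀ ∪ P₁` and starts with `⟨∅, Q ∪ {1}⟩`. -/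
  | cut {Z₀ P₀ B' P₁ : Finset (MvPolynomial σ ℚ)} (hcut : Cut Z₀ P₀ B' P₁) :
      Step m (.loop Z₀ P₀ B')
        (.saturating Z₀ P₀ B' ∅ ((Z₀ ∪ Z₀.image (fun z => -z) ∪ P₀ ∪ P₁) ∪ {1}))
  /-- An iteration of the loop of `saturate`. -/
  | saturate {Z₀ P₀ B' Z P Z₁ P₁ : Finset (MvPolynomial σ ℚ)} (h : SaturateStep m Z P Z₁ P₁) :
      Step m (.saturating Z₀ P₀ B' Z P) (.saturating Z₀ P₀ B' Z₁ P₁)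
  /-- `saturate` has returned `⟨Z', P'⟩`, a basis `B''` for the lattice that is generated by the
  reductions of the elements of `B'` is computed, and the outer loop is repeated. -/
  | again {Z₀ P₀ B' Z' P' B'' : Finset (MvPolynomial σ ℚ)} (hexit : SaturateExit P')
      (hB : IsLatticeBasis (B'.image (red m Z')) B'') (hne : algCone Z' P' ≠ algCone Z₀ P₀) :
      Step m (.saturating Z₀ P₀ B' Z' P') (.loop Z' P' B'')
  /-- As before, but the outer loop is left, and `⟨Z', P'⟩` is returned. -/
  | done {Z₀ P₀ B' Z' P' B'' : Finset (MvPolynomial σ ℚ)} (hexit : SaturateExit P')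
      (hB : IsLatticeBasis (B'.image (red m Z')) B'') (heq : algCone Z' P' = algCone Z₀ P₀) :
      Step m (.saturating Z₀ P₀ B' Z' P') (.returned Z' P')

end RCP

end

namespace RCP

/-! ### Polyhedral cones over the rationals -/

section Polyhedral

variable {V : Type*} [AddCommGroup V] [Module ℚ V]

/-! Affine functions are treated as elements of a rational vector space with a distinguished vector
`e`, the constant one. A cone `C` then describes the polyhedron of all functionals `φ` with `φ e =
1` that are nonnegative on `C`.

The hard existence claim is that the cutting plane closure of a finitely generated cone is finitely
generated (`exists_fg_isLeast_cutClosed`). Suppose `e ∈ C`. If the polyhedron has integral points,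
the closure consists of the functions that are nonnegative at all of them, and finitely many
conditions suffice (`exists_finset_integralHull`, Meyer's theorem). If it has none, cuts derive `-e`
(`neg_unit_mem_of_no_integralPoint`): integral hyperplane sections of the polyhedron are refuted by
induction on the lineality space, and every refuted section lets a cut lower a bound by one. The
same descent shows that cuts reach every integral affine function that is nonnegative at the
integral points.

The elimination theorem and Fourier–Motzkin elimination make `Project` correct
(`Project.mem_algCone`). Hence `Cut` is sound (`Cut.mem_of_cutClosed`) and complete
(`Cut.cutClosed_sup`): the algebraic cone together with the output of a single call is closed under
cuts for the current lattice.

Termination is Noetherian. Within `saturate`, `P` consists of normal forms modulo `Z`, so a nonzero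
unit of its cone lies outside `⟨Z⟩` and the ideal grows (`SaturateStep.span_lt`). An iteration of
the outer loop either enlarges the ideal, or its result is just the old cone plus the cuts plus the
constant one; that cone is already closed, so the next iteration changes nothing (`acc_loop`).

For correctness, every computed cone lies in every regular closed cone `C` above the input, because
cuts are sound and the units of `C` absorb multiples. Reducing the lattice basis changes the lattice
only by units. On exit, the units are exactly the ideal, and completeness of `Cut` gives closedness
(`ConfigInv.step`). -/

theorem hull_induction {S : Set V} {p : V → Prop} (mem : ∀ x ∈ S, p x) (zero : p 0)
    (add : ∀ x y, p x → p y → p (x + y)) (smul : ∀ (c : ℚ) (x : V), 0 ≤ c → p x → p (c • x))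
    {x : V} (hx : x ∈ PointedCone.hull ℚ S) : p x := by
  induction hx using Submodule.span_induction with
  | mem x h => exact mem x h
  | zero => exact zero
  | add x y _ _ hx hy => exact add x y hx hy
  | smul c x _ hx => exact smul c.1 x c.2 hx

theorem hull_le {S : Set V} {C : PointedCone ℚ V} (h : S ⊆ C) : PointedCone.hull ℚ S ≤ C :=
  Submodule.span_le.2 h

theorem hull_mono {S T : Set V} (h : S ⊆ T) : PointedCone.hull ℚ S ≤ PointedCone.hull ℚ T :=
  Submodule.span_mono h

theorem mem_hull {S : Set V} {x : V} (h : x ∈ S) : x ∈ PointedCone.hull ℚ S :=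
  Submodule.subset_span h

theorem smul_mem_cone (C : PointedCone ℚ V) {c : ℚ} (hc : 0 ≤ c) {x : V} (hx : x ∈ C) :
    c • x ∈ C := PointedCone.smul_mem C hc hx

theorem smul_mem_cone_iff (C : PointedCone ℚ V) {c : ℚ} (hc : 0 < c) {x : V} :
    c • x ∈ C ↔ x ∈ C := by
  refine ⟨fun h => ?_, smul_mem_cone C hc.le⟩
  have := smul_mem_cone C (inv_nonneg.2 hc.le) h
  rwa [smul_smul, inv_mul_cancel₀ hc.ne', one_smul] at this

/-- A functional that is nonnegative on generators is nonnegative on the cone. -/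
theorem nonneg_of_mem_hull {S : Set V} {φ : V →ₗ[ℚ] ℚ} (h : ∀ x ∈ S, 0 ≤ φ x) {x : V}
    (hx : x ∈ PointedCone.hull ℚ S) : 0 ≤ φ x := by
  refine hull_induction h (by simp) (fun x y hx hy => ?_) (fun c x hc hx => ?_) hx
  · rw [map_add]; exact add_nonneg hx hy
  · rw [map_smul]; exact mul_nonneg hc hx

/-- The generators that Fourier–Motzkin elimination computes for the section of a cone with the
kernel of `φ`. -/
def fourierMotzkin (φ : V →ₗ[ℚ] ℚ) (S : Set V) : Set V :=
  {s ∈ S | φ s = 0} ∪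
    (fun pq : V × V => (φ pq.1)⁻¹ • pq.1 + (-φ pq.2)⁻¹ • pq.2) ''
      ({s ∈ S | 0 < φ s} ×ˢ {s ∈ S | φ s < 0})

theorem fourierMotzkin_finite (φ : V →ₗ[ℚ] ℚ) {S : Set V} (hS : S.Finite) :
    (fourierMotzkin φ S).Finite :=
  (hS.subset (Set.sep_subset _ _)).union
    (((hS.subset (Set.sep_subset _ _)).prod (hS.subset (Set.sep_subset _ _))).image _)

theorem fourierMotzkin_subset_hull (φ : V →ₗ[ℚ] ℚ) (S : Set V) :
    fourierMotzkin φ S ⊆ PointedCone.hull ℚ S := by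
  rintro x (hx | ⟨⟨p, q⟩, ⟨⟨hp, hp0⟩, hq, hq0⟩, rfl⟩)
  · exact mem_hull hx.1
  · have hq1 : 0 < -φ q := neg_pos.2 hq0
    exact add_mem (smul_mem_cone _ (inv_nonneg.2 (le_of_lt hp0)) (mem_hull hp))
      (smul_mem_cone _ (inv_nonneg.2 hq1.le) (mem_hull hq))

theorem eq_zero_of_mem_fourierMotzkin (φ : V →ₗ[ℚ] ℚ) {S : Set V} {x : V}
    (hx : x ∈ fourierMotzkin φ S) : φ x = 0 := by
  rcases hx with hx | ⟨⟨p, q⟩, ⟨⟨-, hp0⟩, -, hq0⟩, rfl⟩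
  · exact hx.2
  · have hp1 : φ p ≠ 0 := ne_of_gt hp0
    have hq1 : φ q ≠ 0 := ne_of_lt hq0
    simp only [map_add, map_smul, smul_eq_mul]
    field_simp
    ring

theorem eq_zero_of_mem_hull_fourierMotzkin (φ : V →ₗ[ℚ] ℚ) {S : Set V} {x : V}
    (hx : x ∈ PointedCone.hull ℚ (fourierMotzkin φ S)) : φ x = 0 :=
  hull_induction (p := fun x => φ x = 0) (fun _ h => eq_zero_of_mem_fourierMotzkin φ h) (by simp)
    (fun x y hx hy => by rw [map_add, hx, hy, add_zero])
    (fun c x _ hx => by rw [map_smul, hx, smul_zero]) hx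

/-- The combination is bilinear in `y` and `z`, so a double induction reduces to generators, where
it is a positive multiple of a Fourier–Motzkin generator. -/
theorem combine_mem_hull_fourierMotzkin (φ : V →ₗ[ℚ] ℚ) {S : Set V} {y z : V}
    (hy : y ∈ PointedCone.hull ℚ {s ∈ S | 0 < φ s})
    (hz : z ∈ PointedCone.hull ℚ {s ∈ S | φ s < 0}) :
    (-φ z) • y + φ y • z ∈ PointedCone.hull ℚ (fourierMotzkin φ S) := by
  revert z
  refine hull_induction (p := fun y => ∀ {z}, z ∈ PointedCone.hull ℚ {s ∈ S | φ s < 0} →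
    (-φ z) • y + φ y • z ∈ PointedCone.hull ℚ (fourierMotzkin φ S)) ?_ ?_ ?_ ?_ hy
  · intro p hp z hz
    refine hull_induction (p := fun z =>
      (-φ z) • p + φ p • z ∈ PointedCone.hull ℚ (fourierMotzkin φ S)) ?_ ?_ ?_ ?_ hz
    · intro q hq
      have hp1 : φ p ≠ 0 := ne_of_gt hp.2
      have hq1 : -φ q ≠ 0 := ne_of_gt (neg_pos.2 hq.2)
      have h : (-φ q) • p + φ p • q =
          (φ p * -φ q) • ((φ p)⁻¹ • p + (-φ q)⁻¹ • q) := by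
        rw [smul_add, smul_smul, smul_smul]
        congr 2
        · rw [mul_comm, inv_mul_cancel_left₀ hp1]
        · rw [mul_inv_cancel_right₀ hq1]
      rw [h]
      exact smul_mem_cone _ (mul_nonneg hp.2.le (neg_nonneg.2 hq.2.le))
        (mem_hull (Or.inr ⟨(p, q), ⟨hp, hq⟩, rfl⟩))
    · simp
    · intro x y hx hy
      have : (-φ (x + y)) • p + φ p • (x + y) =
          ((-φ x) • p + φ p • x) + ((-φ y) • p + φ p • y) := by
        rw [map_add]; module
      rw [this]; exact add_mem hx hy
    · intro c x hc hx
      have : (-φ (c • x)) • p + φ p • (c • x) = c • ((-φ x) • p + φ p • x) := by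
        rw [map_smul, smul_eq_mul]; module
      rw [this]; exact smul_mem_cone _ hc hx
  · intro z _; simp
  · intro x y hx hy z hz
    have : (-φ z) • (x + y) + φ (x + y) • z =
        ((-φ z) • x + φ x • z) + ((-φ z) • y + φ y • z) := by
      rw [map_add]; module
    rw [this]; exact add_mem (hx hz) (hy hz)
  · intro c x hc hx z hz
    have : (-φ z) • (c • x) + φ (c • x) • z = c • ((-φ z) • x + φ x • z) := by
      rw [map_smul, smul_eq_mul]; module
    rw [this]; exact smul_mem_cone _ hc (hx hz)

theorem pos_of_mem_hull_pos (φ : V →ₗ[ℚ] ℚ) {S : Set V} {y : V}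
    (hy : y ∈ PointedCone.hull ℚ {s ∈ S | 0 < φ s}) : y = 0 ∨ 0 < φ y := by
  refine hull_induction (p := fun y => y = 0 ∨ 0 < φ y) (fun x hx => Or.inr hx.2) (Or.inl rfl)
    ?_ ?_ hy
  · rintro x y (rfl | hx) (rfl | hy)
    · simp
    · simp [hy]
    · simp [hx]
    · right; rw [map_add]; exact add_pos hx hy
  · rintro c x hc (rfl | hx)
    · simp
    · rcases hc.eq_or_lt with rfl | hc
      · simp
      · right; rw [map_smul]; exact mul_pos hc hx

theorem neg_of_mem_hull_neg (φ : V →ₗ[ℚ] ℚ) {S : Set V} {y : V}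
    (hy : y ∈ PointedCone.hull ℚ {s ∈ S | φ s < 0}) : y = 0 ∨ φ y < 0 := by
  have := pos_of_mem_hull_pos (-φ) (S := S) (y := y) (by simpa using hy)
  simpa using this

/-- Every element of a cone is a sum of an element of the section and of an element that is
generated by the generators on one side of the hyperplane. -/
theorem exists_fourierMotzkin_decomposition (φ : V →ₗ[ℚ] ℚ) {S : Set V} {x : V}
    (hx : x ∈ PointedCone.hull ℚ S) :
    ∃ y ∈ PointedCone.hull ℚ (fourierMotzkin φ S), ∃ z, x = y + z ∧
      (z ∈ PointedCone.hull ℚ {s ∈ S | 0 < φ s} ∨ z ∈ PointedCone.hull ℚ {s ∈ S | φ s < 0}) := by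
  have key : ∀ z ∈ PointedCone.hull ℚ {s ∈ S | 0 < φ s},
      ∀ z' ∈ PointedCone.hull ℚ {s ∈ S | φ s < 0},
      ∃ y ∈ PointedCone.hull ℚ (fourierMotzkin φ S), ∃ t, z + z' = y + t ∧
      (t ∈ PointedCone.hull ℚ {s ∈ S | 0 < φ s} ∨ t ∈ PointedCone.hull ℚ {s ∈ S | φ s < 0}) := by
    intro z hz z' hz'
    have hc := combine_mem_hull_fourierMotzkin φ hz hz'
    rcases pos_of_mem_hull_pos φ hz with rfl | h1
    · exact ⟨0, zero_mem _, z', by simp, Or.inr hz'⟩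
    rcases neg_of_mem_hull_neg φ hz' with rfl | h2
    · exact ⟨0, zero_mem _, z, by simp, Or.inl hz⟩
    -- The kernel combination is scaled so that it uses up whichever of `z`, `z'` has the smaller
    -- absolute value under `φ`; a nonnegative multiple of the other one remains.
    rcases le_total (-φ z') (φ z) with h | h
    · refine ⟨(φ z)⁻¹ • ((-φ z') • z + φ z • z'), smul_mem_cone _ (inv_nonneg.2 h1.le) hc,
        (1 - (φ z)⁻¹ * (-φ z')) • z, ?_, Or.inl (smul_mem_cone _ ?_ hz)⟩
      · rw [smul_add, smul_smul, smul_smul, inv_mul_cancel₀ h1.ne']; module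
      · rw [sub_nonneg, inv_mul_le_iff₀ h1, mul_one]; exact h
    · have h3 : 0 < -φ z' := neg_pos.2 h2
      refine ⟨(-φ z')⁻¹ • ((-φ z') • z + φ z • z'), smul_mem_cone _ (inv_nonneg.2 h3.le) hc,
        (1 - (-φ z')⁻¹ * (φ z)) • z', ?_, Or.inr (smul_mem_cone _ ?_ hz')⟩
      · rw [smul_add, smul_smul, smul_smul, inv_mul_cancel₀ h3.ne']; module
      · rw [sub_nonneg, inv_mul_le_iff₀ h3, mul_one]; exact h
  refine hull_induction (p := fun x => ∃ y ∈ PointedCone.hull ℚ (fourierMotzkin φ S), ∃ z,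
    x = y + z ∧ (z ∈ PointedCone.hull ℚ {s ∈ S | 0 < φ s} ∨
      z ∈ PointedCone.hull ℚ {s ∈ S | φ s < 0})) ?_ ?_ ?_ ?_ hx
  · intro x hx
    rcases lt_trichotomy (φ x) 0 with h | h | h
    · exact ⟨0, zero_mem _, x, by simp, Or.inr (mem_hull ⟨hx, h⟩)⟩
    · exact ⟨x, mem_hull (Or.inl ⟨hx, h⟩), 0, by simp, Or.inl (zero_mem _)⟩
    · exact ⟨0, zero_mem _, x, by simp, Or.inl (mem_hull ⟨hx, h⟩)⟩
  · exact ⟨0, zero_mem _, 0, by simp, Or.inl (zero_mem _)⟩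
  · rintro _ _ ⟨y, hy, z, rfl, hz⟩ ⟨y', hy', z', rfl, hz'⟩
    have hsum : y + z + (y' + z') = (y + y') + (z + z') := by abel
    rcases hz with hz | hz <;> rcases hz' with hz' | hz'
    · exact ⟨y + y', add_mem hy hy', z + z', hsum, Or.inl (add_mem hz hz')⟩
    · obtain ⟨a, ha, t, hat, ht⟩ := key z hz z' hz'
      exact ⟨y + y' + a, add_mem (add_mem hy hy') ha, t, by rw [hsum, hat]; abel, ht⟩
    · obtain ⟨a, ha, t, hat, ht⟩ := key z' hz' z hz
      exact ⟨y + y' + a, add_mem (add_mem hy hy') ha, t, by rw [hsum, add_comm z, hat]; abel, ht⟩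
    · exact ⟨y + y', add_mem hy hy', z + z', hsum, Or.inr (add_mem hz hz')⟩
  · rintro c _ hc ⟨y, hy, z, rfl, hz⟩
    exact ⟨c • y, smul_mem_cone _ hc hy, c • z, smul_add _ _ _,
      hz.imp (smul_mem_cone _ hc) (smul_mem_cone _ hc)⟩

/-- A nonzero remainder in the decomposition has a strictly positive or strictly negative value
under `φ`, so it must vanish when the whole sum lies in the kernel. -/
theorem mem_hull_fourierMotzkin (φ : V →ₗ[ℚ] ℚ) {S : Set V} {x : V} :
    x ∈ PointedCone.hull ℚ (fourierMotzkin φ S) ↔ x ∈ PointedCone.hull ℚ S ∧ φ x = 0 := by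
  refine ⟨fun h => ⟨hull_le (fourierMotzkin_subset_hull φ S) h,
    eq_zero_of_mem_hull_fourierMotzkin φ h⟩, ?_⟩
  rintro ⟨h, h0⟩
  obtain ⟨y, hy, z, rfl, hz⟩ := exists_fourierMotzkin_decomposition φ h
  rw [map_add, eq_zero_of_mem_hull_fourierMotzkin φ hy, zero_add] at h0
  have : z = 0 := by
    rcases hz with hz | hz
    · exact (pos_of_mem_hull_pos φ hz).resolve_right (by rw [h0]; exact lt_irrefl _)
    · exact (neg_of_mem_hull_neg φ hz).resolve_right (by rw [h0]; exact lt_irrefl _)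
  rwa [this, add_zero]

/-- The halfspace of the points where `φ` is nonnegative. -/
def halfspace (φ : V →ₗ[ℚ] ℚ) : PointedCone ℚ V :=
  (PointedCone.positive ℚ ℚ).comap φ

@[simp] theorem mem_halfspace {φ : V →ₗ[ℚ] ℚ} {x : V} : x ∈ halfspace φ ↔ 0 ≤ φ x := Iff.rfl

theorem fg_hull {S : Set V} (hS : S.Finite) : (PointedCone.hull ℚ S).FG :=
  Submodule.fg_span hS

/-- In the decomposition along `φ`, a nonzero remainder on the negative side is impossible, so the
section with the kernel and the generators with positive value suffice. -/
theorem fg_inf_halfspace {C : PointedCone ℚ V} (hC : C.FG) (φ : V →ₗ[ℚ] ℚ) :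
    (C ⊓ halfspace φ).FG := by
  obtain ⟨S, rfl⟩ := hC
  have : PointedCone.hull ℚ (S : Set V) ⊓ halfspace φ =
      PointedCone.hull ℚ (fourierMotzkin φ S ∪ {s ∈ (S : Set V) | 0 < φ s}) := by
    refine le_antisymm ?_ (hull_le ?_)
    · rintro x ⟨hx, h0⟩
      obtain ⟨y, hy, z, rfl, hz⟩ := exists_fourierMotzkin_decomposition φ hx
      refine add_mem (hull_mono Set.subset_union_left hy) ?_
      rcases hz with hz | hz
      · exact hull_mono Set.subset_union_right hz
      · rcases neg_of_mem_hull_neg φ hz with rfl | h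
        · exact zero_mem _
        · have h0 : 0 ≤ φ (y + z) := h0
          rw [map_add, eq_zero_of_mem_hull_fourierMotzkin φ hy, zero_add] at h0
          exact absurd h0 (not_le.2 h)
    · rintro x (hx | hx)
      · exact ⟨fourierMotzkin_subset_hull φ _ hx,
          (eq_zero_of_mem_fourierMotzkin φ hx).ge⟩
      · exact ⟨mem_hull hx.1, hx.2.le⟩
  have h := fg_hull ((fourierMotzkin_finite φ S.finite_toSet).union
    (S.finite_toSet.subset (Set.sep_subset _ fun s => 0 < φ s)))
  rw [← this] at h
  exact h

theorem mem_hull_of_mem_span {S T : Set V}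
    (h : ∀ s ∈ S, s ∈ PointedCone.hull ℚ T ∧ -s ∈ PointedCone.hull ℚ T) {x : V}
    (hx : x ∈ Submodule.span ℚ S) : x ∈ PointedCone.hull ℚ T :=
  ((Submodule.span_le (p := (PointedCone.hull ℚ T).lineal)).2 h hx).1

theorem fg_top [FiniteDimensional ℚ V] : (⊤ : PointedCone ℚ V).FG := by
  obtain ⟨S, hS⟩ := (Module.Finite.fg_top : (⊤ : Submodule ℚ V).FG)
  have : PointedCone.hull ℚ ((S : Set V) ∪ -(S : Set V)) = ⊤ := by
    refine eq_top_iff.2 fun x _ => mem_hull_of_mem_span (S := S) (fun s hs => ?_) (hS ▸ trivial)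
    exact ⟨mem_hull (Or.inl hs), mem_hull (Or.inr (by simpa using hs))⟩
  have h := fg_hull (S.finite_toSet.union S.finite_toSet.neg)
  rwa [this] at h

/-- The cone of the points where finitely many functionals are nonnegative, intersected with a
finitely generated cone, is finitely generated. -/
theorem fg_inf_iInf_halfspace {C : PointedCone ℚ V} (hC : C.FG) (T : Finset (V →ₗ[ℚ] ℚ)) :
    ∃ D : PointedCone ℚ V, D.FG ∧ ∀ x, x ∈ D ↔ x ∈ C ∧ ∀ φ ∈ T, 0 ≤ φ x := by
  classical
  induction T using Finset.induction_on with
  | empty => exact ⟨C, hC, by simp⟩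
  | insert φ T _ ih =>
    obtain ⟨D, hD, h⟩ := ih
    refine ⟨D ⊓ halfspace φ, fg_inf_halfspace hD φ, fun x => ?_⟩
    rw [Submodule.mem_inf, h, mem_halfspace, Finset.forall_mem_insert]
    tauto

/-- Farkas' lemma, for an indexed family of generators. -/
theorem farkas_image {ι : Type*} (s : Finset ι) (g : ι → V) (x : V)
    (hx : x ∉ PointedCone.hull ℚ (g '' s)) :
    ∃ φ : V →ₗ[ℚ] ℚ, (∀ i ∈ s, 0 ≤ φ (g i)) ∧ φ x < 0 := by
  classical
  -- The family `g` varies in the induction because the generators get projected; this is the reason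
  -- for indexing them.
  induction s using Finset.induction_on generalizing g x with
  | empty =>
    have hx0 : x ≠ 0 := by rintro rfl; exact hx (zero_mem _)
    obtain ⟨φ, hφ⟩ := not_forall.1 (mt (Module.forall_dual_apply_eq_zero_iff ℚ x).1 hx0)
    rcases lt_or_gt_of_ne hφ with h | h
    · exact ⟨φ, by simp, h⟩
    · exact ⟨-φ, by simp, by simpa using h⟩
  | insert a s ha ih =>
    have hx' : x ∉ PointedCone.hull ℚ (g '' s) := fun h =>
      hx (hull_mono (Set.image_mono (by simp)) h)
    obtain ⟨φ, hφ, hφx⟩ := ih g x hx'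
    rcases le_or_gt 0 (φ (g a)) with h | h
    · exact ⟨φ, by simpa [h] using hφ, hφx⟩
    have hga : g a ∈ PointedCone.hull ℚ (g '' ↑(insert a s)) := mem_hull ⟨a, by simp, rfl⟩
    -- If `φ` separates `x` from the other generators but is negative at `g a`, everything is
    -- projected along `g a` onto the kernel of `φ`. The signs make each original generator differ
    -- from its projection by a multiple of `g a` that goes back into the cone, so the projected `x`
    -- is still outside.
    obtain ⟨ψ, hψ, hψx⟩ := ih (fun i => g i - (φ (g i) / φ (g a)) • g a)
      (x - (φ x / φ (g a)) • g a) (by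
        intro hmem
        apply hx
        have h1 : x - (φ x / φ (g a)) • g a ∈ PointedCone.hull ℚ (g '' ↑(insert a s)) := by
          refine hull_le ?_ hmem
          rintro _ ⟨i, hi, rfl⟩
          have : g i - (φ (g i) / φ (g a)) • g a = g i + (φ (g i) / -φ (g a)) • g a := by
            rw [div_neg]; module
          simp only [this]
          exact add_mem (mem_hull ⟨i, by simp [Finset.mem_coe.1 hi], rfl⟩)
            (smul_mem_cone _ (div_nonneg (hφ i hi) (neg_nonneg.2 h.le)) hga)
        have h2 := add_mem h1 (smul_mem_cone _ (div_pos_of_neg_of_neg hφx h).le hga)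
        simpa using h2)
    refine ⟨ψ ∘ₗ (LinearMap.id - (LinearMap.toSpanSingleton ℚ V (g a)) ∘ₗ ((φ (g a))⁻¹ • φ)),
      ?_, ?_⟩
    · intro i hi
      rcases Finset.mem_insert.1 hi with rfl | hi
      · simp [inv_mul_cancel₀ h.ne]
      · simpa [div_eq_inv_mul] using hψ i hi
    · simpa [div_eq_inv_mul] using hψx

theorem farkas {C : PointedCone ℚ V} (hC : C.FG) {x : V} (hx : x ∉ C) :
    ∃ φ : V →ₗ[ℚ] ℚ, (∀ y ∈ C, 0 ≤ φ y) ∧ φ x < 0 := by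
  obtain ⟨S, rfl⟩ := hC
  obtain ⟨φ, h, hφx⟩ := farkas_image S id x (by simpa using hx)
  exact ⟨φ, fun y hy => nonneg_of_mem_hull h hy, hφx⟩

/-- The dual cone of a finitely generated cone is finitely generated. -/
theorem exists_finset_dual [FiniteDimensional ℚ V] {C : PointedCone ℚ V} (hC : C.FG) :
    ∃ T : Finset (V →ₗ[ℚ] ℚ), ∀ φ : V →ₗ[ℚ] ℚ,
      φ ∈ PointedCone.hull ℚ (T : Set (V →ₗ[ℚ] ℚ)) ↔ ∀ x ∈ C, 0 ≤ φ x := by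
  classical
  obtain ⟨S, rfl⟩ := hC
  -- The dual cone is cut out of the full dual space by the evaluations at the finitely many
  -- generators.
  obtain ⟨D, ⟨T, hT⟩, h⟩ := fg_inf_iInf_halfspace (V := V →ₗ[ℚ] ℚ) fg_top
    (S.image (Module.Dual.eval ℚ V))
  refine ⟨T, fun φ => ?_⟩
  have hT' : PointedCone.hull ℚ (T : Set (V →ₗ[ℚ] ℚ)) = D := hT
  rw [hT', h]
  refine ⟨fun h x hx => nonneg_of_mem_hull (fun y hy => ?_) hx, fun h => ⟨trivial, ?_⟩⟩
  · exact h.2 _ (Finset.mem_image_of_mem _ hy)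
  · intro ψ hψ
    obtain ⟨s, hs, rfl⟩ := Finset.mem_image.1 hψ
    exact h s (mem_hull hs)

/-- By Farkas' lemma, `D` is the intersection of the halfspaces given by generators of its dual
cone, so only finitely many halfspaces have to be intersected with `C`. -/
theorem fg_inf [FiniteDimensional ℚ V] {C D : PointedCone ℚ V} (hC : C.FG) (hD : D.FG) :
    (C ⊓ D).FG := by
  obtain ⟨T, hT⟩ := exists_finset_dual hD
  obtain ⟨E, hE, h⟩ := fg_inf_iInf_halfspace hC T
  have : C ⊓ D = E := by
    ext x
    rw [h, Submodule.mem_inf]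
    refine and_congr_right fun _ => ⟨fun hx φ hφ => (hT φ).1 (mem_hull hφ) x hx, fun hx => ?_⟩
    by_contra hxD
    obtain ⟨φ, hφ, hφx⟩ := farkas hD hxD
    have := nonneg_of_mem_hull (φ := Module.Dual.eval ℚ V x) hx ((hT φ).2 hφ)
    exact absurd this (not_le.2 hφx)
  rwa [this]

end Polyhedral

/-! ### Lattices in rational vector spaces -/

section Lattice

variable {V : Type*} [AddCommGroup V] [Module ℚ V]

/-- A finitely generated subgroup of a rational vector space has a finite basis that is linearly
independent over the rationals. -/
theorem exists_lattice_basis {Λ : AddSubgroup V} (hΛ : Λ.FG) :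
    ∃ B : Finset V, LinearIndependent ℚ (fun b : B => (b : V)) ∧
      AddSubgroup.closure (B : Set V) = Λ := by
  classical
  let L : Submodule ℤ V := AddSubgroup.toIntSubmodule Λ
  have hL : L.FG := by
    rw [Submodule.fg_iff_addSubgroup_fg]
    exact hΛ
  have : Module.Finite ℤ L := Module.Finite.iff_fg.2 hL
  have : Module.IsTorsionFree ℤ V := .trans_faithfulSMul ℤ ℚ V
  have : Module.IsTorsionFree ℤ L := inferInstance
  -- A finitely generated torsion-free abelian group is free, and independence over `ℤ` passes to
  -- the fraction field.
  let b := Module.Free.chooseBasis ℤ L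
  have h1 : LinearIndependent ℤ (fun i => (b i : V)) :=
    b.linearIndependent.map' L.subtype (Submodule.ker_subtype L)
  have h2 : LinearIndependent ℚ (fun i => (b i : V)) := (LinearIndependent.iff_fractionRing ℤ ℚ).1 h1
  refine ⟨Finset.univ.image fun i => (b i : V), ?_, ?_⟩
  · have h3 := h2.linearIndepOn_id
    have h4 : Set.range (fun i => (b i : V)) =
        ((Finset.univ.image fun i => (b i : V) : Finset V) : Set V) := by simp
    rw [h4] at h3
    exact h3
  · have h5 : Submodule.span ℤ (Set.range fun i => (b i : V)) = L := by
      have := congrArg (Submodule.map L.subtype) b.span_eq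
      rw [Submodule.map_span, ← Set.range_comp, Submodule.map_subtype_top] at this
      exact this
    have h6 := congrArg Submodule.toAddSubgroup h5
    rw [Submodule.span_int_eq_addSubgroupClosure] at h6
    rw [Finset.coe_image, Finset.coe_univ, Set.image_univ]
    exact h6

/-- Every functional becomes integral on a finitely generated subgroup after scaling. -/
theorem exists_integral_multiple {Λ : AddSubgroup V} (hΛ : Λ.FG) (φ : V →ₗ[ℚ] ℚ) :
    ∃ N : ℕ, 0 < N ∧ ∀ p ∈ Λ, ∃ n : ℤ, (N : ℚ) * φ p = n := by
  classical
  obtain ⟨S, rfl⟩ := hΛ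
  have hS : ∃ N : ℕ, 0 < N ∧ ∀ p ∈ S, ∃ n : ℤ, (N : ℚ) * φ p = n := by
    induction S using Finset.induction_on with
    | empty => exact ⟨1, one_pos, by simp⟩
    | insert a S _ ih =>
      obtain ⟨N, hN, h⟩ := ih
      refine ⟨N * (φ a).den, Nat.mul_pos hN (φ a).den_pos, ?_⟩
      intro p hp
      rcases Finset.mem_insert.1 hp with rfl | hp
      · refine ⟨N * (φ p).num, ?_⟩
        push_cast
        rw [mul_assoc, Rat.den_mul_eq_num]
      · obtain ⟨n, hn⟩ := h p hp
        refine ⟨n * (φ a).den, ?_⟩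
        push_cast
        rw [← hn]; ring
  obtain ⟨N, hN, h⟩ := hS
  refine ⟨N, hN, fun p hp => ?_⟩
  induction hp using AddSubgroup.closure_induction with
  | mem x hx => exact h x hx
  | zero => exact ⟨0, by simp⟩
  | add x y _ _ hx hy =>
    obtain ⟨a, ha⟩ := hx
    obtain ⟨b, hb⟩ := hy
    exact ⟨a + b, by rw [map_add, mul_add, ha, hb]; push_cast; rfl⟩
  | neg x _ hx =>
    obtain ⟨a, ha⟩ := hx
    exact ⟨-a, by rw [map_neg, mul_neg, ha]; push_cast; rfl⟩

/-- A functional that is integral on the intersection of a finitely generated subgroup with a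
subspace can be changed outside of the subspace so as to become integral on the subgroup. -/
theorem exists_integral_extension {Λ : AddSubgroup V} (hΛ : Λ.FG) (W : Submodule ℚ V)
    (φ : V →ₗ[ℚ] ℚ) (hφ : ∀ p ∈ Λ, p ∈ W → ∃ n : ℤ, φ p = n) :
    ∃ ψ : V →ₗ[ℚ] ℚ, (∀ x ∈ W, ψ x = φ x) ∧ ∀ p ∈ Λ, ∃ n : ℤ, ψ p = n := by
  -- The image of `Λ` modulo `W` has a lattice basis; lifts of this basis together with `Λ ∩ W`
  -- generate `Λ`.
  have hfg : (Λ.map (W.mkQ.toAddMonoidHom : V →+ V ⧸ W)).FG := by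
    classical
    obtain ⟨S, rfl⟩ := hΛ
    exact ⟨S.image W.mkQ.toAddMonoidHom, by rw [AddMonoidHom.map_closure, Finset.coe_image]⟩
  obtain ⟨B, hli, hB⟩ := exists_lattice_basis hfg
  have hlift : ∀ b : B, ∃ p ∈ Λ, W.mkQ p = b.1 := by
    intro b
    have hb : b.1 ∈ AddSubgroup.map (W.mkQ.toAddMonoidHom : V →+ V ⧸ W) Λ := by
      rw [← hB]; exact AddSubgroup.subset_closure b.2
    exact hb
  choose l hlΛ hl using hlift
  -- The correction factors through the quotient, so it leaves `φ` unchanged on `W`, and it makes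
  -- the value at each lifted basis vector zero.
  obtain ⟨θ, hθ⟩ : ∃ θ : V ⧸ W →ₗ[ℚ] ℚ, ∀ b : B, θ b = -φ (l b) := by
    obtain ⟨θ, hθ⟩ := LinearMap.exists_extend
      ((Module.Basis.span hli).constr ℚ (fun b => -φ (l b)))
    refine ⟨θ, fun b => ?_⟩
    have h1 := LinearMap.congr_fun hθ (Module.Basis.span hli b)
    rw [Module.Basis.constr_basis, LinearMap.comp_apply, Submodule.subtype_apply,
      Module.Basis.span_apply] at h1
    exact h1
  refine ⟨φ + θ ∘ₗ W.mkQ, ?_, ?_⟩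
  · intro x hx
    have : W.mkQ x = 0 := by simpa using hx
    simp only [LinearMap.add_apply, LinearMap.comp_apply, this, map_zero, add_zero]
  · intro p hp
    have key : ∀ x ∈ AddSubgroup.closure (B : Set (V ⧸ W)), ∃ q ∈ Λ, W.mkQ q = x ∧
        ∃ n : ℤ, (φ + θ ∘ₗ W.mkQ) q = n := by
      intro x hx
      induction hx using AddSubgroup.closure_induction with
      | mem x hx =>
        refine ⟨l ⟨x, hx⟩, hlΛ _, hl _, 0, ?_⟩
        rw [LinearMap.add_apply, LinearMap.comp_apply, hl, hθ ⟨x, hx⟩]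
        simp
      | zero => exact ⟨0, Λ.zero_mem, by simp, 0, by simp⟩
      | add x y _ _ hx hy =>
        obtain ⟨q, hq, rfl, n, hn⟩ := hx
        obtain ⟨q', hq', rfl, n', hn'⟩ := hy
        exact ⟨q + q', Λ.add_mem hq hq', map_add _ _ _, n + n', by
          rw [map_add, hn, hn']; push_cast; rfl⟩
      | neg x _ hx =>
        obtain ⟨q, hq, rfl, n, hn⟩ := hx
        exact ⟨-q, Λ.neg_mem hq, map_neg _ _, -n, by rw [map_neg, hn]; push_cast; rfl⟩
    obtain ⟨q, hq, hqp, n, hn⟩ := key (W.mkQ p) (by rw [hB]; exact ⟨p, hp, rfl⟩)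
    have hW : p - q ∈ W := by
      rw [← Submodule.Quotient.mk_eq_zero, ← Submodule.mkQ_apply, map_sub, hqp, sub_self]
    obtain ⟨k, hk⟩ := hφ (p - q) (Λ.sub_mem hp hq) hW
    refine ⟨k + n, ?_⟩
    have h0 : W.mkQ (p - q) = 0 := by rw [map_sub, hqp, sub_self]
    have : (φ + θ ∘ₗ W.mkQ) (p - q) = k := by
      simp only [LinearMap.add_apply, LinearMap.comp_apply, h0, map_zero, add_zero, hk]
    rw [map_sub, hn] at this
    push_cast
    linarith

theorem exists_nsmul_mem_of_mem_span {Λ : AddSubgroup V} {x : V}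
    (hx : x ∈ Submodule.span ℚ (Λ : Set V)) : ∃ N : ℕ, 0 < N ∧ (N : ℚ) • x ∈ Λ := by
  induction hx using Submodule.span_induction with
  | mem x h => exact ⟨1, one_pos, by simpa using h⟩
  | zero => exact ⟨1, one_pos, by simp⟩
  | add x y _ _ hx hy =>
    obtain ⟨N, hN, h⟩ := hx
    obtain ⟨M, hM, h'⟩ := hy
    refine ⟨N * M, Nat.mul_pos hN hM, ?_⟩
    have : ((N * M : ℕ) : ℚ) • (x + y) = M • ((N : ℚ) • x) + N • ((M : ℚ) • y) := by
      rw [← Nat.cast_smul_eq_nsmul ℚ, ← Nat.cast_smul_eq_nsmul ℚ]; push_cast; module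
    rw [this]
    exact Λ.add_mem (Λ.nsmul_mem h _) (Λ.nsmul_mem h' _)
  | smul c x _ hx =>
    obtain ⟨N, hN, h⟩ := hx
    refine ⟨N * c.den, Nat.mul_pos hN c.den_pos, ?_⟩
    have : ((N * c.den : ℕ) : ℚ) • (c • x) = c.num • ((N : ℚ) • x) := by
      rw [← Int.cast_smul_eq_zsmul ℚ, smul_smul, smul_smul]
      congr 1
      push_cast
      rw [mul_assoc, Rat.den_mul_eq_num, mul_comm]
    rw [this]
    exact Λ.zsmul_mem h _

end Lattice

/-! ### Cutting planes in rational vector spaces -/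

section Cutting

variable {V : Type*} [AddCommGroup V] [Module ℚ V]

/-- The cone `E` is closed under cutting planes with respect to the subgroup `Λ`, where `e` plays
the role of the constant function one. -/
def CutClosed (e : V) (Λ : AddSubgroup V) (E : PointedCone ℚ V) : Prop :=
  ∀ p ∈ Λ, ∀ c : ℚ, p + c • e ∈ E → p + ((⌊c⌋ : ℤ) : ℚ) • e ∈ E

/-- `φ` is an integral point of the polyhedron that is described by the cone `C` of affine
functions. -/
structure IsIntegralPoint (e : V) (Λ : AddSubgroup V) (C : PointedCone ℚ V)
    (φ : V →ₗ[ℚ] ℚ) : Prop where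
  map_unit : φ e = 1
  nonneg : ∀ x ∈ C, 0 ≤ φ x
  integral : ∀ p ∈ Λ, ∃ n : ℤ, φ p = n

variable {e : V} {Λ : AddSubgroup V} {C E : PointedCone ℚ V}

theorem mem_sup_hull_singleton {g x : V} :
    x ∈ E ⊔ PointedCone.hull ℚ {g} ↔ ∃ s : ℚ, 0 ≤ s ∧ x - s • g ∈ E := by
  rw [Submodule.mem_sup]
  constructor
  · rintro ⟨y, hy, z, hz, rfl⟩
    obtain ⟨a, rfl⟩ := Submodule.mem_span_singleton.1 hz
    refine ⟨a.1, a.2, ?_⟩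
    have : y + a • g - a.1 • g = y := by
      rw [show a • g = a.1 • g from rfl]; abel
    rwa [this]
  · rintro ⟨s, hs, h⟩
    exact ⟨_, h, s • g, smul_mem_cone _ hs (mem_hull rfl), by abel⟩

theorem add_unit_mem (he : e ∈ E) {x : V} {c d : ℚ} (hcd : c ≤ d) (h : x + c • e ∈ E) :
    x + d • e ∈ E := by
  have : x + d • e = (x + c • e) + (d - c) • e := by module
  rw [this]
  exact add_mem h (smul_mem_cone _ (sub_nonneg.2 hcd) he)

theorem neg_unit_mem_of_smul_mem {c : ℚ} (hc : c < 0) (h : c • e ∈ E) : -e ∈ E := by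
  have : c • e = (-c) • (-e) := by module
  rw [this] at h
  exact (smul_mem_cone_iff E (neg_pos.2 hc)).1 h

/-- Once `-e` is available (the polyhedron is empty), any constant may be subtracted, so rounding
down is free. -/
theorem cutClosed_of_neg_unit_mem (h2 : -e ∈ E) : CutClosed e Λ E := by
  intro p _ c hc
  have : p + ((⌊c⌋ : ℤ) : ℚ) • e = (p + c • e) + (c - (⌊c⌋ : ℤ)) • (-e) := by module
  rw [this]
  exact add_mem hc (smul_mem_cone _ (sub_nonneg.2 (Int.floor_le c)) h2)

/-- A face of a cone that is closed under cutting planes is closed under cutting planes. -/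
theorem CutClosed.sup_neg (hE : CutClosed e Λ E) {p : V} (hp : p ∈ Λ) {k : ℤ}
    (hf : p + (k : ℚ) • e ∈ E) :
    CutClosed e Λ (E ⊔ PointedCone.hull ℚ {-(p + (k : ℚ) • e)}) := by
  intro q hq c hc
  rw [mem_sup_hull_singleton] at hc ⊢
  obtain ⟨s, hs, h⟩ := hc
  -- Since `p + k e` lies in `E`, its multiplier `s` may be increased to an integer. An integer
  -- multiple of `p + k e` has its linear part in `Λ` and an integral constant, which commutes with
  -- the floor.
  refine ⟨(⌈s⌉₊ : ℚ), by positivity, ?_⟩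
  have h1 : (q + ⌈s⌉₊ • p) + (c + ((⌈s⌉₊ * k : ℤ) : ℚ)) • e ∈ E := by
    have : (q + ⌈s⌉₊ • p) + (c + ((⌈s⌉₊ * k : ℤ) : ℚ)) • e =
        (q + c • e - s • -(p + (k : ℚ) • e)) + (⌈s⌉₊ - s : ℚ) • (p + (k : ℚ) • e) := by
      rw [← Nat.cast_smul_eq_nsmul ℚ]; push_cast; module
    rw [this]
    exact add_mem h (smul_mem_cone _ (sub_nonneg.2 (Nat.le_ceil s)) hf)
  have h2 := hE _ (Λ.add_mem hq (Λ.nsmul_mem hp _)) _ h1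
  rw [Int.floor_add_intCast] at h2
  have h3 : q + ((⌊c⌋ : ℤ) : ℚ) • e - (⌈s⌉₊ : ℚ) • -(p + (k : ℚ) • e) =
      q + ⌈s⌉₊ • p + ((⌊c⌋ + ⌈s⌉₊ * k : ℤ) : ℚ) • e := by
    rw [← Nat.cast_smul_eq_nsmul ℚ]; push_cast; module
  rw [h3]
  exact h2

/-- If the face that is cut out by `p + k e` is empty, then the inequality `p + k e ≥ 0` can be
strengthened. -/
theorem CutClosed.sub_unit_mem (hE : CutClosed e Λ E) (he : e ∈ E) {p : V} (hp : p ∈ Λ) {k : ℤ}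
    (hf : p + (k : ℚ) • e ∈ E)
    (h : -e ∈ E ⊔ PointedCone.hull ℚ {-(p + (k : ℚ) • e)}) :
    p + ((k - 1 : ℤ) : ℚ) • e ∈ E := by
  rw [mem_sup_hull_singleton] at h
  obtain ⟨s, hs, h⟩ := h
  rcases hs.eq_or_lt with rfl | hs
  · have : p + ((k - 1 : ℤ) : ℚ) • e = (p + (k : ℚ) • e) + (-e - (0 : ℚ) • -(p + (k : ℚ) • e)) := by
      push_cast; module
    rw [this]
    exact add_mem hf h
  -- Dividing by `s` improves the constant by a positive amount, and the cut turns this into an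
  -- improvement by at least one.
  · have h1 : p + ((k : ℚ) - s⁻¹) • e ∈ E := by
      have : p + ((k : ℚ) - s⁻¹) • e = s⁻¹ • (-e - s • -(p + (k : ℚ) • e)) := by
        rw [smul_sub, smul_smul, inv_mul_cancel₀ hs.ne']; module
      rw [this]
      exact smul_mem_cone _ (inv_nonneg.2 hs.le) h
    refine add_unit_mem he ?_ (hE p hp _ h1)
    have : ⌊(k : ℚ) - s⁻¹⌋ < k := Int.floor_lt.2 (by have := inv_pos.2 hs; linarith)
    exact_mod_cast Int.le_sub_one_of_lt this

/-- The construction of an integral point of a polyhedron that is unbounded in all directions in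
which it is not constant. -/
theorem exists_integralPoint (hΛ : Λ.FG)
    (hspan : Submodule.span ℚ (Λ : Set V) ⊔ Submodule.span ℚ {e} = ⊤)
    (hC : C.FG) (heC : e ∈ C) (hne : -e ∉ C)
    (hbdd : ∀ p ∈ Λ, ∀ M N : ℚ, p + M • e ∈ C → -p + N • e ∈ C →
      p ∈ C.lineal ⊔ Submodule.span ℚ {e})
    (hint : ∀ p ∈ Λ, ∀ c : ℚ, p - c • e ∈ C.lineal → ∃ n : ℤ, c = n) :
    ∃ φ, IsIntegralPoint e Λ C φ := by
  classical
  set W := C.lineal ⊔ Submodule.span ℚ {e} with hW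
  obtain ⟨φ, hφC, hφe⟩ : ∃ φ : V →ₗ[ℚ] ℚ, (∀ x ∈ C, 0 ≤ φ x) ∧ φ e = 1 := by
    obtain ⟨φ, h1, h2⟩ := farkas hC hne
    have h3 : 0 < φ e := by simpa using h2
    refine ⟨(φ e)⁻¹ • φ, fun x hx => mul_nonneg (inv_nonneg.2 h3.le) (h1 x hx), ?_⟩
    exact inv_mul_cancel₀ h3.ne'
  have hzero : ∀ φ : V →ₗ[ℚ] ℚ, (∀ x ∈ C, 0 ≤ φ x) → ∀ x ∈ C.lineal, φ x = 0 := by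
    intro φ h x hx
    have h1 := h x hx.1
    have h2 := h (-x) hx.2
    rw [map_neg] at h2
    linarith
  -- A point of the polyhedron is already integral on `Λ ∩ W`, because `hint` makes the constant
  -- values there integers. It is made integral on all of `Λ` at the price of nonnegativity outside
  -- of `W`.
  obtain ⟨φ₁, hφ₁W, hφ₁Λ⟩ := exists_integral_extension hΛ W φ (by
    intro p hp hpW
    obtain ⟨x, hx, y, hy, rfl⟩ := Submodule.mem_sup.1 hpW
    obtain ⟨c, rfl⟩ := Submodule.mem_span_singleton.1 hy
    obtain ⟨n, hn⟩ := hint _ hp c (by simpa using hx)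
    exact ⟨n, by rw [map_add, hzero φ hφC x hx, map_smul, hφe, hn]; simp⟩)
  obtain ⟨S, rfl⟩ := hC
  change ∀ x ∈ PointedCone.hull ℚ (S : Set V), 0 ≤ φ x at hφC
  change e ∈ PointedCone.hull ℚ (S : Set V) at heC
  -- For each generator outside of `W` there is a recession direction along which it increases:
  -- otherwise the generator would be bounded from both sides, and `hbdd`, applied to a multiple of
  -- its lattice part, would place it in `W`.
  have hψ : ∀ g ∈ S, g ∉ W → ∃ ψ : V →ₗ[ℚ] ℚ,
      (∀ x ∈ PointedCone.hull ℚ (S : Set V), 0 ≤ ψ x) ∧ ψ e = 0 ∧ 0 < ψ g := by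
    intro g hg hgW
    have hfg : (PointedCone.hull ℚ (S : Set V) ⊔ PointedCone.hull ℚ {-e}).FG :=
      (fg_hull S.finite_toSet).sup (fg_hull (Set.finite_singleton _))
    have hng : -g ∉ PointedCone.hull ℚ (S : Set V) ⊔ PointedCone.hull ℚ {-e} := by
      intro h
      apply hgW
      obtain ⟨s, hs, h⟩ := mem_sup_hull_singleton.1 h
      have hgt : g ∈ Submodule.span ℚ (Λ : Set V) ⊔ Submodule.span ℚ {e} := by
        rw [hspan]; trivial
      obtain ⟨x, hx, y, hy, hxy⟩ := Submodule.mem_sup.1 hgt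
      obtain ⟨c, rfl⟩ := Submodule.mem_span_singleton.1 hy
      obtain ⟨N, hN, hNx⟩ := exists_nsmul_mem_of_mem_span hx
      have hN' : (0 : ℚ) < N := by exact_mod_cast hN
      have h1 : (N : ℚ) • x ∈ W := by
        refine hbdd _ hNx (N * c) (N * s - N * c) ?_ ?_
        · have : (N : ℚ) • x + (N * c : ℚ) • e = (N : ℚ) • g := by rw [← hxy]; module
          rw [this]
          exact smul_mem_cone _ hN'.le (mem_hull hg)
        · have : -((N : ℚ) • x) + (N * s - N * c : ℚ) • e = (N : ℚ) • (-g - s • -e) := by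
            rw [← hxy]; module
          rw [this]
          exact smul_mem_cone _ hN'.le h
      have h2 : x ∈ W := by
        have := W.smul_mem (N : ℚ)⁻¹ h1
        rwa [smul_smul, inv_mul_cancel₀ hN'.ne', one_smul] at this
      rw [← hxy]
      exact W.add_mem h2 (W.smul_mem _ (Submodule.mem_sup_right (Submodule.mem_span_singleton_self e)))
    obtain ⟨ψ, h1, h2⟩ := farkas hfg hng
    refine ⟨ψ, fun x hx => h1 x (Submodule.mem_sup_left hx), le_antisymm ?_ ?_, by simpa using h2⟩
    · have := h1 (-e) (Submodule.mem_sup_right (mem_hull rfl))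
      simpa using this
    · exact h1 e (Submodule.mem_sup_left heC)
  -- a single functional that is positive on all generators outside of `W`
  obtain ⟨ψ, hψC, hψe, hψpos⟩ : ∃ ψ : V →ₗ[ℚ] ℚ,
      (∀ x ∈ PointedCone.hull ℚ (S : Set V), 0 ≤ ψ x) ∧ ψ e = 0 ∧
      ∀ g ∈ S, g ∉ W → 0 < ψ g := by
    choose! ψ h1 h2 h3 using hψ
    refine ⟨∑ g ∈ S.filter (· ∉ W), ψ g, ?_, ?_, ?_⟩
    · intro x hx
      rw [LinearMap.sum_apply]
      exact Finset.sum_nonneg fun g hg =>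
        h1 g (Finset.mem_filter.1 hg).1 (Finset.mem_filter.1 hg).2 x hx
    · rw [LinearMap.sum_apply]
      exact Finset.sum_eq_zero fun g hg => h2 g (Finset.mem_filter.1 hg).1 (Finset.mem_filter.1 hg).2
    · intro g hg hgW
      rw [LinearMap.sum_apply]
      refine Finset.sum_pos' (fun i hi => ?_) ⟨g, Finset.mem_filter.2 ⟨hg, hgW⟩, h3 g hg hgW⟩
      exact h1 i (Finset.mem_filter.1 hi).1 (Finset.mem_filter.1 hi).2 g (mem_hull hg)
  obtain ⟨N, hN, hNψ⟩ := exists_integral_multiple hΛ ψ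
  have hN' : (0 : ℚ) < N := by exact_mod_cast hN
  -- Moving far enough from `φ₁` in the integral recession direction `N ψ` restores nonnegativity at
  -- the generators outside of `W`.
  obtain ⟨T, hT⟩ : ∃ T : ℕ, ∀ g ∈ S, g ∉ W → 0 ≤ φ₁ g + T * (N * ψ g) := by
    obtain ⟨T, hT⟩ := (S.image fun g => ⌈-φ₁ g / (N * ψ g)⌉₊).exists_le
    refine ⟨T, fun g hg hgW => ?_⟩
    have h1 : -φ₁ g / (N * ψ g) ≤ T := (Nat.le_ceil _).trans
      (by exact_mod_cast hT _ (Finset.mem_image_of_mem _ hg))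
    rw [div_le_iff₀ (mul_pos hN' (hψpos g hg hgW))] at h1
    linarith
  refine ⟨φ₁ + (T * N : ℚ) • ψ, ?_, fun x hx => nonneg_of_mem_hull (fun g hg => ?_) hx, ?_⟩
  · have heW : e ∈ W := Submodule.mem_sup_right (Submodule.mem_span_singleton_self e)
    simp [hφ₁W e heW, hφe, hψe]
  · by_cases hgW : g ∈ W
    · have h1 : 0 ≤ φ₁ g := by rw [hφ₁W g hgW]; exact hφC g (mem_hull hg)
      have h2 := hψC g (mem_hull hg)
      simp only [LinearMap.add_apply, LinearMap.smul_apply, smul_eq_mul]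
      positivity
    · have := hT g hg hgW
      simp only [LinearMap.add_apply, LinearMap.smul_apply, smul_eq_mul]
      linarith
  · intro p hp
    obtain ⟨a, ha⟩ := hφ₁Λ p hp
    obtain ⟨b, hb⟩ := hNψ p hp
    refine ⟨a + T * b, ?_⟩
    simp only [LinearMap.add_apply, LinearMap.smul_apply, smul_eq_mul, ha]
    push_cast
    rw [← hb]; ring

/-- Cutting planes refute every polyhedron without integral points. -/
theorem neg_unit_mem_of_no_integralPoint [FiniteDimensional ℚ V] (hΛ : Λ.FG)
    (hspan : Submodule.span ℚ (Λ : Set V) ⊔ Submodule.span ℚ {e} = ⊤)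
    (hC : C.FG) (heC : e ∈ C) (hno : ∀ φ, ¬ IsIntegralPoint e Λ C φ)
    (hE : CutClosed e Λ E) (hCE : C ≤ E) : -e ∈ E := by
  -- Setting an inequality to equality enlarges the lineality space of the cone, which can happen
  -- only finitely often in finite dimension.
  induction hL : C.lineal using WellFoundedGT.induction generalizing C E with
  | ind L ih =>
  subst hL
  by_contra hneE
  have hne : -e ∉ C := fun h => hneE (hCE h)
  obtain ⟨φ, hφ⟩ : ∃ φ, IsIntegralPoint e Λ C φ := by
    refine exists_integralPoint hΛ hspan hC heC hne ?_ ?_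
    · intro p hp M N hM hN
      by_contra hpW
      -- A bounded but nonconstant `p` allows descent: the section where `p` equals `⌈N⌉ - n` is
      -- refuted by induction, so the upper bound drops by one, until it contradicts the lower bound
      -- `-M`.
      have hdesc : ∀ n : ℕ, -p + ((⌈N⌉ - n : ℤ) : ℚ) • e ∈ E := by
        intro n
        induction n with
        | zero => exact add_unit_mem (hCE heC) (by simpa using Int.le_ceil N) (hCE hN)
        | succ n ihn =>
          set f := -p + ((⌈N⌉ - n : ℤ) : ℚ) • e with hf
          have hfL : f ∉ C.lineal := by
            intro h
            apply hpW
            have : p = -f + ((⌈N⌉ - n : ℤ) : ℚ) • e := by rw [hf]; module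
            rw [this]
            exact Submodule.add_mem_sup (C.lineal.neg_mem h)
              (Submodule.smul_mem _ _ (Submodule.mem_span_singleton_self e))
          have hle : C ⊔ PointedCone.hull ℚ {f, -f} ≤ E ⊔ PointedCone.hull ℚ {-f} := by
            refine sup_le (hCE.trans le_sup_left) (hull_le ?_)
            rintro x (rfl | rfl)
            · exact Submodule.mem_sup_left ihn
            · exact Submodule.mem_sup_right (mem_hull rfl)
          have h1 : -e ∈ E ⊔ PointedCone.hull ℚ {-f} := by
            refine ih _ ?_ (C := C ⊔ PointedCone.hull ℚ {f, -f})
              (hC.sup (fg_hull (Set.toFinite _))) (Submodule.mem_sup_left heC) ?_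
              (hE.sup_neg (Λ.neg_mem hp) ihn) hle rfl
            · refine lt_of_le_of_ne
                (fun x hx => ⟨Submodule.mem_sup_left hx.1, Submodule.mem_sup_left hx.2⟩) ?_
              intro heq
              apply hfL
              rw [heq]
              exact ⟨Submodule.mem_sup_right (mem_hull (by simp)),
                Submodule.mem_sup_right (mem_hull (by simp))⟩
            · intro φ hφ
              exact hno φ ⟨hφ.1, fun x hx => hφ.2 x (Submodule.mem_sup_left hx), hφ.3⟩
          have h2 := hE.sub_unit_mem (hCE heC) (Λ.neg_mem hp) ihn h1
          have h3 : (⌈N⌉ - (n + 1 : ℕ) : ℤ) = ⌈N⌉ - n - 1 := by push_cast; ring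
          rw [h3]; exact h2
      obtain ⟨n, hn⟩ := exists_nat_gt ((⌈N⌉ : ℚ) + M)
      have h4 := add_mem (hdesc n) (hCE hM)
      have h5 : -p + ((⌈N⌉ - n : ℤ) : ℚ) • e + (p + M • e) = ((⌈N⌉ : ℚ) - n + M) • e := by
        push_cast; module
      rw [h5] at h4
      exact hneE (neg_unit_mem_of_smul_mem (by linarith) h4)
    -- If `p = c` holds on the polyhedron with `c` not an integer, then rounding `-c` down and
    -- subtracting the equation leaves a negative multiple of `e`.
    · intro p hp c hpc
      by_contra hc
      have h1 : p + (-c) • e ∈ E := by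
        have : p + (-c) • e = p - c • e := by module
        rw [this]; exact hCE hpc.1
      have h2 := add_mem (hE p hp _ h1) (hCE hpc.2)
      have h3 : p + ((⌊-c⌋ : ℤ) : ℚ) • e + -(p - c • e) = ((⌊-c⌋ : ℚ) + c) • e := by module
      rw [h3] at h2
      refine hneE (neg_unit_mem_of_smul_mem (lt_of_le_of_ne ?_ ?_) h2)
      · have := Int.floor_le (-c); linarith
      · intro h
        exact hc ⟨-⌊-c⌋, by push_cast; linarith⟩
  exact hno φ hφ

end Cutting

/-! ### Integral hulls and finite generation of the cutting plane closure -/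

section CuttingClosure

variable {V : Type*} [AddCommGroup V] [Module ℚ V]
variable {e : V} {Λ : AddSubgroup V} {C E : PointedCone ℚ V}

theorem exists_sum_of_mem_hull {S : Finset V} {x : V}
    (hx : x ∈ PointedCone.hull ℚ (S : Set V)) :
    ∃ μ : V → ℚ, (∀ s, 0 ≤ μ s) ∧ ∑ s ∈ S, μ s • s = x := by
  classical
  refine hull_induction (p := fun x => ∃ μ : V → ℚ, (∀ s, 0 ≤ μ s) ∧ ∑ s ∈ S, μ s • s = x)
    ?_ ⟨0, by simp⟩ ?_ ?_ hx
  · intro x hx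
    refine ⟨Pi.single x 1, fun s => ?_, ?_⟩
    · by_cases h : s = x
      · subst h; simp
      · simp [h]
    · rw [Finset.sum_eq_single x]
      · simp
      · intro b _ hb; simp [hb]
      · intro h; exact absurd hx h
  · rintro _ _ ⟨μ, hμ, rfl⟩ ⟨ν, hν, rfl⟩
    exact ⟨μ + ν, fun s => add_nonneg (hμ s) (hν s), by
      simp [add_smul, Finset.sum_add_distrib]⟩
  · rintro c _ hc ⟨μ, hμ, rfl⟩
    exact ⟨c • μ, fun s => mul_nonneg hc (hμ s), by simp [Finset.smul_sum, smul_smul]⟩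

theorem IsIntegralPoint.add_smul {φ ψ : V →ₗ[ℚ] ℚ} (hφ : IsIntegralPoint e Λ C φ)
    (hψC : ∀ x ∈ C, 0 ≤ ψ x) (hψe : ψ e = 0) (hψ : ∀ p ∈ Λ, ∃ n : ℤ, ψ p = n) (n : ℕ) :
    IsIntegralPoint e Λ C (φ + (n : ℚ) • ψ) where
  map_unit := by simp [hφ.map_unit, hψe]
  nonneg x hx := add_nonneg (hφ.nonneg x hx) (mul_nonneg (Nat.cast_nonneg n) (hψC x hx))
  integral p hp := by
    obtain ⟨a, ha⟩ := hφ.integral p hp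
    obtain ⟨b, hb⟩ := hψ p hp
    exact ⟨a + n * b, by simp [ha, hb]⟩

theorem nonneg_of_forall_nat_mul {a b : ℚ} (h : ∀ n : ℕ, 0 ≤ a + n * b) : 0 ≤ b := by
  by_contra hb
  push Not at hb
  obtain ⟨n, hn⟩ := exists_nat_gt (a / -b)
  rw [div_lt_iff₀ (neg_pos.2 hb)] at hn
  have := h n
  linarith

/-- The recession directions are nonnegative on the functions that are nonnegative on all integral
points. -/
theorem IsIntegralPoint.nonneg_of_recession {φ ψ : V →ₗ[ℚ] ℚ} (hφ : IsIntegralPoint e Λ C φ)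
    (hΛ : Λ.FG) (hψC : ∀ x ∈ C, 0 ≤ ψ x) (hψe : ψ e = 0) {x : V}
    (hx : ∀ φ, IsIntegralPoint e Λ C φ → 0 ≤ φ x) : 0 ≤ ψ x := by
  obtain ⟨N, hN, h⟩ := exists_integral_multiple hΛ ψ
  have hN' : (0 : ℚ) < N := by exact_mod_cast hN
  have : 0 ≤ N * ψ x := by
    refine nonneg_of_forall_nat_mul (a := φ x) fun n => ?_
    exact hx _ (hφ.add_smul (ψ := (N : ℚ) • ψ) (fun y hy => mul_nonneg hN'.le (hψC y hy))
      (by simp [hψe]) h n)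
  exact nonneg_of_mul_nonneg_right this hN'

theorem integralPoint_ext (hspan : Submodule.span ℚ (Λ : Set V) ⊔ Submodule.span ℚ {e} = ⊤)
    {S : Finset V} (hS : AddSubgroup.closure (S : Set V) = Λ) {φ ψ : V →ₗ[ℚ] ℚ}
    (he : φ e = ψ e) (h : ∀ s ∈ S, φ s = ψ s) : φ = ψ := by
  have hΛ : ∀ p ∈ Λ, φ p = ψ p := by
    intro p hp
    rw [← hS] at hp
    induction hp using AddSubgroup.closure_induction with
    | mem x hx => exact h x hx
    | zero => simp
    | add x y _ _ hx hy => rw [map_add, map_add, hx, hy]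
    | neg x _ hx => rw [map_neg, map_neg, hx]
  have hle : (⊤ : Submodule ℚ V) ≤ LinearMap.eqLocus φ ψ := by
    rw [← hspan]
    refine sup_le (Submodule.span_le.2 hΛ) (Submodule.span_le.2 ?_)
    rintro _ rfl
    exact he
  exact LinearMap.ext fun x => hle (Submodule.mem_top (x := x))

/-- Only finitely many integral points are combinations with coefficients in the unit interval of
given functionals. -/
theorem finite_integralPoints_box (hΛ : Λ.FG)
    (hspan : Submodule.span ℚ (Λ : Set V) ⊔ Submodule.span ℚ {e} = ⊤)
    (R : Finset (V →ₗ[ℚ] ℚ)) (σ : (V →ₗ[ℚ] ℚ) → V →ₗ[ℚ] ℚ) :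
    {φ | IsIntegralPoint e Λ C φ ∧ ∃ ν : (V →ₗ[ℚ] ℚ) → ℚ, (∀ τ ∈ R, 0 ≤ ν τ ∧ ν τ ≤ 1) ∧
      φ = ∑ τ ∈ R, ν τ • σ τ}.Finite := by
  obtain ⟨S, hS⟩ := id hΛ
  -- An integral point is determined by its values at generators of `Λ`; in the box these values are
  -- integers of bounded size.
  refine Set.Finite.of_finite_image (f := fun φ (s : S) => φ s.1) ?_ ?_
  · refine (Set.Finite.pi (t := fun s : S =>
      (fun n : ℤ => (n : ℚ)) '' Set.Icc (-⌈∑ τ ∈ R, |σ τ s.1|⌉) ⌈∑ τ ∈ R, |σ τ s.1|⌉)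
      fun s => (Set.finite_Icc _ _).image _).subset ?_
    rintro _ ⟨φ, ⟨hφ, ν, hν, rfl⟩, rfl⟩ s -
    obtain ⟨n, hn⟩ := hφ.integral s.1 (by rw [← hS]; exact AddSubgroup.subset_closure s.2)
    refine ⟨n, ?_, hn.symm⟩
    have hb : |(n : ℚ)| ≤ ∑ τ ∈ R, |σ τ s.1| := by
      rw [← hn, LinearMap.sum_apply]
      refine (Finset.abs_sum_le_sum_abs _ _).trans (Finset.sum_le_sum fun τ hτ => ?_)
      rw [LinearMap.smul_apply, smul_eq_mul, abs_mul, abs_of_nonneg (hν τ hτ).1]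
      exact mul_le_of_le_one_left (abs_nonneg _) (hν τ hτ).2
    have hb' := hb.trans (Int.le_ceil _)
    rw [← Int.cast_abs, Int.cast_le] at hb'
    exact abs_le.1 hb'
  · rintro φ ⟨hφ, -⟩ ψ ⟨hψ, -⟩ h
    exact integralPoint_ext hspan hS (hφ.map_unit.trans hψ.map_unit.symm)
      fun s hs => congrFun h ⟨s, hs⟩

/-- The integral hull of a polyhedron with integral points is a polyhedron. -/
theorem exists_finset_integralHull [FiniteDimensional ℚ V] (hΛ : Λ.FG)
    (hspan : Submodule.span ℚ (Λ : Set V) ⊔ Submodule.span ℚ {e} = ⊤)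
    (hC : C.FG) (heC : e ∈ C) {φ₀ : V →ₗ[ℚ] ℚ} (hφ₀ : IsIntegralPoint e Λ C φ₀) :
    ∃ T : Finset (V →ₗ[ℚ] ℚ), ∀ x : V,
      (∀ φ, IsIntegralPoint e Λ C φ → 0 ≤ φ x) ↔ ∀ τ ∈ T, 0 ≤ τ x := by
  classical
  obtain ⟨R, hR⟩ := exists_finset_dual hC
  -- Including `e` makes the scaled functionals integral at `e` too, which later bounds the
  -- coefficients of those that are positive there.
  have hΛ' : (Λ ⊔ AddSubgroup.closure {e}).FG := by
    obtain ⟨S, rfl⟩ := hΛ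
    exact ⟨S ∪ {e}, by rw [Finset.coe_union, AddSubgroup.closure_union, Finset.coe_singleton]⟩
  choose N hN hNint using fun τ : V →ₗ[ℚ] ℚ => exists_integral_multiple hΛ' τ
  have hN' : ∀ τ, (0 : ℚ) < N τ := fun τ => by exact_mod_cast hN τ
  set σ : (V →ₗ[ℚ] ℚ) → V →ₗ[ℚ] ℚ := fun τ => (N τ : ℚ) • τ with hσ
  have hτC : ∀ τ ∈ R, ∀ x ∈ C, 0 ≤ τ x := fun τ hτ => (hR τ).1 (mem_hull hτ)
  have hσC : ∀ τ ∈ R, ∀ x ∈ C, 0 ≤ σ τ x := fun τ hτ x hx =>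
    mul_nonneg (hN' τ).le (hτC τ hτ x hx)
  have hσΛ : ∀ τ, ∀ p ∈ Λ, ∃ n : ℤ, σ τ p = n := fun τ p hp =>
    hNint τ p (AddSubgroup.mem_sup_left hp)
  have hσe : ∀ τ, ∃ n : ℤ, σ τ e = n := fun τ =>
    hNint τ e (AddSubgroup.mem_sup_right (AddSubgroup.subset_closure rfl))
  set F := {φ | IsIntegralPoint e Λ C φ ∧ ∃ ν : (V →ₗ[ℚ] ℚ) → ℚ,
    (∀ τ ∈ R, 0 ≤ ν τ ∧ ν τ ≤ 1) ∧ φ = ∑ τ ∈ R, ν τ • σ τ} with hF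
  have hFfin : F.Finite := finite_integralPoints_box hΛ hspan R σ
  -- The integral hull is described by the integral points in the box together with the dual
  -- generators that are recession directions (`τ e = 0`).
  refine ⟨hFfin.toFinset ∪ R.filter (fun τ => τ e = 0), fun x => ⟨fun h τ hτ => ?_, fun h φ hφ => ?_⟩⟩
  · rcases Finset.mem_union.1 hτ with hτ | hτ
    · exact h τ (hFfin.mem_toFinset.1 hτ).1
    · obtain ⟨hτR, hτe⟩ := Finset.mem_filter.1 hτ
      exact hφ₀.nonneg_of_recession hΛ (hτC τ hτR) hτe h
  · obtain ⟨μ, hμ, hμφ⟩ := exists_sum_of_mem_hull ((hR φ).2 hφ.nonneg)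
    set ρ : (V →ₗ[ℚ] ℚ) → ℚ := fun τ => μ τ / N τ with hρ
    have hρ0 : ∀ τ, 0 ≤ ρ τ := fun τ => div_nonneg (hμ τ) (hN' τ).le
    have hφρ : φ = ∑ τ ∈ R, ρ τ • σ τ := by
      rw [← hμφ]
      refine Finset.sum_congr rfl fun τ _ => ?_
      rw [hσ, hρ, smul_smul, div_mul_cancel₀ _ (hN' τ).ne']
    -- The integral parts of the coefficients of recession directions are split off into `δ`; what
    -- remains is an integral point in the box.
    set φ' : V →ₗ[ℚ] ℚ := ∑ τ ∈ R, (if τ e = 0 then Int.fract (ρ τ) else ρ τ) • σ τ with hφ'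
    set δ : V →ₗ[ℚ] ℚ := ∑ τ ∈ R, (if τ e = 0 then (⌊ρ τ⌋ : ℚ) else 0) • σ τ with hδ
    have hsum : φ = φ' + δ := by
      rw [hφρ, hφ', hδ, ← Finset.sum_add_distrib]
      refine Finset.sum_congr rfl fun τ _ => ?_
      rw [← _root_.add_smul]
      congr 1
      split_ifs
      · rw [add_comm, Int.floor_add_fract]
      · rw [add_zero]
    have hδe : δ e = 0 := by
      rw [hδ, LinearMap.sum_apply]
      refine Finset.sum_eq_zero fun τ _ => ?_
      split_ifs with h0
      · simp [hσ, h0]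
      · simp
    have hδΛ : ∀ p ∈ Λ, ∃ n : ℤ, δ p = n := by
      intro p hp
      choose n hn using fun τ => hσΛ τ p hp
      refine ⟨∑ τ ∈ R, (if τ e = 0 then ⌊ρ τ⌋ else 0) * n τ, ?_⟩
      rw [hδ, LinearMap.sum_apply]
      push_cast
      refine Finset.sum_congr rfl fun τ _ => ?_
      rw [LinearMap.smul_apply, smul_eq_mul, hn]
    have hν : ∀ τ ∈ R, 0 ≤ (if τ e = 0 then Int.fract (ρ τ) else ρ τ) ∧
        (if τ e = 0 then Int.fract (ρ τ) else ρ τ) ≤ 1 := by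
      intro τ hτ
      split_ifs with h0
      · exact ⟨Int.fract_nonneg _, (Int.fract_lt_one _).le⟩
      · refine ⟨hρ0 τ, ?_⟩
        -- A positive integer value at `e` forces the coefficient to be at most one, since the
        -- nonnegative contributions add up to `φ e = 1`.
        have h1 : (1 : ℚ) ≤ σ τ e := by
          have h2 : 0 < σ τ e := mul_pos (hN' τ) (lt_of_le_of_ne (hτC τ hτ e heC) (Ne.symm h0))
          obtain ⟨n, hn⟩ := hσe τ
          rw [hn] at h2 ⊢
          have h5 : 0 < n := by exact_mod_cast h2
          exact_mod_cast h5
        have h3 : ρ τ * σ τ e ≤ φ e := by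
          rw [hφρ, LinearMap.sum_apply]
          exact Finset.single_le_sum (f := fun τ => (ρ τ • σ τ) e)
            (fun i hi => mul_nonneg (hρ0 i) (hσC i hi e heC)) hτ
        rw [hφ.map_unit] at h3
        exact (le_mul_of_one_le_right (hρ0 τ) h1).trans h3
    have hφ'F : φ' ∈ F := by
      refine ⟨⟨?_, ?_, ?_⟩, _, hν, rfl⟩
      · have := hφ.map_unit
        rw [hsum, LinearMap.add_apply, hδe, add_zero] at this
        exact this
      · intro y hy
        rw [hφ', LinearMap.sum_apply]
        exact Finset.sum_nonneg fun τ hτ => mul_nonneg (hν τ hτ).1 (hσC τ hτ y hy)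
      · intro p hp
        obtain ⟨a, ha⟩ := hφ.integral p hp
        obtain ⟨b, hb⟩ := hδΛ p hp
        refine ⟨a - b, ?_⟩
        rw [hsum, LinearMap.add_apply, hb] at ha
        push_cast
        linarith
    rw [hsum, LinearMap.add_apply]
    refine add_nonneg (h φ' (Finset.mem_union_left _ (hFfin.mem_toFinset.2 hφ'F))) ?_
    rw [hδ, LinearMap.sum_apply]
    refine Finset.sum_nonneg fun τ hτ => ?_
    split_ifs with h0
    · refine mul_nonneg (by exact_mod_cast Int.floor_nonneg.2 (hρ0 τ)) (mul_nonneg (hN' τ).le ?_)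
      exact h τ (Finset.mem_union_right _ (Finset.mem_filter.2 ⟨hτ, h0⟩))
    · simp

/-- An affine function that is nonnegative on all integral points of a polyhedron with integral
points is bounded from below on the polyhedron. -/
theorem IsIntegralPoint.exists_add_unit_mem {φ₀ : V →ₗ[ℚ] ℚ} (hφ₀ : IsIntegralPoint e Λ C φ₀)
    (hΛ : Λ.FG) (hC : C.FG) (heC : e ∈ C) {x : V}
    (hx : ∀ φ, IsIntegralPoint e Λ C φ → 0 ≤ φ x) : ∃ M : ℚ, x + M • e ∈ C := by
  -- Functionals that are nonnegative on `C` and on `-e` vanish at `e`, so a separating functional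
  -- would be a recession direction.
  have hfg : (C ⊔ PointedCone.hull ℚ {-e}).FG := hC.sup (fg_hull (Set.finite_singleton _))
  have hmem : x ∈ C ⊔ PointedCone.hull ℚ {-e} := by
    by_contra hxC
    obtain ⟨ψ, hψ, hψx⟩ := farkas hfg hxC
    refine absurd (hφ₀.nonneg_of_recession hΛ (fun y hy => hψ y (Submodule.mem_sup_left hy)) ?_ hx)
      (not_le.2 hψx)
    refine le_antisymm ?_ (hψ e (Submodule.mem_sup_left heC))
    have := hψ (-e) (Submodule.mem_sup_right (mem_hull rfl))
    simpa using this
  obtain ⟨s, -, hs⟩ := mem_sup_hull_singleton.1 hmem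
  exact ⟨s, by simpa using hs⟩

/-- Completeness of cutting planes for integral affine functions. -/
theorem IsIntegralPoint.add_unit_mem_of_nonneg [FiniteDimensional ℚ V] {φ₀ : V →ₗ[ℚ] ℚ}
    (hφ₀ : IsIntegralPoint e Λ C φ₀) (hΛ : Λ.FG)
    (hspan : Submodule.span ℚ (Λ : Set V) ⊔ Submodule.span ℚ {e} = ⊤)
    (hC : C.FG) (heC : e ∈ C) (hE : CutClosed e Λ E) (hCE : C ≤ E) {p : V} (hp : p ∈ Λ) {k : ℤ}
    (hx : ∀ φ, IsIntegralPoint e Λ C φ → 0 ≤ φ (p + (k : ℚ) • e)) : p + (k : ℚ) • e ∈ E := by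
  obtain ⟨M, hM⟩ := hφ₀.exists_add_unit_mem hΛ hC heC hx
  -- Starting from the bound `M`, the constant descends in unit steps from `k + ⌈M⌉₊` to `k`; `j`
  -- counts the steps.
  have hdesc : ∀ n j : ℕ, n + j = ⌈M⌉₊ → p + ((k + n : ℤ) : ℚ) • e ∈ E := by
    intro n j hj
    induction j generalizing n with
    | zero =>
      have h1 : p + ((k : ℚ) + M) • e ∈ E := by
        have : p + ((k : ℚ) + M) • e = p + (k : ℚ) • e + M • e := by module
        rw [this]; exact hCE hM
      refine add_unit_mem (hCE heC) ?_ h1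
      have := Nat.le_ceil M
      rw [← hj] at this
      push_cast at this ⊢
      linarith
    | succ j ih =>
      have hf := ih (n + 1) (by omega)
      set f := p + ((k + (n + 1 : ℕ) : ℤ) : ℚ) • e with hfdef
      -- The hyperplane section where `f` vanishes contains no integral point: `p + k e` is
      -- nonnegative at integral points, and `f` exceeds it by at least one.
      have hneg : -e ∈ E ⊔ PointedCone.hull ℚ {-f} := by
        refine neg_unit_mem_of_no_integralPoint (C := C ⊔ PointedCone.hull ℚ {f, -f}) hΛ hspan
          (hC.sup (fg_hull (Set.toFinite _))) (Submodule.mem_sup_left heC) ?_ (hE.sup_neg hp hf) ?_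
        · intro φ hφ
          have h1 := hφ.nonneg (-f) (Submodule.mem_sup_right (mem_hull (by simp)))
          have h2 := hx φ ⟨hφ.1, fun x hx => hφ.2 x (Submodule.mem_sup_left hx), hφ.3⟩
          have h3 : f = (p + (k : ℚ) • e) + ((n : ℚ) + 1) • e := by
            rw [hfdef]; push_cast; module
          rw [h3, map_neg, map_add, map_smul, hφ.map_unit, smul_eq_mul, mul_one] at h1
          have : (0 : ℚ) ≤ n := Nat.cast_nonneg n
          linarith
        · refine sup_le (hCE.trans le_sup_left) (hull_le ?_)
          rintro x (rfl | rfl)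
          · exact Submodule.mem_sup_left hf
          · exact Submodule.mem_sup_right (mem_hull rfl)
      have h4 := hE.sub_unit_mem (hCE heC) hp hf hneg
      have h5 : (k + (n + 1 : ℕ) - 1 : ℤ) = k + n := by push_cast; ring
      rwa [h5] at h4
  simpa using hdesc 0 _ (Nat.zero_add _)

/-- With integral points, the least cone consists of the functions nonnegative at all of them;
without integral points, it arises from `C` by adding `-e`. -/
theorem exists_fg_isLeast_of_unit_mem [FiniteDimensional ℚ V] (hΛ : Λ.FG)
    (hspan : Submodule.span ℚ (Λ : Set V) ⊔ Submodule.span ℚ {e} = ⊤)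
    (hC : C.FG) (heC : e ∈ C) :
    ∃ D : PointedCone ℚ V, D.FG ∧ IsLeast {E | C ≤ E ∧ CutClosed e Λ E} D := by
  by_cases hex : ∃ φ, IsIntegralPoint e Λ C φ
  · obtain ⟨φ₀, hφ₀⟩ := hex
    obtain ⟨T, hT⟩ := exists_finset_integralHull hΛ hspan hC heC hφ₀
    obtain ⟨D, hD, hDT⟩ := fg_inf_iInf_halfspace (fg_top (V := V)) T
    have hmem : ∀ x, x ∈ D ↔ ∀ φ, IsIntegralPoint e Λ C φ → 0 ≤ φ x := by
      intro x
      rw [hDT, hT]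
      simp
    refine ⟨D, hD, ⟨fun x hx => (hmem x).2 fun φ hφ => hφ.nonneg x hx, ?_⟩, ?_⟩
    · intro p hp c hc
      rw [hmem] at hc ⊢
      intro φ hφ
      have h1 := hc φ hφ
      obtain ⟨n, hn⟩ := hφ.integral p hp
      rw [map_add, map_smul, hφ.map_unit, smul_eq_mul, mul_one, hn] at h1 ⊢
      have h2 : -n ≤ ⌊c⌋ := Int.le_floor.2 (by push_cast; linarith)
      have h3 : ((-n : ℤ) : ℚ) ≤ ⌊c⌋ := by exact_mod_cast h2
      push_cast at h3
      linarith
    · rintro E ⟨hCE, hE⟩ x hx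
      have hx' : x ∈ Submodule.span ℚ (Λ : Set V) ⊔ Submodule.span ℚ {e} := by
        rw [hspan]; trivial
      obtain ⟨y, hy, z, hz, rfl⟩ := Submodule.mem_sup.1 hx'
      obtain ⟨c, rfl⟩ := Submodule.mem_span_singleton.1 hz
      obtain ⟨N, hN, hNy⟩ := exists_nsmul_mem_of_mem_span hy
      have hN' : (0 : ℚ) < N := by exact_mod_cast hN
      -- Scaling moves the linear part into the lattice. Its values at integral points are then
      -- integers, so the constant can be rounded down without losing nonnegativity there.
      rw [← smul_mem_cone_iff E hN', smul_add, smul_smul]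
      refine add_unit_mem (hCE heC) (Int.floor_le _) ?_
      refine hφ₀.add_unit_mem_of_nonneg hΛ hspan hC heC hE hCE hNy fun φ hφ => ?_
      have h1 := mul_nonneg hN'.le ((hmem _).1 hx φ hφ)
      obtain ⟨n, hn⟩ := hφ.integral _ hNy
      rw [map_add, map_smul φ c, hφ.map_unit, smul_eq_mul, mul_one, mul_add,
        ← smul_eq_mul (N : ℚ) (φ y), ← map_smul, hn] at h1
      rw [map_add, map_smul φ (_ : ℚ) e, hφ.map_unit, smul_eq_mul, mul_one, hn]
      have h2 : -n ≤ ⌊(N : ℚ) * c⌋ := Int.le_floor.2 (by push_cast; linarith)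
      have h3 : ((-n : ℤ) : ℚ) ≤ ⌊(N : ℚ) * c⌋ := by exact_mod_cast h2
      push_cast at h3
      linarith
  · push Not at hex
    refine ⟨C ⊔ PointedCone.hull ℚ {-e}, hC.sup (fg_hull (Set.finite_singleton _)),
      ⟨le_sup_left, cutClosed_of_neg_unit_mem (Submodule.mem_sup_right (mem_hull rfl))⟩, ?_⟩
    rintro E ⟨hCE, hE⟩
    refine sup_le hCE (hull_le ?_)
    rintro _ rfl
    exact neg_unit_mem_of_no_integralPoint hΛ hspan hC heC hex hE hCE

/-- The added multiple of `e` can be postponed until after the cut, because the floor is monotone.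
-/
theorem CutClosed.sup_unit (hE : CutClosed e Λ E) :
    CutClosed e Λ (E ⊔ PointedCone.hull ℚ {e}) := by
  intro p hp c hc
  rw [mem_sup_hull_singleton] at hc ⊢
  obtain ⟨s, hs, h⟩ := hc
  have h1 : p + (c - s) • e ∈ E := by
    have : p + (c - s) • e = p + c • e - s • e := by module
    rwa [this]
  refine ⟨(⌊c⌋ - ⌊c - s⌋ : ℚ), ?_, ?_⟩
  · have : ⌊c - s⌋ ≤ ⌊c⌋ := Int.floor_le_floor (by linarith)
    rw [sub_nonneg]
    exact_mod_cast this
  · have : p + ((⌊c⌋ : ℤ) : ℚ) • e - (⌊c⌋ - ⌊c - s⌋ : ℚ) • e = p + ((⌊c - s⌋ : ℤ) : ℚ) • e := by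
      module
    rw [this]
    exact hE p hp _ h1

/-- The cutting plane closure of a polyhedral cone of affine functions is polyhedral. -/
theorem exists_fg_isLeast_cutClosed [FiniteDimensional ℚ V] (hΛ : Λ.FG)
    (hspan : Submodule.span ℚ (Λ : Set V) ⊔ Submodule.span ℚ {e} = ⊤) (hC : C.FG) :
    ∃ D : PointedCone ℚ V, D.FG ∧ IsLeast {E | C ≤ E ∧ CutClosed e Λ E} D := by
  obtain ⟨D, hD, ⟨hCD, hDcl⟩, hleast⟩ := exists_fg_isLeast_of_unit_mem hΛ hspan
    (C := C ⊔ PointedCone.hull ℚ {e}) (hC.sup (fg_hull (Set.finite_singleton _)))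
    (Submodule.mem_sup_right (mem_hull rfl))
  -- The cone `D` was computed after adjoining `e`, which need not lie in `C`. The second factor
  -- keeps only functions that become members of `C` when some nonnegative constant is added.
  refine ⟨D ⊓ (C ⊔ PointedCone.hull ℚ {-e}),
    fg_inf hD (hC.sup (fg_hull (Set.finite_singleton _))),
    ⟨le_inf (le_sup_left.trans hCD) le_sup_left, ?_⟩, ?_⟩
  · rintro p hp c ⟨h1, h2⟩
    refine ⟨hDcl p hp c h1, ?_⟩
    have : p + ((⌊c⌋ : ℤ) : ℚ) • e = (p + c • e) + (c - ⌊c⌋ : ℚ) • (-e) := by module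
    rw [this]
    exact add_mem h2 (smul_mem_cone _ (sub_nonneg.2 (Int.floor_le c))
      (Submodule.mem_sup_right (mem_hull rfl)))
  · rintro E ⟨hCE, hE⟩ x ⟨h1, h2⟩
    have h3 : x ∈ E ⊔ PointedCone.hull ℚ {e} :=
      hleast ⟨sup_le_sup_right hCE _, hE.sup_unit⟩ h1
    obtain ⟨s, hs, h3⟩ := mem_sup_hull_singleton.1 h3
    obtain ⟨r, hr, h4⟩ := mem_sup_hull_singleton.1 h2
    rcases hs.eq_or_lt with rfl | hs
    · simpa using h3
    · rw [← smul_mem_cone_iff E (add_pos_of_pos_of_nonneg hs hr)]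
      -- Up to scaling, `x` is a convex combination of a shift of `x` downwards, which lies in `E`,
      -- and a shift upwards, which lies in `C`.
      have : (s + r) • x = r • (x - s • e) + s • (x - r • -e) := by module
      rw [this]
      exact add_mem (smul_mem_cone _ hr h3) (smul_mem_cone _ hs.le (hCE h4))

end CuttingClosure

open MvPolynomial

/-! ### Normal forms and Gröbner bases -/

section Groebner

variable {σ : Type u} {m : MonomialOrder.{u, w} σ} {G : Set (MvPolynomial σ ℚ)}

/-- No monomial of `r` is divisible by the leading monomial of a nonzero element of `G`. -/
def IsNormalForm (m : MonomialOrder.{u, w} σ) (G : Set (MvPolynomial σ ℚ))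
    (r : MvPolynomial σ ℚ) : Prop :=
  ∀ d ∈ r.support, ∀ g ∈ G, g ≠ 0 → ¬ m.degree g ≤ d

theorem sub_red_mem (p : MvPolynomial σ ℚ) : p - red m G p ∈ Ideal.span G :=
  (Classical.choose_spec (exists_remainder m G p)).1

theorem isNormalForm_red (p : MvPolynomial σ ℚ) : IsNormalForm m G (red m G p) :=
  (Classical.choose_spec (exists_remainder m G p)).2

theorem IsNormalForm.zero : IsNormalForm m G 0 := by simp [IsNormalForm]

theorem IsNormalForm.add {p q : MvPolynomial σ ℚ} (hp : IsNormalForm m G p)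
    (hq : IsNormalForm m G q) : IsNormalForm m G (p + q) := by
  classical
  intro d hd
  rcases Finset.mem_union.1 (support_add hd) with h | h
  · exact hp d h
  · exact hq d h

theorem IsNormalForm.smul {p : MvPolynomial σ ℚ} (hp : IsNormalForm m G p) (c : ℚ) :
    IsNormalForm m G (c • p) :=
  fun d hd => hp d (support_smul hd)

theorem IsNormalForm.sub {p q : MvPolynomial σ ℚ} (hp : IsNormalForm m G p)
    (hq : IsNormalForm m G q) : IsNormalForm m G (p - q) := by
  rw [sub_eq_add_neg, ← neg_one_smul ℚ q]
  exact hp.add (hq.smul _)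

theorem isNormalForm_of_mem_hull {S : Set (MvPolynomial σ ℚ)} (hS : ∀ p ∈ S, IsNormalForm m G p)
    {p : MvPolynomial σ ℚ} (hp : p ∈ PointedCone.hull ℚ S) : IsNormalForm m G p :=
  hull_induction hS .zero (fun _ _ hx hy => hx.add hy) (fun c _ _ hx => hx.smul c) hp

/-- Otherwise its leading monomial would be divisible by that of an element of `G`. -/
theorem IsNormalForm.eq_zero (hG : IsGroebner m G) {r : MvPolynomial σ ℚ}
    (hr : IsNormalForm m G r) (hmem : r ∈ Ideal.span G) : r = 0 := by
  by_contra h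
  obtain ⟨g, hg, hg0, hle⟩ := hG r hmem h
  exact hr _ (m.degree_mem_support h) g hg hg0 hle

/-- Two congruent normal forms differ by a normal form in the ideal, which is zero. This uniqueness
is the source of the linearity of `red`. -/
theorem red_eq (hG : IsGroebner m G) {p r : MvPolynomial σ ℚ} (h : p - r ∈ Ideal.span G)
    (hr : IsNormalForm m G r) : red m G p = r := by
  refine sub_eq_zero.1 (((isNormalForm_red p).sub hr).eq_zero hG ?_)
  have := Ideal.sub_mem _ h (sub_red_mem (m := m) (G := G) p)
  simpa using this

theorem red_eq_self (hG : IsGroebner m G) {p : MvPolynomial σ ℚ} (hp : IsNormalForm m G p) :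
    red m G p = p := red_eq hG (by simp) hp

theorem red_eq_zero (hG : IsGroebner m G) {p : MvPolynomial σ ℚ} (hp : p ∈ Ideal.span G) :
    red m G p = 0 := red_eq hG (by simpa using hp) .zero

theorem red_add (hG : IsGroebner m G) (p q : MvPolynomial σ ℚ) :
    red m G (p + q) = red m G p + red m G q := by
  refine red_eq hG ?_ ((isNormalForm_red p).add (isNormalForm_red q))
  have := Ideal.add_mem _ (sub_red_mem (m := m) (G := G) p) (sub_red_mem (m := m) (G := G) q)
  rwa [add_sub_add_comm]

theorem red_smul (hG : IsGroebner m G) (c : ℚ) (p : MvPolynomial σ ℚ) :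
    red m G (c • p) = c • red m G p := by
  refine red_eq hG ?_ ((isNormalForm_red p).smul c)
  rw [← smul_sub, MvPolynomial.smul_eq_C_mul]
  exact Ideal.mul_mem_left _ _ (sub_red_mem p)

theorem red_mem_hull_image (hG : IsGroebner m G) {P : Set (MvPolynomial σ ℚ)}
    {p : MvPolynomial σ ℚ} (hp : p ∈ PointedCone.hull ℚ P) :
    red m G p ∈ PointedCone.hull ℚ (red m G '' P) := by
  refine hull_induction (p := fun p => red m G p ∈ PointedCone.hull ℚ (red m G '' P))
    (fun x hx => mem_hull ⟨x, hx, rfl⟩) ?_ ?_ ?_ hp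
  · rw [red_eq_zero hG (Ideal.zero_mem _)]; exact zero_mem _
  · intro x y hx hy; rw [red_add hG]; exact add_mem hx hy
  · intro c x hc hx; rw [red_smul hG]; exact smul_mem_cone _ hc hx

theorem isGroebner_empty : IsGroebner m (∅ : Set (MvPolynomial σ ℚ)) := by
  intro f hf h0
  simp at hf
  exact absurd hf h0

/-- Reduction does not increase the leading monomial. -/
theorem degree_red_le (hG : IsGroebner m G) (p : MvPolynomial σ ℚ) :
    m.toSyn (m.degree (red m G p)) ≤ m.toSyn (m.degree p) := by
  by_contra h
  push Not at h
  -- If the leading monomial grew, it would also lead the difference, which lies in the ideal; but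
  -- normal forms contain no monomial divisible by a leading monomial of `G`.
  have hneg : m.degree (red m G p - p) = m.degree (red m G p) := m.degree_sub_of_lt h
  have hr0 : red m G p ≠ 0 := by
    intro h0
    rw [h0, m.degree_zero, map_zero] at h
    exact absurd h (not_lt.2 (m.zero_le _))
  have hne : red m G p - p ≠ 0 := by
    intro h0
    rw [sub_eq_zero.1 h0] at h
    exact lt_irrefl _ h
  have hmem : red m G p - p ∈ Ideal.span G := by
    rw [← neg_sub]; exact Ideal.neg_mem_iff _ |>.2 (sub_red_mem p)
  obtain ⟨g, hg, hg0, hle⟩ := hG _ hmem hne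
  rw [hneg] at hle
  exact isNormalForm_red p _ (m.degree_mem_support hr0) g hg hg0 hle

/-- Every ideal of polynomials in finitely many variables has a finite Gröbner basis. -/
theorem exists_isGroebnerFor [Finite σ] (m : MonomialOrder.{u, w} σ)
    (Z : Finset (MvPolynomial σ ℚ)) : ∃ G, IsGroebnerFor m Z G := by
  classical
  set I := Ideal.span (Z : Set (MvPolynomial σ ℚ)) with hI
  set L : (σ →₀ ℕ) → Prop := fun d => ∃ f ∈ I, f ≠ 0 ∧ m.degree f = d with hL
  -- Dickson's lemma: the minimal leading monomials form an antichain in a well-quasi-order. One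
  -- polynomial for each of them gives the basis.
  have hfin : {d | Minimal L d}.Finite :=
    WellQuasiOrderedLE.finite_of_isAntichain (setOfPred_minimal_antichain L)
  have hex : ∀ d, Minimal L d → ∃ f ∈ I, f ≠ 0 ∧ m.degree f = d := fun d hd => hd.1
  choose! f hfI hf0 hfd using hex
  refine ⟨hfin.toFinset.image f, ?_⟩
  have hGI : ∀ g ∈ ((hfin.toFinset.image f : Finset _) : Set (MvPolynomial σ ℚ)), g ∈ I := by
    intro g hg
    obtain ⟨d, hd, rfl⟩ := Finset.mem_image.1 (Finset.mem_coe.1 hg)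
    exact hfI d (hfin.mem_toFinset.1 hd)
  have hdiv : ∀ p ∈ I, p ≠ 0 → ∃ g ∈ ((hfin.toFinset.image f : Finset _) : Set (MvPolynomial σ ℚ)),
      g ≠ 0 ∧ m.degree g ≤ m.degree p := by
    intro p hp hp0
    obtain ⟨d, hdp, hd⟩ := exists_minimal_le_of_wellFoundedLT L (m.degree p) ⟨p, hp, hp0, rfl⟩
    exact ⟨f d, Finset.mem_coe.2 (Finset.mem_image_of_mem f (hfin.mem_toFinset.2 hd)), hf0 d hd,
      (hfd d hd).trans_le hdp⟩
  have hspan : Ideal.span ((hfin.toFinset.image f : Finset _) : Set (MvPolynomial σ ℚ)) = I := by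
    refine le_antisymm (Ideal.span_le.2 hGI) fun p hp => ?_
    obtain ⟨r, hr, hnf⟩ := exists_remainder m
      ((hfin.toFinset.image f : Finset _) : Set (MvPolynomial σ ℚ)) p
    have hrI : r ∈ I := by
      have := I.sub_mem hp (Ideal.span_le.2 hGI hr)
      simpa using this
    have hr0 : r = 0 := by
      by_contra h
      obtain ⟨g, hg, hg0, hle⟩ := hdiv r hrI h
      exact hnf _ (m.degree_mem_support h) g hg hg0 hle
    simpa [hr0] using hr
  exact ⟨hspan, fun p hp => hdiv p (hspan ▸ hp)⟩

theorem exists_monomialOrder (α : Type u) [Finite α] : Nonempty (MonomialOrder.{u, u} α) := by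
  classical
  obtain ⟨n, ⟨e⟩⟩ := Finite.exists_equiv_fin α
  let _ : LinearOrder α := LinearOrder.lift' e e.injective
  exact ⟨MonomialOrder.lex⟩

end Groebner

/-! ### Algebraic cones -/

section AlgCone

variable {σ : Type u} {Z P : Finset (MvPolynomial σ ℚ)}

theorem mem_algCone {p : MvPolynomial σ ℚ} :
    p ∈ algCone Z P ↔ ∃ i ∈ Ideal.span (Z : Set (MvPolynomial σ ℚ)),
      ∃ c ∈ PointedCone.hull ℚ (P : Set (MvPolynomial σ ℚ)), i + c = p :=
  Submodule.mem_sup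

theorem span_le_algCone {p : MvPolynomial σ ℚ}
    (hp : p ∈ Ideal.span (Z : Set (MvPolynomial σ ℚ))) : p ∈ algCone Z P :=
  mem_algCone.2 ⟨p, hp, 0, zero_mem _, add_zero p⟩

theorem hull_le_algCone : PointedCone.hull ℚ (P : Set (MvPolynomial σ ℚ)) ≤ algCone Z P :=
  le_sup_right

theorem algCone_le {C : PointedCone ℚ (MvPolynomial σ ℚ)}
    (hZ : ∀ p ∈ Ideal.span (Z : Set (MvPolynomial σ ℚ)), p ∈ C) (hP : ∀ p ∈ P, p ∈ C) :
    algCone Z P ≤ C :=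
  sup_le hZ (hull_le hP)

end AlgCone

/-! ### Elimination -/

section Elimination

variable {α : Type u} {β : Type v}

/-- None of the variables in `β` occurs in `f`. -/
def IsEliminated (f : MvPolynomial (α ⊕ β) ℚ) : Prop :=
  ∀ d ∈ f.support, ∀ b : β, d (Sum.inr b) = 0

theorem IsEliminated.exists_rename {f : MvPolynomial (α ⊕ β) ℚ} (hf : IsEliminated f) :
    ∃ q : MvPolynomial α ℚ, rename Sum.inl q = f := by
  refine exists_rename_eq_of_vars_subset_range f Sum.inl Sum.inl_injective ?_
  intro x hx
  obtain ⟨d, hd, hxd⟩ := (mem_vars_iff_mem_support x).1 (Finset.mem_coe.1 hx)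
  rcases x with a | b
  · exact ⟨a, rfl⟩
  · exact absurd (hf d hd b) (Finsupp.mem_support_iff.1 hxd)

theorem mapDomain_inl_inr (d : α →₀ ℕ) (b : β) :
    Finsupp.mapDomain (Sum.inl : α → α ⊕ β) d (Sum.inr b) = 0 :=
  Finsupp.mapDomain_of_notMem_range _ _ (by simp)

theorem rename_inl_injective :
    Function.Injective (rename (R := ℚ) (Sum.inl : α → α ⊕ β)) :=
  rename_injective _ Sum.inl_injective

@[simp] theorem mem_restrictVars {Q : Finset (MvPolynomial (α ⊕ β) ℚ)} {f : MvPolynomial α ℚ} :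
    f ∈ restrictVars Q ↔ rename Sum.inl f ∈ Q := Finset.mem_preimage

variable (mα : MonomialOrder.{u, u} α) (mβ : MonomialOrder.{v, v} β)

theorem elimOrder_le_iff {d d' : α ⊕ β →₀ ℕ} :
    (elimOrder mα mβ).toSyn d ≤ (elimOrder mα mβ).toSyn d' ↔
      mβ.toSyn (Finsupp.sumFinsuppAddEquivProdFinsupp d).2 ≤
        mβ.toSyn (Finsupp.sumFinsuppAddEquivProdFinsupp d').2 ∧
      (mβ.toSyn (Finsupp.sumFinsuppAddEquivProdFinsupp d).2 =
        mβ.toSyn (Finsupp.sumFinsuppAddEquivProdFinsupp d').2 →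
        mα.toSyn (Finsupp.sumFinsuppAddEquivProdFinsupp d).1 ≤
        mα.toSyn (Finsupp.sumFinsuppAddEquivProdFinsupp d').1) :=
  Prod.Lex.toLex_le_toLex'

theorem snd_eq_zero_iff {d : α ⊕ β →₀ ℕ} :
    (Finsupp.sumFinsuppAddEquivProdFinsupp d).2 = 0 ↔ ∀ b, d (Sum.inr b) = 0 := by
  simp [Finsupp.ext_iff]

/-- The `β`-parts are compared first, and zero is the least of them. -/
theorem eliminated_of_elimOrder_le {d d' : α ⊕ β →₀ ℕ}
    (h : (elimOrder mα mβ).toSyn d ≤ (elimOrder mα mβ).toSyn d')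
    (hd' : ∀ b, d' (Sum.inr b) = 0) (b : β) : d (Sum.inr b) = 0 := by
  have h1 := ((elimOrder_le_iff mα mβ).1 h).1
  rw [snd_eq_zero_iff.2 hd', map_zero, ← mβ.eq_zero_iff, mβ.toSyn_eq_zero_iff] at h1
  exact snd_eq_zero_iff.1 h1 b

theorem elimOrder_mapDomain_le_iff {d d' : α →₀ ℕ} :
    (elimOrder mα mβ).toSyn (d.mapDomain Sum.inl) ≤ (elimOrder mα mβ).toSyn (d'.mapDomain Sum.inl) ↔
      mα.toSyn d ≤ mα.toSyn d' := by
  have h2 : ∀ d : α →₀ ℕ,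
      (Finsupp.sumFinsuppAddEquivProdFinsupp (d.mapDomain (Sum.inl : α → α ⊕ β))).2 = 0 :=
    fun d => snd_eq_zero_iff.2 (mapDomain_inl_inr d)
  have h1 : ∀ d : α →₀ ℕ,
      (Finsupp.sumFinsuppAddEquivProdFinsupp (d.mapDomain (Sum.inl : α → α ⊕ β))).1 = d := by
    intro d
    ext a
    rw [Finsupp.fst_sumFinsuppAddEquivProdFinsupp, Finsupp.mapDomain_apply Sum.inl_injective]
  rw [elimOrder_le_iff, h2, h2, h1, h1]
  simp

theorem isEliminated_of_degree {f : MvPolynomial (α ⊕ β) ℚ}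
    (h : ∀ b, (elimOrder mα mβ).degree f (Sum.inr b) = 0) : IsEliminated f :=
  fun _ hd => eliminated_of_elimOrder_le mα mβ ((elimOrder mα mβ).le_degree hd) h

theorem elimOrder_degree_rename (q : MvPolynomial α ℚ) :
    (elimOrder mα mβ).degree (rename Sum.inl q) = (mα.degree q).mapDomain Sum.inl := by
  classical
  by_cases hq : q = 0
  · subst hq
    rw [map_zero, MonomialOrder.degree_zero, MonomialOrder.degree_zero, Finsupp.mapDomain_zero]
  refine (elimOrder mα mβ).toSyn.injective (le_antisymm ?_ ?_)
  · rw [MonomialOrder.degree_le_iff]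
    intro c hc
    rw [support_rename_of_injective Sum.inl_injective] at hc
    obtain ⟨d, hd, rfl⟩ := Finset.mem_image.1 hc
    exact (elimOrder_mapDomain_le_iff mα mβ).2 (mα.le_degree hd)
  · refine (elimOrder mα mβ).le_degree ?_
    rw [support_rename_of_injective Sum.inl_injective]
    exact Finset.mem_image_of_mem _ (mα.degree_mem_support hq)

/-- Reduction does not increase the leading monomial, and every monomial below a `β`-free one is
`β`-free. -/
theorem isEliminated_red {G : Set (MvPolynomial (α ⊕ β) ℚ)} (hG : IsGroebner (elimOrder mα mβ) G)
    (q : MvPolynomial α ℚ) : IsEliminated (red (elimOrder mα mβ) G (rename Sum.inl q)) := by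
  refine isEliminated_of_degree mα mβ
    (eliminated_of_elimOrder_le mα mβ (degree_red_le hG (rename Sum.inl q)) ?_)
  rw [elimOrder_degree_rename]
  exact mapDomain_inl_inr _

theorem rename_mem_span_of_mem {G : Finset (MvPolynomial (α ⊕ β) ℚ)} {f : MvPolynomial α ℚ}
    (hf : f ∈ Ideal.span (restrictVars G : Set (MvPolynomial α ℚ))) :
    rename Sum.inl f ∈ Ideal.span (G : Set (MvPolynomial (α ⊕ β) ℚ)) := by
  have hle : Ideal.span (restrictVars G : Set (MvPolynomial α ℚ)) ≤
      (Ideal.span (G : Set (MvPolynomial (α ⊕ β) ℚ))).comap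
        (rename Sum.inl : MvPolynomial α ℚ →ₐ[ℚ] MvPolynomial (α ⊕ β) ℚ) :=
    Ideal.span_le.2 fun g hg => Ideal.subset_span (mem_restrictVars.1 hg)
  exact hle hf

/-- The elimination theorem. -/
theorem mem_span_restrictVars {G : Finset (MvPolynomial (α ⊕ β) ℚ)}
    (hG : IsGroebner (elimOrder mα mβ) (G : Set (MvPolynomial (α ⊕ β) ℚ))) {f : MvPolynomial α ℚ}
    (hf : rename Sum.inl f ∈ Ideal.span (G : Set (MvPolynomial (α ⊕ β) ℚ))) :
    f ∈ Ideal.span (restrictVars G : Set (MvPolynomial α ℚ)) := by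
  obtain ⟨r, hr, hnf⟩ := exists_remainder mα (restrictVars G : Set (MvPolynomial α ℚ)) f
  have hrG : rename Sum.inl r ∈ Ideal.span (G : Set (MvPolynomial (α ⊕ β) ℚ)) := by
    have := Ideal.sub_mem _ hf (rename_mem_span_of_mem hr)
    simpa using this
  have hr0 : r = 0 := by
    by_contra h
    obtain ⟨g, hg, hg0, hle⟩ := hG _ hrG
      (fun h0 => h (rename_inl_injective (by rw [h0, map_zero])))
    rw [elimOrder_degree_rename] at hle
    -- The leading monomial of `g` divides a `β`-free one, so all of `g` is `β`-free and survives
    -- the restriction.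
    have hgel : IsEliminated g := by
      refine isEliminated_of_degree mα mβ fun b => ?_
      have := hle (Sum.inr b)
      rw [mapDomain_inl_inr] at this
      exact Nat.le_zero.1 this
    obtain ⟨q, rfl⟩ := hgel.exists_rename
    rw [elimOrder_degree_rename] at hle
    refine hnf _ (mα.degree_mem_support h) q (mem_restrictVars.2 hg) ?_ ?_
    · rintro rfl; exact hg0 (map_zero _)
    · intro a
      have := hle (Sum.inl a)
      rwa [Finsupp.mapDomain_apply Sum.inl_injective,
        Finsupp.mapDomain_apply Sum.inl_injective] at this
  simpa [hr0] using hr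

end Elimination

/-! ### Projection -/

section Projection

theorem coe_fmStep {τ : Type u} (d : τ →₀ ℕ) (P : Finset (MvPolynomial τ ℚ)) :
    (fmStep d P : Set (MvPolynomial τ ℚ)) = fourierMotzkin (lcoeff ℚ d) P := by
  classical
  simp only [fmStep, Finset.coe_union, Finset.coe_filter, Finset.coe_image, Finset.coe_product]
  rfl

theorem mem_hull_foldl_fmStep {τ : Type u} (l : List (τ →₀ ℕ)) (P : Finset (MvPolynomial τ ℚ))
    (x : MvPolynomial τ ℚ) :
    x ∈ PointedCone.hull ℚ ((l.foldl (fun R d => fmStep d R) P : Finset (MvPolynomial τ ℚ)) :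
        Set (MvPolynomial τ ℚ)) ↔
      x ∈ PointedCone.hull ℚ (P : Set (MvPolynomial τ ℚ)) ∧ ∀ d ∈ l, x.coeff d = 0 := by
  induction l generalizing P with
  | nil => simp
  | cons d l ih =>
    rw [List.foldl_cons, ih, coe_fmStep, mem_hull_fourierMotzkin]
    simp only [List.mem_cons, forall_eq_or_imp, and_assoc]
    rfl

theorem coeff_eq_zero_of_mem_hull {τ : Type u} {P : Finset (MvPolynomial τ ℚ)} {d : τ →₀ ℕ}
    (h : ∀ p ∈ P, d ∉ p.support) {x : MvPolynomial τ ℚ}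
    (hx : x ∈ PointedCone.hull ℚ (P : Set (MvPolynomial τ ℚ))) : x.coeff d = 0 :=
  hull_induction (p := fun x => x.coeff d = 0) (fun p hp => notMem_support_iff.1 (h p hp)) (by simp)
    (fun x y hx hy => by rw [coeff_add, hx, hy, add_zero])
    (fun c x _ hx => by rw [coeff_smul, hx, smul_zero]) hx

/-- Monomials that do not occur in `P` have coefficient zero on the whole cone, so eliminating the
listed ones suffices. -/
theorem PolyhedralProject.mem_hull {τ : Type u} {P Q : Finset (MvPolynomial τ ℚ)}
    {N : Set (τ →₀ ℕ)} (h : PolyhedralProject P N Q) {x : MvPolynomial τ ℚ} :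
    x ∈ PointedCone.hull ℚ (Q : Set (MvPolynomial τ ℚ)) ↔
      x ∈ PointedCone.hull ℚ (P : Set (MvPolynomial τ ℚ)) ∧ ∀ d ∈ x.support, d ∈ N := by
  obtain ⟨l, -, hl, rfl⟩ := h
  rw [mem_hull_foldl_fmStep]
  refine and_congr_right fun hx => ⟨fun h d hd => ?_, fun h d hd => ?_⟩
  · by_contra hdN
    by_cases hex : ∃ p ∈ P, d ∈ p.support
    · exact mem_support_iff.1 hd (h d ((hl d).2 ⟨hex, hdN⟩))
    · push Not at hex
      exact mem_support_iff.1 hd (coeff_eq_zero_of_mem_hull hex hx)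
  · by_contra h0
    exact ((hl d).1 hd).2 (h d (mem_support_iff.2 h0))

theorem exists_polyhedralProject {τ : Type u} (P : Finset (MvPolynomial τ ℚ))
    (N : Set (τ →₀ ℕ)) : ∃ Q, PolyhedralProject P N Q := by
  classical
  refine ⟨_, ((P.biUnion support).filter (· ∉ N)).toList, Finset.nodup_toList _, fun d => ?_, rfl⟩
  simp

section

variable {V W : Type*} [AddCommGroup V] [Module ℚ V] [AddCommGroup W] [Module ℚ W]

theorem map_mem_hull_image (f : V →ₗ[ℚ] W) {S : Set V} {x : V}
    (hx : x ∈ PointedCone.hull ℚ S) : f x ∈ PointedCone.hull ℚ (f '' S) :=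
  hull_induction (p := fun x => f x ∈ PointedCone.hull ℚ (f '' S)) (fun x hx => mem_hull ⟨x, hx, rfl⟩)
    (by simp) (fun x y hx hy => by rw [map_add]; exact add_mem hx hy)
    (fun c x hc hx => by rw [map_smul]; exact smul_mem_cone _ hc hx) hx

theorem exists_of_mem_hull_image (f : V →ₗ[ℚ] W) {S : Set V} {y : W}
    (hy : y ∈ PointedCone.hull ℚ (f '' S)) : ∃ x ∈ PointedCone.hull ℚ S, f x = y := by
  refine hull_induction (p := fun y => ∃ x ∈ PointedCone.hull ℚ S, f x = y) ?_
    ⟨0, zero_mem _, map_zero f⟩ ?_ ?_ hy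
  · rintro _ ⟨x, hx, rfl⟩; exact ⟨x, mem_hull hx, rfl⟩
  · rintro _ _ ⟨x, hx, rfl⟩ ⟨y, hy, rfl⟩; exact ⟨x + y, add_mem hx hy, map_add f x y⟩
  · rintro c _ hc ⟨x, hx, rfl⟩; exact ⟨c • x, smul_mem_cone _ hc hx, map_smul f c x⟩

end

variable {α : Type u} {β : Type v}

/-- Correctness of projection. -/
theorem Project.mem_algCone {Z P : Finset (MvPolynomial (α ⊕ β) ℚ)}
    {Z' P' : Finset (MvPolynomial α ℚ)} (h : Project Z P Z' P') {f : MvPolynomial α ℚ} :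
    f ∈ algCone Z' P' ↔ rename Sum.inl f ∈ algCone Z P := by
  classical
  obtain ⟨mα, mβ, G, Q, ⟨hspan, hG⟩, hQ, rfl, rfl⟩ := h
  have hred : ∀ p, p - red (elimOrder mα mβ) G p ∈
      Ideal.span (Z : Set (MvPolynomial (α ⊕ β) ℚ)) := fun p => hspan ▸ sub_red_mem p
  constructor
  · intro hf
    obtain ⟨i, hi, c, hc, rfl⟩ := RCP.mem_algCone.1 hf
    rw [map_add]
    refine add_mem (span_le_algCone (hspan ▸ rename_mem_span_of_mem hi)) ?_
    have h1 : rename Sum.inl c ∈ PointedCone.hull ℚ (Q : Set (MvPolynomial (α ⊕ β) ℚ)) := by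
      refine hull_mono ?_ (map_mem_hull_image
        (rename (Sum.inl : α → α ⊕ β) : MvPolynomial α ℚ →ₐ[ℚ] _).toLinearMap hc)
      rintro _ ⟨q, hq, rfl⟩
      exact mem_restrictVars.1 hq
    refine hull_le ?_ (hQ.mem_hull.1 h1).1
    intro q hq
    obtain ⟨p, hp, rfl⟩ := Finset.mem_image.1 (Finset.mem_coe.1 hq)
    have : red (elimOrder mα mβ) G p = -(p - red (elimOrder mα mβ) G p) + p := by ring
    rw [this]
    exact add_mem (span_le_algCone (Ideal.neg_mem_iff _ |>.2 (hred p)))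
      (hull_le_algCone (mem_hull hp))
  · intro hf
    obtain ⟨i, hi, c, hc, hic⟩ := RCP.mem_algCone.1 hf
    -- By linearity, the reduction of `f` is a conical combination of reductions of `P`; it is
    -- `β`-free and hence survives the elimination.
    have h1 : red (elimOrder mα mβ) G (rename Sum.inl f) ∈
        PointedCone.hull ℚ (Q : Set (MvPolynomial (α ⊕ β) ℚ)) := by
      refine hQ.mem_hull.2 ⟨?_, isEliminated_red mα mβ hG f⟩
      rw [← hic, red_add hG, red_eq_zero hG (hspan ▸ hi), zero_add, Finset.coe_image]
      exact red_mem_hull_image hG hc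
    have h2 : (Q : Set (MvPolynomial (α ⊕ β) ℚ)) =
        (rename (Sum.inl : α → α ⊕ β) : MvPolynomial α ℚ →ₐ[ℚ] _).toLinearMap ''
          (restrictVars Q : Set (MvPolynomial α ℚ)) := by
      ext q
      constructor
      · intro hq
        obtain ⟨p, rfl⟩ := IsEliminated.exists_rename (hQ.mem_hull.1 (RCP.mem_hull hq)).2
        exact ⟨p, mem_restrictVars.2 hq, rfl⟩
      · rintro ⟨p, hp, rfl⟩
        exact mem_restrictVars.1 hp
    rw [h2] at h1
    obtain ⟨c', hc', hcc'⟩ := exists_of_mem_hull_image _ h1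
    refine RCP.mem_algCone.2 ⟨f - c', mem_span_restrictVars mα mβ hG ?_, c', hc', by ring⟩
    have h3 := sub_red_mem (m := elimOrder mα mβ) (G := G) (rename Sum.inl f)
    rw [← hcc'] at h3
    rw [map_sub]
    exact h3

/-- This serves to show that the ideal part of the intersection with the linear polynomials is zero,
so that the second component alone carries the result. -/
theorem Project.mem_span {Z P : Finset (MvPolynomial (α ⊕ β) ℚ)}
    {Z' P' : Finset (MvPolynomial α ℚ)} (h : Project Z P Z' P') {f : MvPolynomial α ℚ}
    (hf : f ∈ Ideal.span (Z' : Set (MvPolynomial α ℚ))) :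
    rename Sum.inl f ∈ Ideal.span (Z : Set (MvPolynomial (α ⊕ β) ℚ)) := by
  obtain ⟨mα, mβ, G, Q, ⟨hspan, hG⟩, hQ, rfl, rfl⟩ := h
  exact hspan ▸ rename_mem_span_of_mem hf

theorem exists_project [Finite α] [Finite β] (Z P : Finset (MvPolynomial (α ⊕ β) ℚ)) :
    ∃ Z' P', Project (α := α) (β := β) Z P Z' P' := by
  classical
  obtain ⟨mα⟩ := exists_monomialOrder α
  obtain ⟨mβ⟩ := exists_monomialOrder β
  obtain ⟨G, hG⟩ := exists_isGroebnerFor (elimOrder mα mβ) Z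
  obtain ⟨Q, hQ⟩ := exists_polyhedralProject (P.image (red (elimOrder mα mβ) G))
    {d | ∀ b : β, d (Sum.inr b) = 0}
  exact ⟨_, _, mα, mβ, G, Q, hG, hQ, rfl, rfl⟩

end Projection

/-! ### Images of algebraic cones under homomorphisms -/

section Hom

variable {τ : Type*}

/-- The ideal `I` mediates because `C` itself is not closed under multiplication by polynomials. -/
theorem map_mem_of_mem_algCone {σ : Type u} {Z P : Finset (MvPolynomial σ ℚ)}
    (g : MvPolynomial σ ℚ →ₐ[ℚ] MvPolynomial τ ℚ) {C : PointedCone ℚ (MvPolynomial τ ℚ)}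
    (I : Ideal (MvPolynomial τ ℚ)) (hI : ∀ p ∈ I, p ∈ C) (hZ : ∀ z ∈ Z, g z ∈ I)
    (hP : ∀ p ∈ P, g p ∈ C) {x : MvPolynomial σ ℚ} (hx : x ∈ algCone Z P) : g x ∈ C := by
  have hle : algCone Z P ≤ PointedCone.comap g.toLinearMap C := by
    refine algCone_le (fun p hp => ?_) hP
    have : Ideal.span (Z : Set (MvPolynomial σ ℚ)) ≤ I.comap g := Ideal.span_le.2 hZ
    exact hI _ (this hp)
  exact hle hx

theorem mul_mem_span_of_forall {σ : Type u} {Z : Finset (MvPolynomial σ ℚ)}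
    (g : MvPolynomial σ ℚ →ₐ[ℚ] MvPolynomial τ ℚ) (t : MvPolynomial τ ℚ)
    {J : Ideal (MvPolynomial τ ℚ)} (hZ : ∀ z ∈ Z, t * g z ∈ J) {x : MvPolynomial σ ℚ}
    (hx : x ∈ Ideal.span (Z : Set (MvPolynomial σ ℚ))) : t * g x ∈ J := by
  induction hx using Submodule.span_induction with
  | mem x h => exact hZ x h
  | zero => simp
  | add x y _ _ hx hy => rw [map_add, mul_add]; exact J.add_mem hx hy
  | smul c x _ hx =>
    rw [smul_eq_mul, map_mul, mul_left_comm]; exact J.mul_mem_left _ hx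

end Hom

/-! ### Intersection with the polynomials of degree at most one -/

section Subspace

/-- The substitution of a rational number for the tag variable. -/
noncomputable def evalTag (Y : Type u) (c : ℚ) : MvPolynomial (Y ⊕ Unit) ℚ →ₐ[ℚ] MvPolynomial Y ℚ :=
  aeval (Sum.elim X fun _ => C c)

@[simp] theorem evalTag_rename {Y : Type u} (c : ℚ) (q : MvPolynomial Y ℚ) :
    evalTag Y c (rename Sum.inl q) = q := by
  rw [evalTag, aeval_rename, Sum.elim_comp_inl, aeval_X_left_apply]

@[simp] theorem evalTag_X {Y : Type u} (c : ℚ) : evalTag Y c (X (Sum.inr ())) = C c := by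
  simp [evalTag]

variable {Y : Type u} [Fintype Y]

theorem mem_hull_linGens_iff {f : MvPolynomial Y ℚ} :
    f ∈ PointedCone.hull ℚ (linGens Y : Set (MvPolynomial Y ℚ)) ↔
      f ∈ Submodule.span ℚ (Set.range (X : Y → MvPolynomial Y ℚ) ∪ {1}) := by
  classical
  constructor
  · intro hf
    refine hull_le (C := PointedCone.ofSubmodule (Submodule.span ℚ _)) ?_ hf
    intro x hx
    simp only [linGens, Finset.coe_union, Finset.coe_image, Finset.coe_univ, Set.image_univ,
      Finset.coe_insert, Finset.coe_singleton] at hx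
    rcases hx with (⟨y, rfl⟩ | ⟨y, rfl⟩) | (rfl | rfl)
    · exact Submodule.subset_span (Or.inl ⟨y, rfl⟩)
    · exact Submodule.neg_mem _ (Submodule.subset_span (Or.inl ⟨y, rfl⟩))
    · exact Submodule.subset_span (Or.inr rfl)
    · exact Submodule.neg_mem _ (Submodule.subset_span (Or.inr rfl))
  · refine mem_hull_of_mem_span fun s hs => ?_
    rcases hs with ⟨y, rfl⟩ | rfl
    · exact ⟨mem_hull (by simp [linGens]), mem_hull (by simp [linGens])⟩
    · exact ⟨mem_hull (by simp [linGens]), mem_hull (by simp [linGens])⟩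

/-- Correctness of the intersection with the polynomials of degree at most one. -/
theorem IntersectSubspace.mem_hull {Z P P' : Finset (MvPolynomial Y ℚ)}
    (h : IntersectSubspace Z P P') {f : MvPolynomial Y ℚ} :
    f ∈ PointedCone.hull ℚ (P' : Set (MvPolynomial Y ℚ)) ↔
      f ∈ algCone Z P ∧ f ∈ PointedCone.hull ℚ (linGens Y : Set (MvPolynomial Y ℚ)) := by
  classical
  obtain ⟨Z', hZ'⟩ := h
  -- Substituting zero for the tag annihilates all ideal generators but fixes polynomials over `Y`.
  have hzero : ∀ i ∈ Ideal.span (Z' : Set (MvPolynomial Y ℚ)), i = 0 := by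
    intro i hi
    have h1 := Project.mem_span hZ' hi
    have h2 : Ideal.span (tagged Z ∅ : Set (MvPolynomial (Y ⊕ Unit) ℚ)) ≤
        (⊥ : Ideal (MvPolynomial Y ℚ)).comap (evalTag Y 0) := by
      refine Ideal.span_le.2 fun z hz => ?_
      simp only [tagged, Finset.image_empty, Finset.union_empty, Finset.coe_image] at hz
      obtain ⟨q, -, rfl⟩ := hz
      simp
    simpa using h2 h1
  have hiff : f ∈ PointedCone.hull ℚ (P' : Set (MvPolynomial Y ℚ)) ↔ f ∈ algCone Z' P' := by
    refine ⟨fun hf => hull_le_algCone hf, fun hf => ?_⟩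
    obtain ⟨i, hi, c, hc, rfl⟩ := mem_algCone.1 hf
    rwa [hzero i hi, zero_add]
  rw [hiff, Project.mem_algCone hZ']
  constructor
  · intro hf
    constructor
    -- The tag value one isolates the first cone; the value zero, used afterwards, isolates the
    -- second.
    · have := map_mem_of_mem_algCone (evalTag Y 1) (C := algCone Z P)
        (Ideal.span (Z : Set (MvPolynomial Y ℚ))) (fun p hp => span_le_algCone hp) ?_ ?_ hf
      · simpa using this
      · intro z hz
        simp only [tagged, Finset.image_empty, Finset.union_empty, Finset.mem_image] at hz
        obtain ⟨q, hq, rfl⟩ := hz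
        simpa using Ideal.subset_span (Finset.mem_coe.2 hq)
      · intro p hp
        simp only [tagged, Finset.mem_union, Finset.mem_image] at hp
        rcases hp with ⟨q, hq, rfl⟩ | ⟨q, -, rfl⟩
        · simpa using hull_le_algCone (RCP.mem_hull (Finset.mem_coe.2 hq))
        · simp
    · have := map_mem_of_mem_algCone (evalTag Y 0)
        (C := PointedCone.hull ℚ (linGens Y : Set (MvPolynomial Y ℚ))) ⊥ ?_ ?_ ?_ hf
      · simpa using this
      · intro p hp
        rw [(Submodule.mem_bot _).1 hp]; exact zero_mem _
      · intro z hz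
        simp only [tagged, Finset.image_empty, Finset.union_empty, Finset.mem_image] at hz
        obtain ⟨q, -, rfl⟩ := hz
        simp
      · intro p hp
        simp only [tagged, Finset.mem_union, Finset.mem_image] at hp
        rcases hp with ⟨q, -, rfl⟩ | ⟨q, hq, rfl⟩
        · simp
        · simpa using RCP.mem_hull (Finset.mem_coe.2 hq)
  · rintro ⟨hf, hl⟩
    set t : MvPolynomial (Y ⊕ Unit) ℚ := X (Sum.inr ()) with ht
    have hsum : rename Sum.inl f = t * rename Sum.inl f + (1 - t) * rename Sum.inl f := by ring
    rw [hsum]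
    refine add_mem ?_ ?_
    · obtain ⟨i, hi, c, hc, rfl⟩ := mem_algCone.1 hf
      rw [map_add, mul_add]
      refine add_mem (span_le_algCone (mul_mem_span_of_forall (rename Sum.inl) t ?_ hi)) ?_
      · intro z hz
        refine Ideal.subset_span ?_
        simp only [tagged, Finset.image_empty, Finset.union_empty, Finset.coe_image]
        exact ⟨z, hz, rfl⟩
      · refine hull_le_algCone (hull_mono ?_ (map_mem_hull_image
          (LinearMap.mulLeft ℚ t ∘ₗ (rename (Sum.inl : Y → Y ⊕ Unit) :
            MvPolynomial Y ℚ →ₐ[ℚ] _).toLinearMap) hc))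
        rintro _ ⟨q, hq, rfl⟩
        exact Finset.mem_coe.2 (Finset.mem_union_left _ (Finset.mem_image.2 ⟨q, hq, rfl⟩))
    · refine hull_le_algCone (hull_mono ?_ (map_mem_hull_image
        (LinearMap.mulLeft ℚ (1 - t) ∘ₗ (rename (Sum.inl : Y → Y ⊕ Unit) :
          MvPolynomial Y ℚ →ₐ[ℚ] _).toLinearMap) hl))
      rintro _ ⟨q, hq, rfl⟩
      exact Finset.mem_coe.2 (Finset.mem_union_right _ (Finset.mem_image.2 ⟨q, hq, rfl⟩))

theorem exists_intersectSubspace (Z P : Finset (MvPolynomial Y ℚ)) :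
    ∃ P', IntersectSubspace Z P P' := by
  obtain ⟨Z', P', h⟩ := exists_project (tagged Z ∅) (tagged P (linGens Y))
  exact ⟨P', Z', h⟩

end Subspace

/-! ### Inverse images -/

/-- Correctness of the computation of inverse images. -/
theorem InverseHom.mem_algCone {σ Y : Type u} [Fintype Y] {Z P : Finset (MvPolynomial σ ℚ)}
    {f : MvPolynomial Y ℚ →ₐ[ℚ] MvPolynomial σ ℚ} {Z' P' : Finset (MvPolynomial Y ℚ)}
    (h : InverseHom Z P f Z' P') {q : MvPolynomial Y ℚ} :
    q ∈ algCone Z' P' ↔ f q ∈ algCone Z P := by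
  classical
  rw [Project.mem_algCone h]
  constructor
  · intro hq
    -- Substituting `f y` for `y` annihilates the generators `y - f y`.
    let g : MvPolynomial (Y ⊕ σ) ℚ →ₐ[ℚ] MvPolynomial σ ℚ :=
      aeval (Sum.elim (fun y => f (X y)) X)
    have hgl : ∀ q, g (rename Sum.inl q) = f q := by
      intro q
      have : g.comp (rename Sum.inl) = f := by
        refine algHom_ext fun y => ?_
        simp [g]
      exact DFunLike.congr_fun this q
    have hgr : ∀ q, g (rename Sum.inr q) = q := by
      intro q
      simp only [g, aeval_rename, Sum.elim_comp_inr, aeval_X_left_apply]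
    have := map_mem_of_mem_algCone g (C := algCone Z P)
      (Ideal.span (Z : Set (MvPolynomial σ ℚ))) (fun p hp => span_le_algCone hp) ?_ ?_ hq
    · rwa [hgl] at this
    · intro z hz
      rcases Finset.mem_union.1 hz with hz | hz
      · obtain ⟨y, -, rfl⟩ := Finset.mem_image.1 hz
        have : g (X (Sum.inl y)) = f (X y) := by simp [g]
        rw [map_sub, this, hgr, sub_self]
        exact Ideal.zero_mem _
      · obtain ⟨q, hq, rfl⟩ := Finset.mem_image.1 hz
        rw [hgr]
        exact Ideal.subset_span hq
    · intro p hp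
      obtain ⟨q, hq, rfl⟩ := Finset.mem_image.1 hp
      rw [hgr]
      exact hull_le_algCone (mem_hull hq)
  · intro hq
    set ZZ : Finset (MvPolynomial (Y ⊕ σ) ℚ) :=
      Finset.univ.image (fun y : Y => X (Sum.inl y) - rename Sum.inr (f (X y))) ∪
        Z.image (rename Sum.inr) with hZZ
    have hdiff : rename Sum.inl q - rename Sum.inr (f q) ∈
        Ideal.span (ZZ : Set (MvPolynomial (Y ⊕ σ) ℚ)) := by
      have : (Ideal.Quotient.mkₐ ℚ (Ideal.span (ZZ : Set (MvPolynomial (Y ⊕ σ) ℚ)))).comp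
          (rename Sum.inl) =
          (Ideal.Quotient.mkₐ ℚ (Ideal.span (ZZ : Set (MvPolynomial (Y ⊕ σ) ℚ)))).comp
            ((rename Sum.inr).comp f) := by
        refine algHom_ext fun y => ?_
        simp only [AlgHom.comp_apply, rename_X, Ideal.Quotient.mkₐ_eq_mk]
        refine Ideal.Quotient.eq.2 (Ideal.subset_span ?_)
        exact Finset.mem_coe.2 (Finset.mem_union_left _ (Finset.mem_image.2 ⟨y, Finset.mem_univ y, rfl⟩))
      exact Ideal.Quotient.eq.1 (DFunLike.congr_fun this q)
    have hsum : rename Sum.inl q =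
        (rename Sum.inl q - rename Sum.inr (f q)) + rename Sum.inr (f q) := by ring
    rw [hsum]
    refine add_mem (span_le_algCone hdiff) ?_
    refine map_mem_of_mem_algCone (rename Sum.inr)
      (Ideal.span (ZZ : Set (MvPolynomial (Y ⊕ σ) ℚ))) (fun p hp => span_le_algCone hp) ?_ ?_ hq
    · intro z hz
      exact Ideal.subset_span (Finset.mem_coe.2 (Finset.mem_union_right _ (Finset.mem_image_of_mem _ hz)))
    · intro p hp
      exact hull_le_algCone (mem_hull (Finset.mem_coe.2 (Finset.mem_image_of_mem _ hp)))

theorem exists_inverseHom {σ Y : Type u} [Finite σ] [Fintype Y] (Z P : Finset (MvPolynomial σ ℚ))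
    (f : MvPolynomial Y ℚ →ₐ[ℚ] MvPolynomial σ ℚ) : ∃ Z' P', InverseHom Z P f Z' P' :=
  exists_project _ _

/-! ### Cutting planes for polynomials -/

section PolynomialCuts

theorem intCast_eq_smul_one {σ : Type*} (n : ℤ) : (n : MvPolynomial σ ℚ) = (n : ℚ) • 1 := by
  rw [smul_eq_C_mul, mul_one, map_intCast]

/-- Scaling by `a` translates integer pairs `a`, `b` into the rational constant `b / a`; conversely,
a rational constant is written with its denominator and numerator. -/
theorem closedUnderCuts_iff {σ : Type u} {Λ : AddSubgroup (MvPolynomial σ ℚ)}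
    {D : PointedCone ℚ (MvPolynomial σ ℚ)} :
    ClosedUnderCuts (Λ : Set (MvPolynomial σ ℚ)) (D : Set (MvPolynomial σ ℚ)) ↔
      CutClosed 1 Λ D := by
  constructor
  · intro h p hp c hc
    have h1 := h c.den c.num (by exact_mod_cast c.den_pos) p hp ?_
    · rw [intCast_eq_smul_one] at h1
      simpa [Rat.num_div_den] using h1
    · have : ((c.den : ℤ) : MvPolynomial σ ℚ) * p + (c.num : MvPolynomial σ ℚ) =
          (c.den : ℚ) • (p + c • 1) := by
        rw [intCast_eq_smul_one, intCast_eq_smul_one, smul_one_mul, smul_add, smul_smul,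
          Rat.den_mul_eq_num]
        push_cast
        rfl
      rw [this]
      exact smul_mem_cone _ (by positivity) hc
  · intro h a b ha p hp hab
    rw [intCast_eq_smul_one]
    refine h p hp _ ?_
    have ha' : (0 : ℚ) < a := by exact_mod_cast ha
    rw [← smul_mem_cone_iff D ha', smul_add, smul_smul, mul_div_cancel₀ _ ha'.ne',
      ← intCast_eq_smul_one, ← smul_one_mul, ← intCast_eq_smul_one]
    exact hab

theorem cutClosed_cpClosure {σ : Type u} (Λ : AddSubgroup (MvPolynomial σ ℚ))
    (C : PointedCone ℚ (MvPolynomial σ ℚ)) : CutClosed 1 Λ (cpClosure Λ C) :=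
  closedUnderCuts_iff.1 (isLeast_cpClosure _ C).1.2

theorem cpClosure_le {σ : Type u} {Λ : AddSubgroup (MvPolynomial σ ℚ)}
    {C D : PointedCone ℚ (MvPolynomial σ ℚ)} (h : C ≤ D) (hD : CutClosed 1 Λ D) :
    cpClosure Λ C ≤ D :=
  (isLeast_cpClosure _ C).2 ⟨h, closedUnderCuts_iff.2 hD⟩

theorem le_cpClosure {σ : Type u} (Λ : AddSubgroup (MvPolynomial σ ℚ))
    (C : PointedCone ℚ (MvPolynomial σ ℚ)) : C ≤ cpClosure Λ C :=
  (isLeast_cpClosure _ C).1.1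

/-- The cutting plane closure of a finitely generated cone of polynomials of degree at most one is
finitely generated. -/
theorem exists_cutPolyhedral {Y : Type u} [Fintype Y] (P : Finset (MvPolynomial Y ℚ))
    (hP : ∀ p ∈ P, p ∈ Submodule.span ℚ (Set.range (X : Y → MvPolynomial Y ℚ) ∪ {1})) :
    ∃ P', CutPolyhedral P P' := by
  classical
  set S : Set (MvPolynomial Y ℚ) := Set.range (X : Y → MvPolynomial Y ℚ) ∪ {1} with hS
  set U := Submodule.span ℚ S with hU
  have hSfin : S.Finite := (Set.finite_range _).union (Set.finite_singleton _)
  -- The polyhedral theorem is applied in the finite-dimensional space `U` of polynomials of degree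
  -- at most one, and its result is transported along the inclusion.
  have : FiniteDimensional ℚ U := FiniteDimensional.span_of_finite ℚ hSfin
  let x : Y → U := fun y => ⟨X y, Submodule.subset_span (Or.inl ⟨y, rfl⟩)⟩
  let e : U := ⟨1, Submodule.subset_span (Or.inr rfl)⟩
  set Λ : AddSubgroup U := AddSubgroup.closure (Set.range x) with hΛ
  have hΛfg : Λ.FG := ⟨Finset.univ.image x, by simp [hΛ]⟩
  have hspan : Submodule.span ℚ (Λ : Set U) ⊔ Submodule.span ℚ {e} = ⊤ := by
    rw [eq_top_iff, ← Submodule.span_span_coe_preimage (R := ℚ) (s := S)]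
    refine Submodule.span_le.2 fun v hv => ?_
    rcases hv with ⟨y, hy⟩ | hv
    · exact Submodule.mem_sup_left (Submodule.subset_span
        (AddSubgroup.subset_closure ⟨y, Subtype.ext hy⟩))
    · refine Submodule.mem_sup_right (Submodule.subset_span ?_)
      exact Subtype.ext hv
  obtain ⟨D, ⟨T, hT⟩, ⟨hCD, hD⟩, hleast⟩ := exists_fg_isLeast_cutClosed (e := e) hΛfg hspan
    (C := PointedCone.hull ℚ ((fun v : U => (v : MvPolynomial Y ℚ)) ⁻¹' (P : Set _)))
    (fg_hull (P.finite_toSet.preimage Subtype.val_injective.injOn))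
  have hTD : PointedCone.hull ℚ (T : Set U) = D := hT
  refine ⟨T.image U.subtype, ?_⟩
  have hLat : intSpan (Set.range (X : Y → MvPolynomial Y ℚ)) =
      Λ.map (U.subtype : U →+ MvPolynomial Y ℚ) := by
    rw [hΛ, AddMonoidHom.map_closure, ← Set.range_comp]
    rfl
  have hmemD : ∀ v : U, v ∈ D → (v : MvPolynomial Y ℚ) ∈
      PointedCone.hull ℚ ((T.image U.subtype : Finset _) : Set (MvPolynomial Y ℚ)) := by
    intro v hv
    rw [Finset.coe_image]
    exact map_mem_hull_image U.subtype (hTD ▸ hv)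
  rw [CutPolyhedral]
  refine le_antisymm ?_ (cpClosure_le (hull_le fun p hp => ?_) ?_)
  · have hle : D ≤ PointedCone.comap U.subtype
        (cpClosure (intSpan (Set.range (X : Y → MvPolynomial Y ℚ)))
          (PointedCone.hull ℚ (P : Set (MvPolynomial Y ℚ)))) := by
      refine hleast ⟨hull_le fun v hv => ?_, ?_⟩
      · exact le_cpClosure _ _ (mem_hull hv)
      · intro p hp c hc
        refine cutClosed_cpClosure _ _ (p : MvPolynomial Y ℚ) ?_ c hc
        rw [hLat]
        exact ⟨p, hp, rfl⟩
    refine hull_le fun p hp => ?_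
    obtain ⟨v, hv, rfl⟩ := Finset.mem_image.1 (Finset.mem_coe.1 hp)
    exact hle (hTD ▸ mem_hull hv)
  · exact hmemD ⟨p, hP p hp⟩ (hCD (mem_hull hp))
  · intro p hp c hc
    rw [hLat] at hp
    obtain ⟨q, hq, rfl⟩ := hp
    rw [Finset.coe_image] at hc
    obtain ⟨v, hv, hvc⟩ := exists_of_mem_hull_image U.subtype hc
    have hvq : v = q + c • e := Subtype.ext hvc
    rw [hTD, hvq] at hv
    exact hmemD _ (hD q hq c hv)

end PolynomialCuts

/-! ### The procedure `cut` -/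

section CutProcedure

variable {σ : Type u} {Z P B P' : Finset (MvPolynomial σ ℚ)}

theorem map_evalB_intSpan (B : Finset (MvPolynomial σ ℚ)) :
    (intSpan (Set.range (X : B → MvPolynomial B ℚ))).map
      ((evalB B).toLinearMap : MvPolynomial B ℚ →+ MvPolynomial σ ℚ) =
      intSpan (B : Set (MvPolynomial σ ℚ)) := by
  rw [intSpan, intSpan, AddMonoidHom.map_closure, ← Set.range_comp]
  congr 1
  ext b
  constructor
  · rintro ⟨b, rfl⟩
    have : evalB B (X b) = b := by simp [evalB]
    change evalB B (X b) ∈ B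
    rw [this]
    exact b.2
  · intro hb
    exact ⟨⟨b, hb⟩, by simp [evalB]⟩

theorem exists_cut [Finite σ] (Z P B : Finset (MvPolynomial σ ℚ)) : ∃ P', Cut Z P B P' := by
  classical
  obtain ⟨Z₁, P₁, h1⟩ := exists_inverseHom Z P (evalB B)
  obtain ⟨P₂, h2⟩ := exists_intersectSubspace Z₁ P₁
  obtain ⟨P₃, h3⟩ := exists_cutPolyhedral P₂ fun p hp =>
    mem_hull_linGens_iff.1 (h2.mem_hull.1 (mem_hull hp)).2
  exact ⟨_, Z₁, P₁, P₂, P₃, h1, h2, h3, rfl⟩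

/-- The cutting planes that `cut` computes are sound. -/
theorem Cut.mem_of_cutClosed (h : Cut Z P B P') {C : PointedCone ℚ (MvPolynomial σ ℚ)}
    (hle : algCone Z P ≤ C) (hC : CutClosed 1 (intSpan (B : Set (MvPolynomial σ ℚ))) C) :
    ∀ p ∈ P', p ∈ C := by
  classical
  obtain ⟨Z₁, P₁, P₂, P₃, h1, h2, h3, rfl⟩ := h
  -- The pullback of `C` along `evalB B` is closed under cuts, since `evalB B` maps `ℤY` onto `ℤB`
  -- and fixes constants.
  have hle' : PointedCone.hull ℚ (P₃ : Set (MvPolynomial B ℚ)) ≤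
      PointedCone.comap (evalB B).toLinearMap C := by
    rw [h3]
    refine cpClosure_le (fun q hq => hle (h1.mem_algCone.1 (h2.mem_hull.1 hq).1)) ?_
    intro q hq c hc
    have hc' : evalB B q + c • 1 ∈ C := by
      have : evalB B (q + c • 1) ∈ C := hc
      rwa [map_add, map_smul, map_one] at this
    have := hC (evalB B q) (by rw [← map_evalB_intSpan]; exact ⟨q, hq, rfl⟩) c hc'
    change evalB B (q + ((⌊c⌋ : ℤ) : ℚ) • 1) ∈ C
    rwa [map_add, map_smul, map_one]
  intro p hp
  obtain ⟨q, hq, rfl⟩ := Finset.mem_image.1 hp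
  exact hle' (mem_hull hq)

/-- The cutting planes that `cut` computes are complete. -/
theorem Cut.cutClosed_sup (h : Cut Z P B P') :
    CutClosed 1 (intSpan (B : Set (MvPolynomial σ ℚ)))
      (algCone Z P ⊔ PointedCone.hull ℚ (P' : Set (MvPolynomial σ ℚ))) := by
  classical
  obtain ⟨Z₁, P₁, P₂, P₃, h1, h2, h3, rfl⟩ := h
  set U := Submodule.span ℚ (Set.range (X : B → MvPolynomial B ℚ) ∪ {1}) with hU
  have h1U : (1 : MvPolynomial B ℚ) ∈ U := Submodule.subset_span (Or.inr rfl)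
  have hintU : ∀ q ∈ intSpan (Set.range (X : B → MvPolynomial B ℚ)), q ∈ U := by
    have : intSpan (Set.range (X : B → MvPolynomial B ℚ)) ≤ U.toAddSubgroup :=
      (AddSubgroup.closure_le _).2 fun x hx => Submodule.subset_span (Or.inl hx)
    exact this
  have hKU : ∀ q ∈ PointedCone.hull ℚ (P₃ : Set (MvPolynomial B ℚ)), q ∈ U := by
    have : PointedCone.hull ℚ (P₃ : Set (MvPolynomial B ℚ)) ≤ PointedCone.ofSubmodule U := by
      rw [h3]
      refine cpClosure_le (fun q hq => mem_hull_linGens_iff.1 (h2.mem_hull.1 hq).2) ?_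
      intro q hq c _
      exact U.add_mem (hintU q hq) (U.smul_mem _ h1U)
    exact this
  have himage : ∀ q, q ∈ PointedCone.hull ℚ (P₃ : Set (MvPolynomial B ℚ)) →
      evalB B q ∈ PointedCone.hull ℚ ((P₃.image (evalB B) : Finset _) : Set (MvPolynomial σ ℚ)) := by
    intro q hq
    rw [Finset.coe_image]
    exact map_mem_hull_image (evalB B).toLinearMap hq
  intro p hp c hc
  rw [← map_evalB_intSpan] at hp
  obtain ⟨q, hq, rfl⟩ := hp
  obtain ⟨x, hx, y, hy, hxy⟩ := Submodule.mem_sup.1 hc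
  rw [Finset.coe_image] at hy
  obtain ⟨k, hk, rfl⟩ := exists_of_mem_hull_image (evalB B).toLinearMap hy
  have hx' : evalB B (q + c • 1 - k) = x := by
    rw [map_sub, map_add, map_smul, map_one]
    exact sub_eq_of_eq_add hxy.symm
  -- After the contribution `k` of `P₃` is subtracted, what remains is linear with image in the
  -- algebraic cone, so it belongs to the cone of `P₂`. Adding `k` back stays within the closure,
  -- where the cut is available.
  have hP₂ : q + c • 1 - k ∈ PointedCone.hull ℚ (P₂ : Set (MvPolynomial B ℚ)) :=
    h2.mem_hull.2 ⟨h1.mem_algCone.2 (hx' ▸ hx), mem_hull_linGens_iff.2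
      (U.sub_mem (U.add_mem (hintU q hq) (U.smul_mem _ h1U)) (hKU k hk))⟩
  have hP₃ : q + c • 1 ∈ PointedCone.hull ℚ (P₃ : Set (MvPolynomial B ℚ)) := by
    have h4 : q + c • 1 - k ∈ PointedCone.hull ℚ (P₃ : Set (MvPolynomial B ℚ)) := by
      rw [h3]; exact le_cpClosure _ _ hP₂
    have := add_mem h4 hk
    rwa [sub_add_cancel] at this
  have hcut : q + ((⌊c⌋ : ℤ) : ℚ) • 1 ∈ PointedCone.hull ℚ (P₃ : Set (MvPolynomial B ℚ)) := by
    have hcl : CutClosed 1 (intSpan (Set.range (X : B → MvPolynomial B ℚ)))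
        (PointedCone.hull ℚ (P₃ : Set (MvPolynomial B ℚ))) := by
      rw [h3]; exact cutClosed_cpClosure _ _
    exact hcl q hq c hP₃
  have := himage _ hcut
  rw [map_add, map_smul, map_one] at this
  exact Submodule.mem_sup_right this

end CutProcedure

/-! ### Sound cones -/

section Sound

variable {σ : Type u} {B B' : AddSubgroup (MvPolynomial σ ℚ)}
  {C : PointedCone ℚ (MvPolynomial σ ℚ)}

theorem CutClosed.mono {V : Type*} [AddCommGroup V] [Module ℚ V] {e : V} {Λ Λ' : AddSubgroup V}
    {E : PointedCone ℚ V} (hE : CutClosed e Λ' E) (h : Λ ≤ Λ') : CutClosed e Λ E :=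
  fun p hp => hE p (h hp)

/-- The unit part of `p` can be removed before the cut and put back afterwards. -/
theorem CutClosed.sup_lineal {V : Type*} [AddCommGroup V] [Module ℚ V] {e : V}
    {Λ : AddSubgroup V} {E : PointedCone ℚ V} (hE : CutClosed e Λ E) :
    CutClosed e (E.lineal.toAddSubgroup ⊔ Λ) E := by
  intro p hp c hc
  obtain ⟨x, hx, q, hq, rfl⟩ := AddSubgroup.mem_sup.1 hp
  have h1 : q + c • e ∈ E := by
    have : q + c • e = (x + q + c • e) + -x := by abel
    rw [this]; exact add_mem hc hx.2
  rw [add_assoc]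
  exact add_mem hx.1 (hE q hq c h1)

/-- `C` is regular and closed under cutting planes with respect to `units(C) + B`. -/
def IsRegularCutClosed (B : AddSubgroup (MvPolynomial σ ℚ))
    (C : PointedCone ℚ (MvPolynomial σ ℚ)) : Prop :=
  IsRegularCone C ∧ CutClosed 1 (C.lineal.toAddSubgroup ⊔ B) C

theorem IsRegularCutClosed.mono (hC : IsRegularCutClosed B C)
    (h : B' ≤ C.lineal.toAddSubgroup ⊔ B) : IsRegularCutClosed B' C :=
  ⟨hC.1, hC.2.mono (sup_le le_sup_left h)⟩

theorem isRegularCutClosed_iff :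
    IsRegularCutClosed B C ↔ IsRegularCone C ∧ ClosedUnderCuts
      ((C.lineal : Set (MvPolynomial σ ℚ)) + (B : Set (MvPolynomial σ ℚ)))
      (C : Set (MvPolynomial σ ℚ)) := by
  have : (C.lineal : Set (MvPolynomial σ ℚ)) + (B : Set (MvPolynomial σ ℚ)) =
      ((C.lineal.toAddSubgroup ⊔ B : AddSubgroup _) : Set (MvPolynomial σ ℚ)) := by
    ext x
    rw [SetLike.mem_coe, AddSubgroup.mem_sup, Set.mem_add]
    rfl
  rw [this, closedUnderCuts_iff, IsRegularCutClosed]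

/-- In a regular cone, the ideal generated by additive units consists of additive units. -/
theorem IsRegularCone.span_le (hC : IsRegularCone C) {S : Set (MvPolynomial σ ℚ)}
    (hS : ∀ p ∈ S, p ∈ C.lineal) {p : MvPolynomial σ ℚ} (hp : p ∈ Ideal.span S) :
    p ∈ C.lineal := by
  obtain ⟨I, hI⟩ := hC.2
  have hmem : ∀ p, p ∈ I ↔ p ∈ C.lineal := fun p => Set.ext_iff.1 hI p
  exact (hmem p).1 (Ideal.span_le.2 (fun q hq => (hmem q).2 (hS q hq)) hp)

theorem span_le_lineal_of_algCone_le {Z P : Finset (MvPolynomial σ ℚ)} (h : algCone Z P ≤ C)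
    {p : MvPolynomial σ ℚ} (hp : p ∈ Ideal.span (Z : Set (MvPolynomial σ ℚ))) : p ∈ C.lineal :=
  ⟨h (span_le_algCone hp), h (span_le_algCone (Ideal.neg_mem_iff _ |>.2 hp))⟩

end Sound

/-! ### The loop of `saturate` -/

section Saturate

variable {σ : Type u} {m : MonomialOrder.{u, w} σ} {Z P Z' P' : Finset (MvPolynomial σ ℚ)}

theorem ReduceCone.red_mem (h : ReduceCone m Z P Z' P') {p : MvPolynomial σ ℚ} (hp : p ∈ P)
    (h0 : red m Z' p ≠ 0) : red m Z' p ∈ P' := by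
  classical
  rw [h.2]
  exact Finset.mem_filter.2 ⟨Finset.mem_image_of_mem _ hp, h0⟩

theorem ReduceCone.exists_of_mem (h : ReduceCone m Z P Z' P') {q : MvPolynomial σ ℚ}
    (hq : q ∈ P') : ∃ p ∈ P, red m Z' p = q := by
  classical
  rw [h.2] at hq
  exact Finset.mem_image.1 (Finset.mem_filter.1 hq).1

theorem ReduceCone.isNormalForm (h : ReduceCone m Z P Z' P') :
    ∀ q ∈ P', IsNormalForm m Z' q := by
  intro q hq
  obtain ⟨p, -, rfl⟩ := h.exists_of_mem hq
  exact isNormalForm_red p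

/-- The procedure `reduce` does not change the algebraic cone. -/
theorem ReduceCone.algCone_eq (h : ReduceCone m Z P Z' P') : algCone Z' P' = algCone Z P := by
  have hspan := h.1.1
  refine le_antisymm (algCone_le (fun p hp => span_le_algCone (hspan ▸ hp)) fun q hq => ?_)
    (algCone_le (fun p hp => span_le_algCone (hspan.symm ▸ hp)) fun p hp => ?_)
  · obtain ⟨p, hp, rfl⟩ := h.exists_of_mem hq
    have : red m Z' p = -(p - red m Z' p) + p := by ring
    rw [this]
    exact add_mem (span_le_algCone (Ideal.neg_mem_iff _ |>.2 (hspan ▸ sub_red_mem p)))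
      (hull_le_algCone (mem_hull hp))
  · have : p = (p - red m Z' p) + red m Z' p := by ring
    rw [this]
    refine add_mem (span_le_algCone (sub_red_mem p)) ?_
    by_cases h0 : red m Z' p = 0
    · rw [h0]; exact zero_mem _
    · exact hull_le_algCone (mem_hull (h.red_mem hp h0))

/-- The chosen unit is a nonzero normal form modulo `Z`, hence outside of `⟨Z⟩`. This drives the
termination of `saturate`. -/
theorem SaturateStep.span_lt (h : SaturateStep m Z P Z' P')
    (hZ : IsGroebner m (Z : Set (MvPolynomial σ ℚ))) (hP : ∀ p ∈ P, IsNormalForm m Z p) :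
    Ideal.span (Z : Set (MvPolynomial σ ℚ)) < Ideal.span (Z' : Set (MvPolynomial σ ℚ)) := by
  classical
  obtain ⟨t, ht, ht0, hred⟩ := h
  rw [hred.1.1]
  refine lt_of_le_of_ne (Ideal.span_mono (by simp)) fun heq => ht0 ?_
  refine (isNormalForm_of_mem_hull hP ht.1).eq_zero hZ ?_
  rw [heq]
  exact Ideal.subset_span (by simp)

theorem SaturateStep.algCone_le_algCone (h : SaturateStep m Z P Z' P') :
    algCone Z P ≤ algCone Z' P' := by
  classical
  obtain ⟨t, -, -, hred⟩ := h
  rw [hred.algCone_eq]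
  exact algCone_le (fun p hp => span_le_algCone (Ideal.span_mono (by simp) hp))
    fun p hp => hull_le_algCone (mem_hull hp)

/-- Since `t` and `-t` lie in `C`, regularity puts all multiples of `t` into `C`. -/
theorem SaturateStep.algCone_le_of_isRegularCone (h : SaturateStep m Z P Z' P')
    {C : PointedCone ℚ (MvPolynomial σ ℚ)} (hC : IsRegularCone C) (hle : algCone Z P ≤ C) :
    algCone Z' P' ≤ C := by
  classical
  obtain ⟨t, ht, -, hred⟩ := h
  rw [hred.algCone_eq]
  refine algCone_le (fun p hp => (hC.span_le ?_ hp).1) fun p hp => hle (hull_le_algCone (mem_hull hp))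
  intro q hq
  rcases Finset.mem_union.1 (Finset.mem_coe.1 hq) with hq | hq
  · exact span_le_lineal_of_algCone_le hle (Ideal.subset_span hq)
  · rw [Finset.mem_singleton.1 hq]
    exact ⟨hle (hull_le_algCone ht.1), hle (hull_le_algCone ht.2)⟩

/-- Apart from the growing ideal, a step adds nothing to the generators `Q` that the loop started
with. -/
theorem SaturateStep.algCone_le_of_le (h : SaturateStep m Z P Z' P')
    {Q : Finset (MvPolynomial σ ℚ)} (hle : algCone Z P ≤ algCone Z Q) :
    algCone Z' P' ≤ algCone Z' Q := by
  classical
  obtain ⟨t, -, -, hred⟩ := h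
  rw [hred.algCone_eq]
  have hmono : algCone Z Q ≤ algCone Z' Q :=
    algCone_le (fun p hp => span_le_algCone (by
      rw [hred.1.1]; exact Ideal.span_mono (by simp) hp)) fun p hp => hull_le_algCone (mem_hull hp)
  exact algCone_le (fun p hp => span_le_algCone (hred.1.1.symm ▸ hp))
    fun p hp => hmono (hle (hull_le_algCone (mem_hull hp)))

/-- When the loop of `saturate` is left, the additive units form the ideal generated by `Z`. -/
theorem SaturateExit.mem_lineal_iff (h : SaturateExit P)
    (hZ : IsGroebner m (Z : Set (MvPolynomial σ ℚ))) (hP : ∀ p ∈ P, IsNormalForm m Z p)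
    {p : MvPolynomial σ ℚ} :
    p ∈ (algCone Z P).lineal ↔ p ∈ Ideal.span (Z : Set (MvPolynomial σ ℚ)) := by
  refine ⟨fun hp => ?_, span_le_lineal_of_algCone_le le_rfl⟩
  obtain ⟨i, hi, c, hc, hp1⟩ := mem_algCone.1 hp.1
  obtain ⟨j, hj, d, hd, hp2⟩ := mem_algCone.1 hp.2
  -- The sum is a normal form in the ideal; its vanishing makes `c` a unit of `cone(P)`, which is
  -- zero by the exit condition.
  have hcd : c + d = 0 := by
    refine (isNormalForm_of_mem_hull hP (add_mem hc hd)).eq_zero hZ ?_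
    have : c + d = -(i + j) := by linear_combination hp1 + hp2
    rw [this]
    exact Ideal.neg_mem_iff _ |>.2 (Ideal.add_mem _ hi hj)
  have hc0 : c = 0 := h c ⟨hc, show -c ∈ PointedCone.hull ℚ (P : Set (MvPolynomial σ ℚ)) by
    rwa [neg_eq_of_add_eq_zero_right hcd]⟩
  rwa [← hp1, hc0, add_zero]

theorem SaturateExit.isRegularCone (h : SaturateExit P)
    (hZ : IsGroebner m (Z : Set (MvPolynomial σ ℚ))) (hP : ∀ p ∈ P, IsNormalForm m Z p)
    (h1 : 1 ∈ algCone Z P) : IsRegularCone (algCone Z P) :=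
  ⟨h1, Ideal.span (Z : Set (MvPolynomial σ ℚ)), Set.ext fun _ => (h.mem_lineal_iff hZ hP).symm⟩

theorem exists_saturateStep [Finite σ] (m : MonomialOrder.{u, w} σ)
    (Z P : Finset (MvPolynomial σ ℚ)) (h : ¬ SaturateExit P) :
    ∃ Z' P', SaturateStep m Z P Z' P' := by
  classical
  unfold SaturateExit at h
  push Not at h
  obtain ⟨t, ht, ht0⟩ := h
  obtain ⟨G, hG⟩ := exists_isGroebnerFor m (Z ∪ {t})
  exact ⟨G, _, t, ht, ht0, hG, rfl⟩

end Saturate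

/-! ### Invariants of `rcp` -/

section Run

variable {σ : Type u} {m : MonomialOrder.{u, w} σ}

theorem exists_isLatticeBasis (B : Finset (MvPolynomial σ ℚ)) : ∃ B', IsLatticeBasis B B' :=
  exists_lattice_basis (Λ := intSpan (B : Set (MvPolynomial σ ℚ))) ⟨B, rfl⟩

open scoped Classical in
/-- The generators with which `saturate` is started. -/
noncomputable def satInit (Z₀ P₀ P₁ : Finset (MvPolynomial σ ℚ)) : Finset (MvPolynomial σ ℚ) :=
  (Z₀ ∪ Z₀.image (fun z => -z) ∪ P₀ ∪ P₁) ∪ {1}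

/-- The invariant of the loop of `saturate` in an iteration of `rcp`. -/
structure SaturateInv (m : MonomialOrder.{u, w} σ) (Z₀ P₀ B' P₁ Z P : Finset (MvPolynomial σ ℚ)) :
    Prop where
  cut : Cut Z₀ P₀ B' P₁
  groebner : IsGroebner m (Z : Set (MvPolynomial σ ℚ))
  normal : ∀ p ∈ P, IsNormalForm m Z p
  init_mem : ∀ p ∈ satInit Z₀ P₀ P₁, p ∈ algCone Z P
  le_init : algCone Z P ≤ algCone Z (satInit Z₀ P₀ P₁)
  sound : ∀ C, IsRegularCutClosed (intSpan (B' : Set (MvPolynomial σ ℚ))) C →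
    algCone Z₀ P₀ ≤ C → algCone Z P ≤ C

variable {Z₀ P₀ B' P₁ Z P : Finset (MvPolynomial σ ℚ)}

theorem saturateInv_init (hcut : Cut Z₀ P₀ B' P₁) :
    SaturateInv m Z₀ P₀ B' P₁ ∅ (satInit Z₀ P₀ P₁) where
  cut := hcut
  groebner := by rw [Finset.coe_empty]; exact isGroebner_empty
  normal p _ := by simp [IsNormalForm]
  init_mem p hp := hull_le_algCone (mem_hull hp)
  le_init := le_rfl
  sound C hC hle := by
    classical
    refine algCone_le (fun p hp => ?_) fun p hp => ?_
    · have : p = 0 := by simpa using hp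
      rw [this]; exact zero_mem _
    · simp only [satInit, Finset.mem_union, Finset.mem_image, Finset.mem_singleton] at hp
      rcases hp with (((hp | ⟨z, hz, rfl⟩) | hp) | hp) | rfl
      · exact hle (span_le_algCone (Ideal.subset_span hp))
      · exact hle (span_le_algCone (Ideal.neg_mem_iff _ |>.2 (Ideal.subset_span hz)))
      · exact hle (hull_le_algCone (mem_hull hp))
      · exact hcut.mem_of_cutClosed hle (hC.2.mono le_sup_right) p hp
      · exact hC.1.1

theorem SaturateInv.step (h : SaturateInv m Z₀ P₀ B' P₁ Z P) {Z' P' : Finset (MvPolynomial σ ℚ)}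
    (hstep : SaturateStep m Z P Z' P') : SaturateInv m Z₀ P₀ B' P₁ Z' P' where
  cut := h.cut
  groebner := by obtain ⟨t, -, -, hred⟩ := hstep; exact hred.1.2
  normal := by obtain ⟨t, -, -, hred⟩ := hstep; exact hred.isNormalForm
  init_mem p hp := hstep.algCone_le_algCone (h.init_mem p hp)
  le_init := hstep.algCone_le_of_le h.le_init
  sound C hC hle := hstep.algCone_le_of_isRegularCone hC.1 (h.sound C hC hle)

theorem SaturateInv.one_mem (h : SaturateInv m Z₀ P₀ B' P₁ Z P) : 1 ∈ algCone Z P := by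
  classical
  exact h.init_mem 1 (by simp [satInit])

theorem SaturateInv.cut_mem (h : SaturateInv m Z₀ P₀ B' P₁ Z P) :
    ∀ p ∈ P₁, p ∈ algCone Z P := by
  classical
  exact fun p hp => h.init_mem p (by simp [satInit, hp])

/-! ### Consequences of leaving the loop of `saturate` -/

section Exit

variable (h : SaturateInv m Z₀ P₀ B' P₁ Z P) (hexit : SaturateExit P)
include h hexit

theorem SaturateInv.isRegularCone : IsRegularCone (algCone Z P) :=
  hexit.isRegularCone h.groebner h.normal h.one_mem

theorem SaturateInv.mem_lineal_iff {p : MvPolynomial σ ℚ} :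
    p ∈ (algCone Z P).lineal ↔ p ∈ Ideal.span (Z : Set (MvPolynomial σ ℚ)) :=
  hexit.mem_lineal_iff h.groebner h.normal

/-- Both `Z₀` and `-Z₀` are among the initial generators, so `Z₀` consists of units, and on exit the
units form `⟨Z⟩`. -/
theorem SaturateInv.span_le :
    Ideal.span (Z₀ : Set (MvPolynomial σ ℚ)) ≤ Ideal.span (Z : Set (MvPolynomial σ ℚ)) := by
  classical
  refine Ideal.span_le.2 fun z hz => (h.mem_lineal_iff hexit).1 ⟨?_, ?_⟩
  · exact h.init_mem z (by simp [satInit, Finset.mem_coe.1 hz])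
  · exact h.init_mem (-z) (by simp [satInit, Finset.mem_coe.1 hz])

theorem SaturateInv.le_algCone : algCone Z₀ P₀ ≤ algCone Z P := by
  classical
  refine algCone_le (fun p hp => span_le_algCone (h.span_le hexit hp)) fun p hp => ?_
  exact h.init_mem p (by simp [satInit, hp])

/-- Each `b` differs from its reduction by an element of the ideal, that is, by a unit; thus the old
and the new lattice agree modulo units. -/
theorem SaturateInv.intSpan_le {B'' : Finset (MvPolynomial σ ℚ)}
    (hB : intSpan (B'' : Set (MvPolynomial σ ℚ)) = intSpan (red m Z '' B')) :
    intSpan (B' : Set (MvPolynomial σ ℚ)) ≤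
      (algCone Z P).lineal.toAddSubgroup ⊔ intSpan (B'' : Set (MvPolynomial σ ℚ)) := by
  refine (AddSubgroup.closure_le _).2 fun b hb => ?_
  refine AddSubgroup.mem_sup.2 ⟨b - red m Z b, ?_, red m Z b, ?_, by abel⟩
  · exact (h.mem_lineal_iff hexit).2 (sub_red_mem b)
  · rw [hB]; exact AddSubgroup.subset_closure ⟨b, hb, rfl⟩

theorem SaturateInv.le_intSpan {B'' : Finset (MvPolynomial σ ℚ)}
    (hB : intSpan (B'' : Set (MvPolynomial σ ℚ)) = intSpan (red m Z '' B')) :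
    intSpan (B'' : Set (MvPolynomial σ ℚ)) ≤
      (algCone Z P).lineal.toAddSubgroup ⊔ intSpan (B' : Set (MvPolynomial σ ℚ)) := by
  rw [hB]
  refine (AddSubgroup.closure_le _).2 ?_
  rintro _ ⟨b, hb, rfl⟩
  refine AddSubgroup.mem_sup.2 ⟨-(b - red m Z b), ?_, b, AddSubgroup.subset_closure hb, by abel⟩
  exact AddSubgroup.neg_mem _ ((h.mem_lineal_iff hexit).2 (sub_red_mem b))

/-- If an iteration does not change the ideal, then its result is closed under cutting planes. -/
theorem SaturateInv.isRegularCutClosed_of_span_eq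
    (hspan : Ideal.span (Z : Set (MvPolynomial σ ℚ)) = Ideal.span (Z₀ : Set (MvPolynomial σ ℚ))) :
    IsRegularCutClosed (intSpan (B' : Set (MvPolynomial σ ℚ))) (algCone Z P) := by
  classical
  refine ⟨h.isRegularCone hexit, CutClosed.sup_lineal ?_⟩
  -- With the ideal unchanged, only the cuts and the constant one have been added, so the
  -- completeness of `Cut` applies directly.
  have heq : algCone Z P = algCone Z₀ P₀ ⊔ PointedCone.hull ℚ (P₁ : Set (MvPolynomial σ ℚ)) ⊔
      PointedCone.hull ℚ {1} := by
    refine le_antisymm (h.le_init.trans (algCone_le (fun p hp => ?_) fun p hp => ?_))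
      (sup_le (sup_le (h.le_algCone hexit) (hull_le h.cut_mem)) (hull_le ?_))
    · exact Submodule.mem_sup_left (Submodule.mem_sup_left (span_le_algCone (hspan ▸ hp)))
    · simp only [satInit, Finset.mem_union, Finset.mem_image, Finset.mem_singleton] at hp
      rcases hp with (((hp | ⟨z, hz, rfl⟩) | hp) | hp) | rfl
      · exact Submodule.mem_sup_left (Submodule.mem_sup_left
          (span_le_algCone (Ideal.subset_span hp)))
      · exact Submodule.mem_sup_left (Submodule.mem_sup_left
          (span_le_algCone (Ideal.neg_mem_iff _ |>.2 (Ideal.subset_span hz))))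
      · exact Submodule.mem_sup_left (Submodule.mem_sup_left (hull_le_algCone (mem_hull hp)))
      · exact Submodule.mem_sup_left (Submodule.mem_sup_right (mem_hull hp))
      · exact Submodule.mem_sup_right (mem_hull rfl)
    · rintro _ rfl
      exact h.one_mem
  rw [heq]
  exact h.cut.cutClosed_sup.sup_unit

/-- If an iteration does not change the algebraic cone, then it is closed under cutting planes. -/
theorem SaturateInv.isRegularCutClosed_of_algCone_eq (heq : algCone Z P = algCone Z₀ P₀) :
    IsRegularCutClosed (intSpan (B' : Set (MvPolynomial σ ℚ))) (algCone Z P) := by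
  refine ⟨h.isRegularCone hexit, CutClosed.sup_lineal ?_⟩
  have hsup : algCone Z₀ P₀ ⊔ PointedCone.hull ℚ (P₁ : Set (MvPolynomial σ ℚ)) =
      algCone Z P := by
    rw [← heq]
    exact sup_eq_left.2 (hull_le h.cut_mem)
  rw [← hsup]
  exact h.cut.cutClosed_sup

end Exit

theorem IsLatticeBasis.intSpan_eq_of_image {B B'' : Finset (MvPolynomial σ ℚ)}
    {f : MvPolynomial σ ℚ → MvPolynomial σ ℚ} {_ : DecidableEq (MvPolynomial σ ℚ)}
    (h : IsLatticeBasis (B.image f) B'') :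
    intSpan (B'' : Set (MvPolynomial σ ℚ)) = intSpan (f '' B) := by
  rw [h.2, Finset.coe_image]

/-! ### Termination -/

theorem acc_returned (Z P : Finset (MvPolynomial σ ℚ)) :
    Acc (fun c' c => Step m c c') (.returned Z P) :=
  ⟨_, fun c hc => by cases hc⟩

/-- Noetherian induction on the ideal `⟨Z⟩`; `hnext` takes over when the outer loop is repeated. -/
theorem acc_saturating [Finite σ]
    (hnext : ∀ Z P B'' : Finset (MvPolynomial σ ℚ), SaturateInv m Z₀ P₀ B' P₁ Z P → SaturateExit P →
      intSpan (B'' : Set (MvPolynomial σ ℚ)) = intSpan (red m Z '' B') →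
      algCone Z P ≠ algCone Z₀ P₀ → Acc (fun c' c => Step m c c') (.loop Z P B''))
    (h : SaturateInv m Z₀ P₀ B' P₁ Z P) :
    Acc (fun c' c => Step m c c') (.saturating Z₀ P₀ B' Z P) := by
  induction hI : Ideal.span (Z : Set (MvPolynomial σ ℚ)) using WellFoundedGT.induction
    generalizing Z P with
  | ind I ih =>
  subst hI
  refine ⟨_, fun c hc => ?_⟩
  cases hc with
  | saturate hs => exact ih _ (hs.span_lt h.groebner h.normal) (h.step hs) rfl
  | again hexit hB hne => exact hnext _ _ _ h hexit hB.intSpan_eq_of_image hne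
  | done hexit hB heq => exact acc_returned _ _

/-- If the current algebraic cone is closed under cutting planes, then the loop is left after the
next iteration. -/
theorem acc_loop_of_isRegularCutClosed [Finite σ]
    (h : IsRegularCutClosed (intSpan (B' : Set (MvPolynomial σ ℚ))) (algCone Z₀ P₀)) :
    Acc (fun c' c => Step m c c') (.loop Z₀ P₀ B') := by
  refine ⟨_, fun c hc => ?_⟩
  cases hc with
  | cut hcut =>
    refine acc_saturating (fun Z P B'' hinv hexit _ hne => absurd ?_ hne) (saturateInv_init hcut)
    exact le_antisymm (hinv.sound _ h le_rfl) (hinv.le_algCone hexit)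

/-- Noetherian induction on `⟨Z₀⟩`: an iteration that does not enlarge the ideal yields a closed
cone, after which the loop cannot be repeated again. -/
theorem acc_loop [Finite σ] (Z₀ P₀ B' : Finset (MvPolynomial σ ℚ)) :
    Acc (fun c' c => Step m c c') (.loop Z₀ P₀ B') := by
  induction hI : Ideal.span (Z₀ : Set (MvPolynomial σ ℚ)) using WellFoundedGT.induction
    generalizing Z₀ P₀ B' with
  | ind I ih =>
  subst hI
  refine ⟨_, fun c hc => ?_⟩
  cases hc with
  | cut hcut =>
    refine acc_saturating (fun Z P B'' hinv hexit hB _ => ?_) (saturateInv_init hcut)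
    rcases (hinv.span_le hexit).lt_or_eq with hlt | heq
    · exact ih _ hlt _ _ _ rfl
    · exact acc_loop_of_isRegularCutClosed
        ((hinv.isRegularCutClosed_of_span_eq hexit heq.symm).mono (hinv.le_intSpan hexit hB))

/-! ### Progress and correctness -/

theorem exists_step [Finite σ] (m : MonomialOrder.{u, w} σ) (c : Config σ) :
    (∃ Z P, c = .returned Z P) ∨ ∃ c', Step m c c' := by
  classical
  rcases c with ⟨Z, P, B⟩ | ⟨Z, P, B⟩ | ⟨Z₀, P₀, B', Z, P⟩ | ⟨Z, P⟩
  · obtain ⟨B', hB⟩ := exists_isLatticeBasis B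
    exact Or.inr ⟨_, .init hB⟩
  · obtain ⟨P₁, h⟩ := exists_cut Z P B
    exact Or.inr ⟨_, .cut h⟩
  · right
    by_cases hexit : SaturateExit P
    · obtain ⟨B'', hB⟩ := exists_isLatticeBasis (B'.image (red m Z))
      by_cases heq : algCone Z P = algCone Z₀ P₀
      · exact ⟨_, .done hexit (by convert hB) heq⟩
      · exact ⟨_, .again hexit (by convert hB) heq⟩
    · obtain ⟨Z', P', h⟩ := exists_saturateStep m Z P hexit
      exact ⟨_, .saturate h⟩
  · exact Or.inl ⟨Z, P, rfl⟩

/-- The invariant of the outer loop of a run of `rcp` on `Z`, `P`, `B`. -/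
structure LoopInv (Z P B Z' P' B' : Finset (MvPolynomial σ ℚ)) : Prop where
  le : algCone Z P ≤ algCone Z' P'
  intSpan_le : intSpan (B : Set (MvPolynomial σ ℚ)) ≤
    (algCone Z' P').lineal.toAddSubgroup ⊔ intSpan (B' : Set (MvPolynomial σ ℚ))
  sound : ∀ C, IsRegularCutClosed (intSpan (B : Set (MvPolynomial σ ℚ))) C → algCone Z P ≤ C →
    algCone Z' P' ≤ C ∧ IsRegularCutClosed (intSpan (B' : Set (MvPolynomial σ ℚ))) C

/-- The invariant of a run of `rcp` on `Z`, `P`, `B`. -/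
def ConfigInv (m : MonomialOrder.{u, w} σ) (Z P B : Finset (MvPolynomial σ ℚ)) :
    Config σ → Prop
  | .start Z' P' B' => Z' = Z ∧ P' = P ∧ B' = B
  | .loop Z' P' B' => LoopInv Z P B Z' P' B'
  | .saturating Z₀ P₀ B' Z' P' => LoopInv Z P B Z₀ P₀ B' ∧ ∃ P₁, SaturateInv m Z₀ P₀ B' P₁ Z' P'
  | .returned Z' P' => IsReduced m Z' P' ∧
      IsRegularCutClosed (intSpan (B : Set (MvPolynomial σ ℚ))) (algCone Z' P') ∧
      algCone Z P ≤ algCone Z' P' ∧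
      ∀ C, IsRegularCutClosed (intSpan (B : Set (MvPolynomial σ ℚ))) C → algCone Z P ≤ C →
        algCone Z' P' ≤ C

theorem lineal_mono {C D : PointedCone ℚ (MvPolynomial σ ℚ)} (h : C ≤ D) :
    C.lineal ≤ D.lineal :=
  fun _ hx => ⟨h hx.1, h hx.2⟩

/-- Units of a smaller cone remain units, so the inclusion of lattices modulo units can be chained.
-/
theorem LoopInv.intSpan_le_sup {Z P B Z₀ P₀ B' : Finset (MvPolynomial σ ℚ)}
    (h : LoopInv Z P B Z₀ P₀ B') {C : PointedCone ℚ (MvPolynomial σ ℚ)} (hle : algCone Z₀ P₀ ≤ C)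
    {Λ : AddSubgroup (MvPolynomial σ ℚ)}
    (hΛ : intSpan (B' : Set (MvPolynomial σ ℚ)) ≤ C.lineal.toAddSubgroup ⊔ Λ) :
    intSpan (B : Set (MvPolynomial σ ℚ)) ≤ C.lineal.toAddSubgroup ⊔ Λ :=
  h.intSpan_le.trans (sup_le ((Submodule.toAddSubgroup_mono (lineal_mono hle)).trans le_sup_left) hΛ)

theorem ConfigInv.step {Z P B : Finset (MvPolynomial σ ℚ)} {c c' : Config σ}
    (h : ConfigInv m Z P B c) (hstep : Step m c c') : ConfigInv m Z P B c' := by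
  cases hstep with
  | init hB =>
    obtain ⟨rfl, rfl, rfl⟩ := h
    exact ⟨le_rfl, by rw [hB.2]; exact le_sup_right, fun C hC hle => ⟨hle, by rwa [hB.2]⟩⟩
  | cut hcut => exact ⟨h, _, saturateInv_init hcut⟩
  | saturate hs =>
    obtain ⟨hloop, P₁, hinv⟩ := h
    exact ⟨hloop, P₁, hinv.step hs⟩
  | again hexit hB hne =>
    obtain ⟨hloop, P₁, hinv⟩ := h
    have hB' := hB.intSpan_eq_of_image
    refine ⟨hloop.le.trans (hinv.le_algCone hexit),
      hloop.intSpan_le_sup (hinv.le_algCone hexit) (hinv.intSpan_le hexit hB'),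
      fun C hC hle => ?_⟩
    obtain ⟨h1, h2⟩ := hloop.sound C hC hle
    have h3 := hinv.sound C h2 h1
    -- Reduction changes the lattice by units of the new algebraic cone, and these are units of `C`
    -- because that cone lies in `C`.
    refine ⟨h3, h2.mono ((hinv.le_intSpan hexit hB').trans (sup_le_sup_right ?_ _))⟩
    exact Submodule.toAddSubgroup_mono (lineal_mono h3)
  | done hexit hB heq =>
    obtain ⟨hloop, P₁, hinv⟩ := h
    refine ⟨⟨hinv.groebner, fun p hp => red_eq_self hinv.groebner (hinv.normal p hp)⟩, ?_,
      hloop.le.trans (hinv.le_algCone hexit), fun C hC hle => ?_⟩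
    -- The final cone is closed for the last lattice, which contains the input lattice modulo units.
    · exact (hinv.isRegularCutClosed_of_algCone_eq hexit heq).mono
        (hloop.intSpan_le_sup (hinv.le_algCone hexit) le_sup_right)
    · obtain ⟨h1, h2⟩ := hloop.sound C hC hle
      exact hinv.sound C h2 h1

theorem configInv_of_reachable {Z P B : Finset (MvPolynomial σ ℚ)} {c : Config σ}
    (h : Relation.ReflTransGen (Step m) (.start Z P B) c) : ConfigInv m Z P B c := by
  induction h with
  | refl => exact ⟨rfl, rfl, rfl⟩
  | tail _ hstep ih => exact ih.step hstep

end Run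

end RCP

/-- Total correctness of the algorithm: every run of `rcp(Z, P, B)` is finite, no run gets stuck
before it has returned a result, and every result that a run returns is correct. -/
theorem mainTheorem7 {σ : Type u} [Finite σ] (m : MonomialOrder.{u, w} σ)
    (Z P B : Finset (MvPolynomial σ ℚ)) (hZP : RCP.IsReduced m Z P) :
    Acc (fun c' c => RCP.Step m c c') (RCP.Config.start Z P B) ∧
    (∀ c : RCP.Config σ,
      Relation.ReflTransGen (RCP.Step m) (RCP.Config.start Z P B) c →
        (∃ Z' P' : Finset (MvPolynomial σ ℚ), c = RCP.Config.returned Z' P') ∨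
          ∃ c' : RCP.Config σ, RCP.Step m c c') ∧
    (∀ Z' P' : Finset (MvPolynomial σ ℚ),
      Relation.ReflTransGen (RCP.Step m) (RCP.Config.start Z P B) (RCP.Config.returned Z' P') →
        RCP.IsReduced m Z' P' ∧
        IsLeast {C : PointedCone ℚ (MvPolynomial σ ℚ) |
          RCP.IsRegularCone C ∧ RCP.algCone Z P ≤ C ∧
            RCP.ClosedUnderCuts
              ((C.lineal : Set (MvPolynomial σ ℚ)) +
                (RCP.intSpan (B : Set (MvPolynomial σ ℚ)) : Set (MvPolynomial σ ℚ)))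
              (C : Set (MvPolynomial σ ℚ))}
          (RCP.algCone Z' P')) := by
  refine ⟨⟨_, fun c hc => ?_⟩, fun c _ => RCP.exists_step m c, fun Z' P' h => ?_⟩
  · cases hc with
    | init hB => exact RCP.acc_loop _ _ _
  · obtain ⟨hred, hreg, hle, hleast⟩ := RCP.configInv_of_reachable h
    have hreg' := RCP.isRegularCutClosed_iff.1 hreg
    exact ⟨hred, ⟨hreg'.1, hle, hreg'.2⟩, fun C hC =>
      hleast C (RCP.isRegularCutClosed_iff.2 ⟨hC.1, hC.2.2⟩) hC.2.1⟩
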